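/- Let $n\ge 0$, let $\hat{\mathcal O}_n=\mathbb C[[x_1,\dots,x_n]]$ with maximal ideal $\mathfrak m$. Let $\widehat{\mathrm{Diff}}(\mathbb C^n,0)$ be the group of formal diffeomorphisms, i.e. of $n$-tuples $\varphi\in\mathfrak m\times\cdots\times\mathfrak m$ with invertible linear part, each identified with the automorphism $f\mapsto f\circ\varphi$ of the $\mathbb C$-algebra $\hat{\mathcal O}_n$. Let $\hat{\mathfrak X}(\mathbb C^n,0)$ be the complex Lie algebra of formal vector fields, i.e. of $\mathbb C$-derivations $X$ of $\hat{\mathcal O}_n$ with $X(\mathfrak m)\subset\mathfrak m$. For $k\ge 1$ such $\varphi$ and $X$ induce $\varphi_k\in\mathrm{GL}(\mathfrak m/\mathfrak m^{k+1})$ and $X_k\in\mathrm{End}(\mathfrak m/\mathfrak m^{k+1})$. A formal diffeomorphism $\varphi$ is unipotent if its linear part is unipotent, and $X$ is nilpotent if its linear part is nilpotent; $\widehat{\mathrm{Diff}}_u(\mathbb C^n,0)$ and $\hat{\mathfrak X}_N(\mathbb C^n,0)$ denote the corresponding sets, and a subgroup is unipotent if all its elements are. The Krull topologies have as basic open sets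 the sets of all $\varphi$ (resp. $X$) with prescribed $k$-jet, $k\in\mathbb N$. For $X\in\hat{\mathfrak X}_N(\mathbb C^n,0)$, $\exp(X)$ is the formal diffeomorphism with components $\sum_{j\ge 0} X^j(x_i)/j!$, $1\le i\le n$; for $\varphi\in\widehat{\mathrm{Diff}}_u(\mathbb C^n,0)$, $\log\varphi$ is the unique element of $\hat{\mathfrak X}_N(\mathbb C^n,0)$ with $\exp(\log\varphi)=\varphi$, and $\varphi^t=\exp(t\log\varphi)$ for $t\in\mathbb C$. For a subgroup $G$ of $\widehat{\mathrm{Diff}}(\mathbb C^n,0)$ let $D_k=\{\varphi_k : \varphi\in\widehat{\mathrm{Diff}}(\mathbb C^n,0)\}$, let $G_k$ be the smallest algebraic (Zariski-closed) subgroup of $D_k$ containing $\{\varphi_k:\varphi\in G\}$, and let $\mathfrak g_k$ be the Lie algebra of the algebraic group $G_k$. The pro-algebraic closure of $G$ is $\overline G^{(0)}=\{\varphi:\varphi_k\in G_k\ \forall k\}$, its Lie algebra is $\{X\in\hat{\mathfrak X}(\mathbb C^n,0) : X_k\in\mathfrak g_k\ \forall k\}$, and $G$ is pro-algebraic if $G=\overline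 G^{(0)}$. Then: (0) $\exp:\hat{\mathfrak X}_N(\mathbb C^n,0)\to\widehat{\mathrm{Diff}}_u(\mathbb C^n,0)$ is a bijection (so that $\log\varphi$ and $\varphi^t$ are well defined). (1) If $\mathfrak g$ is a complex Lie subalgebra of $\hat{\mathfrak X}(\mathbb C^n,0)$ that is contained in $\hat{\mathfrak X}_N(\mathbb C^n,0)$ and closed in the Krull topology, then $\exp(\mathfrak g)=\{\exp(X):X\in\mathfrak g\}$ is a unipotent pro-algebraic subgroup of $\widehat{\mathrm{Diff}}(\mathbb C^n,0)$ whose Lie algebra is $\mathfrak g$. (2) The map $\mathfrak g\mapsto\exp(\mathfrak g)$ is a bijection from the set of Lie subalgebras as in (1) to the set of unipotent pro-algebraic subgroups of $\widehat{\mathrm{Diff}}(\mathbb C^n,0)$. (3) If $G$ is a unipotent subgroup of $\widehat{\mathrm{Diff}}(\mathbb C^n,0)$, then $\overline G^{(0)}$ is the closure in the Krull topology of the group generated by $\bigcup_{\varphi\in G}\{\varphi^t:t\in\mathbb C\}$. (4) A unipotent subgroup $G$ of $\widehat{\mathrm{Diff}}(\mathbb C^n,0)$ is pro-algebraic if and only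 if it is closed in the Krull topology and $\varphi^t\in G$ for all $\varphi\in G$ and $t\in\mathbb C$. -/

import Mathlib

noncomputable section

namespace FormalLie

/-- The ring `ℂ[[x₁, …, xₙ]]` of formal power series. -/
abbrev Series (n : ℕ) : Type := MvPowerSeries (Fin n) ℂ

/-- The maximal ideal of `ℂ[[x₁, …, xₙ]]`. -/
abbrev maxIdeal (n : ℕ) : Ideal (Series n) := IsLocalRing.maximalIdeal (Series n)

lemma mem_maxIdeal_iff {n : ℕ} {f : Series n} :
    f ∈ maxIdeal n ↔ MvPowerSeries.constantCoeff f = 0 := by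
  rw [IsLocalRing.mem_maximalIdeal, mem_nonunits_iff, MvPowerSeries.isUnit_iff_constantCoeff,
    isUnit_iff_ne_zero, not_not]

lemma maxIdeal_eq_span (n : ℕ) :
    maxIdeal n = Ideal.span (Set.range (MvPowerSeries.X : Fin n → Series n)) := by
  classical
  apply le_antisymm
  · intro f hf
    rw [mem_maxIdeal_iff] at hf
    let p : (Fin n →₀ ℕ) → Fin n → Prop := fun d i => d i ≠ 0 ∧ ∀ j, d j ≠ 0 → i ≤ j
    let g : Fin n → Series n := fun i e =>
      if p (e + Finsupp.single i 1) i then MvPowerSeries.coeff (e + Finsupp.single i 1) f else 0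
    have key : f = ∑ i, g i * MvPowerSeries.X i := by
      ext d
      rw [map_sum]
      have h1 : ∀ i, MvPowerSeries.coeff d (g i * MvPowerSeries.X i) =
          if p d i then MvPowerSeries.coeff d f else 0 := by
        intro i
        rw [MvPowerSeries.X, MvPowerSeries.coeff_mul_monomial]
        by_cases hi : Finsupp.single i 1 ≤ d
        · rw [if_pos hi, mul_one]
          change (if p (d - Finsupp.single i 1 + Finsupp.single i 1) i then
            MvPowerSeries.coeff (d - Finsupp.single i 1 + Finsupp.single i 1) f else 0) = _
          rw [tsub_add_cancel_of_le hi]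
        · rw [if_neg hi, if_neg]
          rintro ⟨h, -⟩
          exact hi (by rw [Finsupp.single_le_iff]; omega)
      simp_rw [h1]
      by_cases hd : d = 0
      · subst hd
        rw [MvPowerSeries.coeff_zero_eq_constantCoeff_apply, hf]
        simp
      · have hne : (d.support).Nonempty := Finsupp.support_nonempty_iff.mpr hd
        have hp : ∀ i, p d i ↔ i = d.support.min' hne := by
          intro i
          constructor
          · rintro ⟨h1, h2⟩
            apply le_antisymm
            · exact h2 _ (Finsupp.mem_support_iff.mp (Finset.min'_mem _ _))
            · exact Finset.min'_le _ _ (Finsupp.mem_support_iff.mpr h1)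
          · rintro rfl
            exact ⟨Finsupp.mem_support_iff.mp (Finset.min'_mem _ _),
              fun j hj => Finset.min'_le _ _ (Finsupp.mem_support_iff.mpr hj)⟩
        simp [hp]
    rw [key]
    exact Ideal.sum_mem _ fun i _ => Ideal.mul_mem_left _ _ (Ideal.subset_span ⟨i, rfl⟩)
  · rw [Ideal.span_le]
    rintro _ ⟨i, rfl⟩
    exact mem_maxIdeal_iff.mpr (by simp)

lemma complete (n : ℕ) : IsAdicComplete (maxIdeal n) (Series n) := by
  rw [maxIdeal_eq_span]; infer_instance

lemma eq_of_forall_sub_mem {n : ℕ} {f g : Series n} (h : ∀ k, f - g ∈ maxIdeal n ^ k) :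
    f = g := by
  have := complete n
  rw [← sub_eq_zero]
  refine IsHausdorff.haus' (I := maxIdeal n) _ fun k => ?_
  rw [SModEq.zero]
  simpa using h k

/-! ### Jet spaces -/

/-- The space `𝔪 / 𝔪 ^ (k + 1)` of `k`-jets of functions vanishing at the origin. -/
abbrev JetSpace (n k : ℕ) : Type :=
  ↥((maxIdeal n).restrictScalars ℂ) ⧸
    ((maxIdeal n ^ (k + 1)).restrictScalars ℂ).submoduleOf ((maxIdeal n).restrictScalars ℂ)

lemma maps_maxIdeal {n : ℕ} {T : Series n →ₗ[ℂ] Series n}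
    (hT : ∀ j, ∀ f ∈ maxIdeal n ^ j, T f ∈ maxIdeal n ^ j) {f : Series n} (hf : f ∈ maxIdeal n) :
    T f ∈ maxIdeal n := by
  have h := hT 1 f ((pow_one (maxIdeal n)).symm ▸ hf)
  rwa [pow_one] at h

/-- The operator `g + 𝔪 ^ (k + 1) ↦ T g + 𝔪 ^ (k + 1)` induced on `𝔪 / 𝔪 ^ (k + 1)` by an
operator `T` that preserves the powers of `𝔪`. -/
def jetMap {n : ℕ} (k : ℕ) (T : Series n →ₗ[ℂ] Series n)
    (hT : ∀ j, ∀ f ∈ maxIdeal n ^ j, T f ∈ maxIdeal n ^ j) : Module.End ℂ (JetSpace n k) :=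
  Submodule.mapQ _ _
    (T.restrict (p := (maxIdeal n).restrictScalars ℂ) (q := (maxIdeal n).restrictScalars ℂ)
      fun f hf => maps_maxIdeal hT hf)
    (by rintro ⟨f, _⟩ h; exact hT (k + 1) f h)

/-! ### Formal diffeomorphisms -/

/-- The group of formal diffeomorphisms of `(ℂⁿ, 0)`: a formal diffeomorphism `φ` is identified
with the automorphism `f ↦ f ∘ φ` of the `ℂ`-algebra `ℂ[[x₁, …, xₙ]]`, so that its components are
the images `φ (X i)` of the variables. The product is the composition of operators, which is the
opposite of the composition of maps; this affects neither subgroups nor generated subgroups. -/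
abbrev FormalDiff (n : ℕ) : Type := Series n ≃ₐ[ℂ] Series n

lemma FormalDiff.map_mem {n : ℕ} (φ : FormalDiff n) (j : ℕ) :
    ∀ f ∈ maxIdeal n ^ j, φ.toLinearMap f ∈ maxIdeal n ^ j := by
  intro f hf
  have h1 : Ideal.map (φ : Series n →ₐ[ℂ] Series n).toRingHom (maxIdeal n) ≤ maxIdeal n := by
    rw [Ideal.map_le_iff_le_comap]
    intro g hg
    rw [Ideal.mem_comap]
    rw [IsLocalRing.mem_maximalIdeal, mem_nonunits_iff] at hg ⊢
    intro hu
    apply hg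
    simpa using hu
  have h2 := Ideal.mem_map_of_mem (φ : Series n →ₐ[ℂ] Series n).toRingHom hf
  rw [Ideal.map_pow] at h2
  exact Ideal.pow_right_mono h1 j h2

/-- The action `φ ↦ φₖ` of formal diffeomorphisms on `𝔪 / 𝔪 ^ (k + 1)`,
`φₖ (g + 𝔪 ^ (k + 1)) = g ∘ φ + 𝔪 ^ (k + 1)`. -/
def jetHom (n k : ℕ) :
    FormalDiff n →* LinearMap.GeneralLinearGroup ℂ (JetSpace n k) where
  toFun φ :=
    { val := jetMap k φ.toLinearMap φ.map_mem
      inv := jetMap k (φ⁻¹ : FormalDiff n).toLinearMap (φ⁻¹ : FormalDiff n).map_mem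
      val_inv := by
        refine LinearMap.ext fun v => ?_
        obtain ⟨f, rfl⟩ := Submodule.Quotient.mk_surjective _ v
        exact congrArg Submodule.Quotient.mk (Subtype.ext (φ.apply_symm_apply _))
      inv_val := by
        refine LinearMap.ext fun v => ?_
        obtain ⟨f, rfl⟩ := Submodule.Quotient.mk_surjective _ v
        exact congrArg Submodule.Quotient.mk (Subtype.ext (φ.symm_apply_apply _)) }
  map_one' := by
    refine Units.ext (LinearMap.ext fun v => ?_)
    obtain ⟨f, rfl⟩ := Submodule.Quotient.mk_surjective _ v
    rfl
  map_mul' φ ψ := by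
    refine Units.ext (LinearMap.ext fun v => ?_)
    obtain ⟨f, rfl⟩ := Submodule.Quotient.mk_surjective _ v
    rfl

/-- A formal diffeomorphism is unipotent if its linear part, i.e. its action on `𝔪 / 𝔪 ^ 2`,
is unipotent. -/
def IsUnipotentDiff {n : ℕ} (φ : FormalDiff n) : Prop :=
  IsNilpotent ((jetHom n 1 φ : Module.End ℂ (JetSpace n 1)) - 1)

/-- A group of formal diffeomorphisms is unipotent if all its elements are unipotent. -/
def IsUnipotentGroup {n : ℕ} (G : Subgroup (FormalDiff n)) : Prop :=
  ∀ φ ∈ G, IsUnipotentDiff φ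

/-- The Krull topology on formal diffeomorphisms, with the basic open sets
`{η | j ^ k η = j ^ k φ}`. -/
instance krullTopologyDiff (n : ℕ) : TopologicalSpace (FormalDiff n) :=
  TopologicalSpace.generateFrom
    {U | ∃ (k : ℕ) (φ : FormalDiff n),
      U = {η | ∀ i, η (MvPowerSeries.X i) - φ (MvPowerSeries.X i) ∈ maxIdeal n ^ (k + 1)}}

/-! ### Formal vector fields -/

/-- The Lie algebra of (singular) formal vector fields: the `ℂ`-derivations `X` of
`ℂ[[x₁, …, xₙ]]` with `X 𝔪 ⊆ 𝔪`. -/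
def formalVectorFields (n : ℕ) : LieSubalgebra ℂ (Derivation ℂ (Series n) (Series n)) where
  carrier := {X | ∀ f ∈ maxIdeal n, X f ∈ maxIdeal n}
  add_mem' hX hY f hf := Ideal.add_mem _ (hX f hf) (hY f hf)
  zero_mem' f _ := Ideal.zero_mem _
  smul_mem' c X hX f hf := by
    rw [Derivation.smul_apply]
    exact Submodule.smul_of_tower_mem _ c (hX f hf)
  lie_mem' {X Y} hX hY f hf := by
    rw [Derivation.commutator_apply]
    exact Ideal.sub_mem _ (hX _ (hY f hf)) (hY _ (hX f hf))

/-- The type of formal vector fields. -/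
abbrev FormalVF (n : ℕ) : Type := ↥(formalVectorFields n)

/-- A formal vector field as a linear operator on formal power series. -/
abbrev op {n : ℕ} (X : FormalVF n) : Module.End ℂ (Series n) := X.1.toLinearMap

lemma op_mul {n : ℕ} (X : FormalVF n) (a b : Series n) :
    op X (a * b) = a * op X b + op X a * b := by
  have h := X.1.leibniz a b
  rw [smul_eq_mul, smul_eq_mul, mul_comm b] at h
  exact h

lemma FormalVF.map_mem {n : ℕ} (X : FormalVF n) (j : ℕ) :
    ∀ f ∈ maxIdeal n ^ j, op X f ∈ maxIdeal n ^ j := by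
  induction j with
  | zero => intro f _; simp
  | succ j ih =>
    intro f hf
    rw [pow_succ'] at hf ⊢
    refine Submodule.mul_induction_on hf ?_ ?_
    · intro a ha b hb
      rw [op_mul]
      exact Ideal.add_mem _ (Ideal.mul_mem_mul ha (ih b hb)) (Ideal.mul_mem_mul (X.2 a ha) hb)
    · intro a b ha hb
      rw [map_add]
      exact Ideal.add_mem _ ha hb

/-- The operator `Xₖ` induced by a formal vector field `X` on `𝔪 / 𝔪 ^ (k + 1)`. -/
def jetVF {n : ℕ} (k : ℕ) (X : FormalVF n) : Module.End ℂ (JetSpace n k) :=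
  jetMap k (op X) X.map_mem

/-- A formal vector field is nilpotent if its linear part, i.e. its action on `𝔪 / 𝔪 ^ 2`,
is nilpotent. -/
def IsNilpotentVF {n : ℕ} (X : FormalVF n) : Prop := IsNilpotent (jetVF 1 X)

/-- The Krull topology on formal vector fields, with the basic open sets
`{Y | j ^ k Y = j ^ k X}`. -/
instance krullTopologyVF (n : ℕ) : TopologicalSpace (FormalVF n) :=
  TopologicalSpace.generateFrom
    {U | ∃ (k : ℕ) (X : FormalVF n),
      U = {Y | ∀ i, Y.1 (MvPowerSeries.X i) - X.1 (MvPowerSeries.X i) ∈ maxIdeal n ^ (k + 1)}}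

/-- The set of nilpotent formal vector fields. -/
abbrev NilVF (n : ℕ) : Type := {X : FormalVF n // IsNilpotentVF X}

lemma jetVF_smul {n : ℕ} (k : ℕ) (c : ℂ) (X : FormalVF n) : jetVF k (c • X) = c • jetVF k X := by
  refine LinearMap.ext fun v => ?_
  obtain ⟨f, rfl⟩ := Submodule.Quotient.mk_surjective _ v
  rfl

/-- The multiple `t X` of a nilpotent formal vector field. -/
instance (n : ℕ) : SMul ℂ (NilVF n) where
  smul t X := ⟨t • X.1, by
    have h := X.2
    unfold IsNilpotentVF at h ⊢
    rw [jetVF_smul]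
    exact h.smul t⟩

instance (n : ℕ) : Zero (NilVF n) where
  zero := ⟨0, by
    have h : jetVF 1 (0 : FormalVF n) = 0 := by
      refine LinearMap.ext fun v => ?_
      obtain ⟨f, rfl⟩ := Submodule.Quotient.mk_surjective _ v
      rfl
    unfold IsNilpotentVF
    rw [h]
    exact IsNilpotent.zero⟩

/-! ### The exponential -/

lemma op_pow_mem {n : ℕ} (X : FormalVF n) (i j : ℕ) {f : Series n} (hf : f ∈ maxIdeal n ^ j) :
    (op X ^ i) f ∈ maxIdeal n ^ j := by
  induction i with
  | zero => simpa using hf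
  | succ i ih =>
    rw [pow_succ', Module.End.mul_apply]
    exact X.map_mem j _ ih

lemma op_pow_mul_mem {n : ℕ} (X : FormalVF n) (k a b : ℕ) {f g : Series n}
    (hf : f ∈ maxIdeal n) (hg : g ∈ maxIdeal n ^ k) (hfa : (op X ^ a) f ∈ maxIdeal n ^ 2)
    (hgb : (op X ^ b) g ∈ maxIdeal n ^ (k + 1)) :
    (op X ^ (a + b)) (f * g) ∈ maxIdeal n ^ (k + 2) := by
  obtain ⟨c, hc⟩ : ∃ c, c = a + b := ⟨_, rfl⟩
  induction c generalizing a b f g with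
  | zero =>
    obtain ⟨rfl, rfl⟩ : a = 0 ∧ b = 0 := by omega
    rw [show k + 2 = 2 + k by omega, pow_add]
    exact Ideal.mul_mem_mul hfa hg
  | succ c ih =>
    rcases a with _ | a
    · apply op_pow_mem
      rw [show k + 2 = 2 + k by omega, pow_add]
      exact Ideal.mul_mem_mul hfa hg
    rcases b with _ | b
    · apply op_pow_mem
      rw [show k + 2 = 1 + (k + 1) by omega, pow_add, pow_one]
      exact Ideal.mul_mem_mul hf hgb
    have hX : op X f ∈ maxIdeal n := X.2 f hf
    have hY : op X g ∈ maxIdeal n ^ k := X.map_mem k g hg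
    have hX' : (op X ^ a) (op X f) ∈ maxIdeal n ^ 2 := by
      rwa [← Module.End.mul_apply, ← pow_succ]
    have hY' : (op X ^ b) (op X g) ∈ maxIdeal n ^ (k + 1) := by
      rwa [← Module.End.mul_apply, ← pow_succ]
    rw [show a + 1 + (b + 1) = (a + b + 1) + 1 by omega, pow_succ (op X), Module.End.mul_apply,
      op_mul, map_add]
    refine Ideal.add_mem _ ?_ ?_
    · have := ih (a + 1) b hf hY hfa hY' (by omega)
      rwa [show a + 1 + b = a + b + 1 by omega] at this
    · exact ih a (b + 1) hX hg hX' hgb (by omega)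

lemma exists_op_pow_mem {n : ℕ} (X : NilVF n) (k : ℕ) :
    ∃ N, ∀ j, N ≤ j → ∀ f, (op X.1 ^ j) f ∈ maxIdeal n ^ k := by
  obtain ⟨N, hN⟩ := X.2
  have h1 : ∀ f ∈ maxIdeal n, (op X.1 ^ N) f ∈ maxIdeal n ^ 2 := by
    have key : ∀ (i : ℕ) (f : Series n) (hf : f ∈ maxIdeal n),
        ∃ hf' : (op X.1 ^ i) f ∈ maxIdeal n, (jetVF 1 X.1 ^ i) (Submodule.Quotient.mk ⟨f, hf⟩) =
          Submodule.Quotient.mk ⟨(op X.1 ^ i) f, hf'⟩ := by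
      intro i
      induction i with
      | zero => intro f hf; exact ⟨hf, rfl⟩
      | succ i ih =>
        intro f hf
        obtain ⟨h, h'⟩ := ih (op X.1 f) (X.1.2 f hf)
        refine ⟨by rw [pow_succ]; exact h, ?_⟩
        simp only [pow_succ]
        exact h'
    intro f hf
    obtain ⟨h, h'⟩ := key N f hf
    rw [hN, LinearMap.zero_apply, eq_comm, Submodule.Quotient.mk_eq_zero] at h'
    exact h'
  have h2 : ∀ k, ∃ M, ∀ f ∈ maxIdeal n ^ (k + 1), (op X.1 ^ M) f ∈ maxIdeal n ^ (k + 2) := by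
    intro k
    induction k with
    | zero => exact ⟨N, fun f hf => h1 f (by simpa using hf)⟩
    | succ k ih =>
      obtain ⟨M, hM⟩ := ih
      refine ⟨N + M, fun f hf => ?_⟩
      rw [pow_succ' _ (k + 1)] at hf
      refine Submodule.mul_induction_on hf ?_ ?_
      · intro a ha b hb
        exact op_pow_mul_mem X.1 (k + 1) N M ha hb (h1 a ha) (hM b hb)
      · intro a b ha hb
        rw [map_add]
        exact Ideal.add_mem _ ha hb
  have h3 : ∃ M, ∀ f, (op X.1 ^ M) f ∈ maxIdeal n ^ k := by
    induction k with
    | zero => exact ⟨0, fun f => by simp⟩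
    | succ k ih =>
      obtain ⟨M, hM⟩ := ih
      rcases k with _ | k
      · refine ⟨1, fun f => ?_⟩
        have hf : f - algebraMap ℂ (Series n) (MvPowerSeries.constantCoeff f) ∈ maxIdeal n := by
          rw [mem_maxIdeal_iff, map_sub, ← MvPowerSeries.c_eq_algebraMap,
            MvPowerSeries.constantCoeff_C, sub_self]
        have := X.1.2 _ hf
        rw [map_sub, Derivation.map_algebraMap, sub_zero] at this
        simpa using this
      · obtain ⟨M', hM'⟩ := h2 k
        refine ⟨M' + M, fun f => ?_⟩
        rw [pow_add (op X.1), Module.End.mul_apply]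
        exact hM' _ (hM f)
  obtain ⟨M, hM⟩ := h3
  refine ⟨M, fun j hj f => ?_⟩
  obtain ⟨i, rfl⟩ := Nat.exists_eq_add_of_le' hj
  rw [pow_add, Module.End.mul_apply]
  exact op_pow_mem _ _ _ (hM f)

/-- The partial sums `∑ j < N, X ^ j (f) / j!` of the exponential series. -/
def expPartial {n : ℕ} (X : FormalVF n) (N : ℕ) : Module.End ℂ (Series n) :=
  ∑ j ∈ Finset.range N, ((Nat.factorial j : ℂ)⁻¹) • op X ^ j

lemma expPartial_stable {n : ℕ} (X : NilVF n) (k : ℕ) :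
    ∃ N, ∀ M, N ≤ M → ∀ f, expPartial X.1 M f - expPartial X.1 N f ∈ maxIdeal n ^ k := by
  obtain ⟨N, hN⟩ := exists_op_pow_mem X k
  refine ⟨N, fun M hM f => ?_⟩
  rw [expPartial, expPartial, ← LinearMap.sub_apply, ← Finset.sum_Ico_eq_sub _ hM,
    LinearMap.sum_apply]
  refine Ideal.sum_mem _ fun j hj => ?_
  rw [LinearMap.smul_apply]
  exact Submodule.smul_of_tower_mem _ _ (hN j (Finset.mem_Ico.mp hj).1 f)

lemma exists_exp {n : ℕ} (X : NilVF n) (f : Series n) :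
    ∃ g : Series n, ∀ k, ∃ N, ∀ M, N ≤ M → expPartial X.1 M f - g ∈ maxIdeal n ^ k := by
  have := complete n
  choose N hN using expPartial_stable X
  have hc : ∀ {a b : ℕ}, a ≤ b → expPartial X.1 (N a) f ≡ expPartial X.1 (N b) f
      [SMOD (maxIdeal n ^ a • ⊤ : Submodule (Series n) (Series n))] := by
    intro a b hab
    rw [SModEq.sub_mem]
    have h1 := hN a (max (N a) (N b)) (le_max_left _ _) f
    have h2 := Ideal.pow_le_pow_right hab (hN b (max (N a) (N b)) (le_max_right _ _) f)
    have h3 := Ideal.sub_mem _ h2 h1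
    rw [sub_sub_sub_cancel_left] at h3
    simpa using h3
  obtain ⟨g, hg⟩ := IsPrecomplete.prec' (I := maxIdeal n) _ hc
  refine ⟨g, fun k => ⟨N k, fun M hM => ?_⟩⟩
  have h1 := hg k
  rw [SModEq.sub_mem] at h1
  have h2 := Ideal.add_mem _ (hN k M hM f) (by simpa using h1)
  simpa using h2

/-- The sum `∑ j, X ^ j (f) / j!` in the Krull topology, for a nilpotent formal vector field. -/
def expFun {n : ℕ} (X : NilVF n) (f : Series n) : Series n := (exists_exp X f).choose

lemma expFun_spec {n : ℕ} (X : NilVF n) (f : Series n) (k : ℕ) :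
    ∃ N, ∀ M, N ≤ M → expPartial X.1 M f - expFun X f ∈ maxIdeal n ^ k :=
  (exists_exp X f).choose_spec k

lemma expFun_eq {n : ℕ} (X : NilVF n) {f g : Series n}
    (h : ∀ k, ∃ N, ∀ M, N ≤ M → expPartial X.1 M f - g ∈ maxIdeal n ^ k) : expFun X f = g := by
  refine eq_of_forall_sub_mem fun k => ?_
  obtain ⟨N, hN⟩ := expFun_spec X f k
  obtain ⟨N', hN'⟩ := h k
  have := Ideal.sub_mem _ (hN' _ (le_max_right N N')) (hN _ (le_max_left N N'))
  rwa [sub_sub_sub_cancel_left] at this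

/-- The operator induced by a formal vector field on `ℂ[[x₁, …, xₙ]] / 𝔪 ^ k`. -/
def quotOp {n : ℕ} (k : ℕ) (X : FormalVF n) : Module.End ℂ (Series n ⧸ (maxIdeal n ^ k)) :=
  Submodule.mapQ ((maxIdeal n ^ k).restrictScalars ℂ) ((maxIdeal n ^ k).restrictScalars ℂ) (op X)
    (X.map_mem k)

lemma quotOp_pow_mk {n : ℕ} (k i : ℕ) (X : FormalVF n) (f : Series n) :
    (quotOp k X ^ i) (Ideal.Quotient.mk _ f) = Ideal.Quotient.mk _ ((op X ^ i) f) := by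
  induction i generalizing f with
  | zero => rfl
  | succ i ih =>
    rw [pow_succ, pow_succ, Module.End.mul_apply, Module.End.mul_apply]
    exact ih _

lemma quotOp_nilpotent {n : ℕ} (k : ℕ) (X : NilVF n) : IsNilpotent (quotOp k X.1) := by
  obtain ⟨N, hN⟩ := exists_op_pow_mem X k
  refine ⟨N, LinearMap.ext fun v => ?_⟩
  obtain ⟨f, rfl⟩ := Ideal.Quotient.mk_surjective v
  rw [quotOp_pow_mk, LinearMap.zero_apply, Ideal.Quotient.eq_zero_iff_mem]
  exact hN N le_rfl f

lemma mk_expFun {n : ℕ} (k : ℕ) (X : NilVF n) (f : Series n) :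
    (Ideal.Quotient.mk (maxIdeal n ^ k)) (expFun X f) =
      IsNilpotent.exp (quotOp k X.1) (Ideal.Quotient.mk _ f) := by
  obtain ⟨N, hN⟩ := expFun_spec X f k
  obtain ⟨a, ha⟩ := quotOp_nilpotent k X
  have h := hN (max N a) (le_max_left _ _)
  rw [← Ideal.Quotient.eq] at h
  rw [← h, IsNilpotent.exp_eq_sum (pow_eq_zero_of_le (le_max_right N a) ha), expPartial,
    LinearMap.sum_apply, LinearMap.sum_apply, map_sum]
  refine Finset.sum_congr rfl fun j _ => ?_
  rw [LinearMap.smul_apply, LinearMap.smul_apply, quotOp_pow_mk]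
  rw [← Ideal.Quotient.mkₐ_eq_mk ℂ, map_smul, ← algebraMap_smul ℂ ((j.factorial : ℚ)⁻¹)]
  simp

lemma eq_of_mk_eq {n : ℕ} {f g : Series n}
    (h : ∀ k, Ideal.Quotient.mk (maxIdeal n ^ k) f = Ideal.Quotient.mk (maxIdeal n ^ k) g) :
    f = g :=
  eq_of_forall_sub_mem fun k => Ideal.Quotient.eq.mp (h k)

lemma expFun_mul {n : ℕ} (X : NilVF n) (f g : Series n) :
    expFun X (f * g) = expFun X f * expFun X g := by
  refine eq_of_mk_eq fun k => ?_
  rw [map_mul, mk_expFun, mk_expFun, mk_expFun, map_mul]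
  refine Module.End.exp_mul_of_derivation ℂ _ (quotOp k X.1) ?_ (quotOp_nilpotent k X) _ _
  intro x y
  obtain ⟨a, rfl⟩ := Ideal.Quotient.mk_surjective x
  obtain ⟨b, rfl⟩ := Ideal.Quotient.mk_surjective y
  exact congrArg (Ideal.Quotient.mk (maxIdeal n ^ k)) (op_mul X.1 a b)

lemma expFun_add {n : ℕ} (X : NilVF n) (f g : Series n) :
    expFun X (f + g) = expFun X f + expFun X g := by
  refine eq_of_mk_eq fun k => ?_
  rw [map_add, mk_expFun, mk_expFun, mk_expFun, map_add, map_add]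

lemma expFun_algebraMap {n : ℕ} (X : NilVF n) (c : ℂ) :
    expFun X (algebraMap ℂ (Series n) c) = algebraMap ℂ (Series n) c := by
  refine expFun_eq X fun k => ⟨1, fun M hM => ?_⟩
  obtain ⟨M, rfl⟩ := Nat.exists_eq_add_of_le' hM
  have h0 : op X.1 (algebraMap ℂ (Series n) c) = 0 := X.1.1.map_algebraMap c
  have : expPartial X.1 (M + 1) (algebraMap ℂ (Series n) c) = algebraMap ℂ (Series n) c := by
    rw [expPartial, LinearMap.sum_apply, Finset.sum_range_succ', Finset.sum_eq_zero]
    · simp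
    · intro i _
      rw [LinearMap.smul_apply, pow_succ, Module.End.mul_apply, h0, map_zero, smul_zero]
  rw [this, sub_self]
  exact Ideal.zero_mem _

lemma quotOp_neg {n : ℕ} (k : ℕ) (X : FormalVF n) :
    quotOp k ((-1 : ℂ) • X) = -quotOp k X := by
  refine LinearMap.ext fun v => ?_
  obtain ⟨f, rfl⟩ := Ideal.Quotient.mk_surjective v
  refine congrArg (Ideal.Quotient.mk (maxIdeal n ^ k)) (?_ : _ = -op X f)
  exact neg_one_smul ℂ _

/-- The exponential `exp X` of a nilpotent formal vector field, `(exp X) f = ∑ j, X ^ j (f) / j!`;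
its components are the series `∑ j, X ^ j (x i) / j!`. -/
def exp {n : ℕ} (X : NilVF n) : FormalDiff n where
  toFun := expFun X
  invFun := expFun ((-1 : ℂ) • X)
  left_inv f := by
    refine eq_of_mk_eq fun k => ?_
    rw [mk_expFun, mk_expFun, ← Module.End.mul_apply]
    change (IsNilpotent.exp (quotOp k ((-1 : ℂ) • X.1)) * IsNilpotent.exp (quotOp k X.1)) _ = _
    rw [quotOp_neg, IsNilpotent.exp_neg_mul_exp_self (quotOp_nilpotent k X), Module.End.one_apply]
  right_inv f := by
    refine eq_of_mk_eq fun k => ?_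
    rw [mk_expFun, mk_expFun, ← Module.End.mul_apply]
    change (IsNilpotent.exp (quotOp k X.1) * IsNilpotent.exp (quotOp k ((-1 : ℂ) • X.1))) _ = _
    rw [quotOp_neg, IsNilpotent.exp_mul_exp_neg_self (quotOp_nilpotent k X), Module.End.one_apply]
  map_mul' := expFun_mul X
  map_add' := expFun_add X
  commutes' := expFun_algebraMap X

/-- The set `exp 𝔤 = {exp X | X ∈ 𝔤}`. -/
def expSet {n : ℕ} (g : LieSubalgebra ℂ (FormalVF n)) : Set (FormalDiff n) :=
  exp '' {X | X.1 ∈ g}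

/-- The infinitesimal generator `log φ` of a unipotent formal diffeomorphism: the nilpotent formal
vector field with `exp (log φ) = φ`. -/
def log {n : ℕ} (φ : FormalDiff n) : NilVF n :=
  open Classical in if h : ∃ X : NilVF n, exp X = φ then h.choose else 0

/-- The one-parameter group `φ ^ t = exp (t log φ)`. -/
def oneParam {n : ℕ} (φ : FormalDiff n) (t : ℂ) : FormalDiff n := exp (t • log φ)

/-! ### Algebraic matrix groups -/

section Algebraic

variable {V : Type*} [AddCommGroup V] [Module ℂ V]

/-- The algebra of polynomial functions on the vector space `End V`, generated by the linear
forms. -/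
def polyFun (V : Type*) [AddCommGroup V] [Module ℂ V] : Subalgebra ℂ (Module.End ℂ V → ℂ) :=
  Algebra.adjoin ℂ (Set.range fun (l : Module.Dual ℂ (Module.End ℂ V)) A => l A)

/-- A subgroup of `GL V` is algebraic if it is Zariski closed in `GL V`, i.e. cut out in `GL V` by
polynomial equations. -/
def IsAlgebraicGroup (H : Subgroup (LinearMap.GeneralLinearGroup ℂ V)) : Prop :=
  ∃ S : Set (Module.End ℂ V → ℂ), S ⊆ polyFun V ∧
    ∀ A : LinearMap.GeneralLinearGroup ℂ V, A ∈ H ↔ ∀ p ∈ S, p (A : Module.End ℂ V) = 0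

/-- The Lie algebra of an algebraic group `H ≤ GL V`: the Zariski tangent space of `H` at the
identity, i.e. the endomorphisms `A` such that the derivative at the identity, in the direction of
`A`, of every polynomial function vanishing on `H` is zero. -/
def lieAlgebraOf (H : Subgroup (LinearMap.GeneralLinearGroup ℂ V)) : Set (Module.End ℂ V) :=
  {A | ∀ p ∈ polyFun V, (∀ B ∈ H, p (B : Module.End ℂ V) = 0) →
    HasDerivAt (fun t : ℂ => p (1 + t • A)) 0 0}

end Algebraic

/-! ### Pro-algebraic groups -/

/-- The group `Dₖ` of `k`-jets of diffeomorphisms, acting on `𝔪 / 𝔪 ^ (k + 1)`; since every jet is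
realized by a polynomial map, formal and convergent diffeomorphisms have the same `k`-jets. -/
def jetGroup (n k : ℕ) : Subgroup (LinearMap.GeneralLinearGroup ℂ (JetSpace n k)) :=
  (jetHom n k).range

/-- The group `Gₖ`: the smallest algebraic subgroup of `Dₖ` containing `{φₖ | φ ∈ G}`. -/
def jetClosure {n : ℕ} (G : Subgroup (FormalDiff n)) (k : ℕ) :
    Subgroup (LinearMap.GeneralLinearGroup ℂ (JetSpace n k)) :=
  sInf {H | IsAlgebraicGroup H ∧ H ≤ jetGroup n k ∧ G.map (jetHom n k) ≤ H}

/-- The pro-algebraic closure `{φ | φₖ ∈ Gₖ for all k}` of `G`. -/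
def proClosure {n : ℕ} (G : Subgroup (FormalDiff n)) : Subgroup (FormalDiff n) :=
  ⨅ k, (jetClosure G k).comap (jetHom n k)

/-- A group of formal diffeomorphisms is pro-algebraic if it equals its pro-algebraic closure. -/
def IsProAlgebraic {n : ℕ} (G : Subgroup (FormalDiff n)) : Prop := G = proClosure G

/-- The Lie algebra `{X | Xₖ ∈ 𝔤ₖ for all k}` of the pro-algebraic closure of `G`, where `𝔤ₖ` is
the Lie algebra of the algebraic group `Gₖ`. -/
def proLie {n : ℕ} (G : Subgroup (FormalDiff n)) : Set (FormalVF n) :=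
  {X | ∀ k, jetVF k X ∈ lieAlgebraOf (jetClosure G k)}

end FormalLie

end

open FormalLie

namespace FormalLie

open Polynomial

/-! ### Exponential and logarithm of nilpotent elements -/

section NilpotentLog

variable {A : Type*} [Ring A] [Algebra ℂ A]

/-! Everything is read off on the finite-dimensional spaces `𝔪 / 𝔪 ^ (k + 1)`. On nilpotent and
unipotent operators the exponential and logarithm are polynomial maps, inverse to each other, and
they exchange Lie algebras of nilpotent operators with unipotent algebraic groups.

From algebras to groups: by Engel's theorem a Lie algebra `g` of nilpotent operators lies in a
nilpotent associative algebra, and there `exp g` is closed under products by the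
Baker-Campbell-Hausdorff theorem (`exists_exp_eq_exp_mul_exp`). The group `exp g` is Zariski closed
because it is cut out by unipotence and by the equations `l (log a) = 0`, for `l` a linear form
vanishing on `g` (`isAlgebraicGroup_expGroup`); its tangent space at the identity is `g`
(`lieAlgebraOf_expGroup`).

From groups to algebras: the logarithms of a unipotent algebraic group form a Lie algebra. Multiples
come from polynomials in `t` that vanish on `ℕ`, sums from the limit of `s⁻¹ log (∏ exp (s Y_i))`,
brackets from the linear term of `exp (s a) b exp (-s a)` (`smul_mem_logSet`, `sum_mem_logSet`,
`lie_mem_logSet`).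

Passage to the formal level: taking jets commutes with `exp` (`coe_jetHom_exp`). Logarithms on the
quotients by `𝔪 ^ k` are derivations (`log_mul`) and fit together by completeness, so every
unipotent diffeomorphism has a logarithm. A Krull-closed `g` is determined by its jets `g_k`, and
`exp g` maps onto each `exp g_k`, which is therefore its `G_k` (`map_expSubgroup`). Conversely, a
unipotent pro-algebraic `G` is the exponential of the fields whose jets are logarithms of elements
of the `G_k` (`expSet_logLie`).

For one-parameter groups the key fact is that if `S` generates the Lie algebra `g`, then the lines
`exp (t b)`, `b ∈ S`, generate the abstract group `exp g`, without any closure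
(`expGroup_le_of_generates`, by the inverse function theorem). Hence the one-parameter groups of `G`
generate a group whose `k`-jets contain `G_k` for every `k`, and this is Krull density in the
pro-algebraic closure. The last characterization follows. -/

lemma commute_aeval_self (u : A) (p : ℂ[X]) : Commute u (aeval u p) := by
  have := (Commute.all (X : ℂ[X]) p).map (aeval u)
  simpa using this

/-- The operator `b ↦ a * b - b * a`. -/
def commMap (a : A) : Module.End ℂ A := LinearMap.mulLeft ℂ a - LinearMap.mulRight ℂ a

@[simp]
lemma commMap_apply (a b : A) : commMap a b = a * b - b * a := rfl

variable [Module ℚ A]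

/-- The truncated exponential series. -/
noncomputable def expPoly (d : ℕ) : ℂ[X] :=
  ∑ i ∈ Finset.range d, C ((i.factorial : ℂ)⁻¹) * X ^ i

lemma rat_inv_smul (m : ℕ) (a : A) : ((m : ℚ)⁻¹) • a = ((m : ℂ)⁻¹) • a := by
  rw [← algebraMap_smul ℂ ((m : ℚ)⁻¹)]
  simp

lemma exp_eq_aeval {d : ℕ} {a : A} (h : a ^ d = 0) :
    IsNilpotent.exp a = aeval a (expPoly d) := by
  rw [IsNilpotent.exp_eq_sum h, expPoly, map_sum]
  refine Finset.sum_congr rfl fun i _ => ?_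
  rw [rat_inv_smul, map_mul, aeval_C, map_pow, aeval_X, Algebra.smul_def]

/-- The remainder is kept as `a ^ 2` times a polynomial in `a`, so that every factor commutes with
`a`. -/
lemma exists_exp_eq {a : A} (h : IsNilpotent a) :
    ∃ s : ℂ[X], IsNilpotent.exp a = 1 + a + a ^ 2 * aeval a s := by
  obtain ⟨d, hd⟩ := h
  have hd' : a ^ (d + 2) = 0 := pow_eq_zero_of_le (by omega) hd
  refine ⟨∑ i ∈ Finset.range d, C (((i + 2).factorial : ℂ)⁻¹) * X ^ i, ?_⟩
  rw [exp_eq_aeval hd', expPoly, Finset.sum_range_succ', Finset.sum_range_succ', map_add, map_add,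
    map_sum, map_sum, Finset.mul_sum]
  have : ∀ i ∈ Finset.range d, aeval a (C (((i + 1 + 1).factorial : ℂ)⁻¹) * X ^ (i + 1 + 1)) =
      a ^ 2 * aeval a (C (((i + 2).factorial : ℂ)⁻¹) * X ^ i) := by
    intro i _
    simp only [map_mul, aeval_C, map_pow, aeval_X]
    rw [← mul_assoc (a ^ 2), ← Algebra.commutes, mul_assoc, ← pow_add]
    ring_nf
  rw [Finset.sum_congr rfl this]
  simp
  abel

/-- Here `exp a - 1` is `a` times a unit of the form `1 +` nilpotent. -/
lemma exp_eq_one_imp {a : A} (h : IsNilpotent a) (h1 : IsNilpotent.exp a = 1) : a = 0 := by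
  obtain ⟨s, hs⟩ := exists_exp_eq h
  rw [h1] at hs
  have hc : Commute a (aeval a s) := commute_aeval_self a s
  have h2 : a * (1 + a * aeval a s) = 0 := by
    have : a + a ^ 2 * aeval a s = 0 := by
      have := hs.symm
      rwa [add_assoc, add_eq_left] at this
    rw [← this]; noncomm_ring
  have hu : IsUnit (1 + a * aeval a s) := (hc.isNilpotent_mul_right h).isUnit_one_add
  exact hu.mul_left_eq_zero.mp h2

/-- Successive approximation of the logarithm modulo `X ^ d`: an error `x ^ (j + 2) * p` is
cancelled by subtracting `X ^ (j + 2) * p` from the exponent, and this creates errors of order at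
least `j + 3` only. -/
lemma exists_log_aux (d j : ℕ) : ∃ q : ℂ[X], ∃ r : ℂ[X] ⧸ Ideal.span {(X : ℂ[X]) ^ d},
    IsNilpotent.exp (Ideal.Quotient.mk (Ideal.span {(X : ℂ[X]) ^ d}) (X + X ^ 2 * q)) =
      1 + Ideal.Quotient.mk _ X + (Ideal.Quotient.mk _ X) ^ (j + 2) * r := by
  set Q := Ideal.Quotient.mk (Ideal.span {(X : ℂ[X]) ^ d}) with hQ
  have hx : (Q X) ^ d = 0 := by
    rw [← map_pow]
    exact Ideal.Quotient.eq_zero_iff_mem.mpr (Ideal.mem_span_singleton_self _)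
  have hn : ∀ p, IsNilpotent (Q X * p) := fun p => ⟨d, by rw [mul_pow, hx, zero_mul]⟩
  induction j with
  | zero =>
    refine ⟨0, ?_⟩
    obtain ⟨s, hs⟩ := exists_exp_eq (a := Q X) ⟨d, hx⟩
    exact ⟨_, by simpa using hs⟩
  | succ j ih =>
    obtain ⟨q, r, hr⟩ := ih
    obtain ⟨p, rfl⟩ := Ideal.Quotient.mk_surjective r
    have h1 : IsNilpotent (Q (X + X ^ 2 * q)) := by
      convert hn (Q (1 + X * q)) using 1
      rw [← map_mul]; congr 1; ring
    have h2 : IsNilpotent (Q (- (X ^ (j + 2) * p))) := by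
      convert hn (Q (- (X ^ (j + 1) * p))) using 1
      rw [← map_mul]; congr 1; ring
    refine ⟨q - X ^ j * p, ?_⟩
    have h3 : Q (X + X ^ 2 * (q - X ^ j * p)) = Q (X + X ^ 2 * q) + Q (- (X ^ (j + 2) * p)) := by
      rw [← map_add]; congr 1; ring
    obtain ⟨s, hs⟩ := exists_exp_eq h2
    rw [h3, IsNilpotent.exp_add_of_commute (Commute.all _ _) h1 h2, hr, hs]
    set x := Q X
    set y := Q p
    set z := aeval (Q (-(X ^ (j + 2) * p))) s
    have h4 : Q (-(X ^ (j + 2) * p)) = - (x ^ (j + 2) * y) := by simp [x, y]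
    refine ⟨- y - x ^ (j + 1) * y ^ 2 +
      (1 + x + x ^ (j + 2) * y) * x ^ (j + 1) * y ^ 2 * z, ?_⟩
    rw [h4]
    change (1 + x + x ^ (j + 2) * y) * _ = _
    ring

lemma exists_logTail (d : ℕ) : ∃ q : ℂ[X],
    IsNilpotent.exp (Ideal.Quotient.mk (Ideal.span {(X : ℂ[X]) ^ d}) (X + X ^ 2 * q)) =
      1 + Ideal.Quotient.mk _ X := by
  obtain ⟨q, r, h⟩ := exists_log_aux d d
  refine ⟨q, ?_⟩
  rw [h, pow_add, ← map_pow, Ideal.Quotient.eq_zero_iff_mem.mpr (Ideal.mem_span_singleton_self _)]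
  ring

/-- The polynomial for which `X + X ^ 2 * logTail d` is the logarithm of `1 + X` modulo `X ^ d`. -/
noncomputable def logTail (d : ℕ) : ℂ[X] := (exists_logTail d).choose

/-- The polynomial `logPoly d`, for which `aeval u (logPoly d)` is the logarithm of `1 + u`
whenever `u ^ d = 0`. -/
noncomputable def logPoly (d : ℕ) : ℂ[X] := X + X ^ 2 * logTail d

omit [Module ℚ A] in
lemma aeval_logPoly (d : ℕ) (u : A) : aeval u (logPoly d) = u * (1 + u * aeval u (logTail d)) := by
  simp [logPoly]; noncomm_ring

omit [Module ℚ A] in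
lemma pow_aeval_logPoly {d : ℕ} {u : A} (h : u ^ d = 0) : (aeval u (logPoly d)) ^ d = 0 := by
  have hc : Commute u (1 + u * aeval u (logTail d)) := by
    have := commute_aeval_self u (1 + X * logTail d)
    simpa using this
  rw [aeval_logPoly, hc.mul_pow, h, zero_mul]

/-- Evaluation at `u` factors through `ℂ[X] / (X ^ d)`, where the identity holds by the choice of
`logTail`. -/
lemma exp_aeval_logPoly {d : ℕ} {u : A} (h : u ^ d = 0) :
    IsNilpotent.exp (aeval u (logPoly d)) = 1 + u := by
  let f : (ℂ[X] ⧸ Ideal.span {(X : ℂ[X]) ^ d}) →+* A :=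
    Ideal.Quotient.lift (Ideal.span {(X : ℂ[X]) ^ d}) (aeval u : ℂ[X] →ₐ[ℂ] A).toRingHom (by
      intro a ha
      obtain ⟨b, rfl⟩ := Ideal.mem_span_singleton.mp ha
      simp [h])
  have h1 : IsNilpotent (Ideal.Quotient.mk (Ideal.span {(X : ℂ[X]) ^ d}) (logPoly d)) := by
    refine ⟨d, pow_aeval_logPoly (A := ℂ[X] ⧸ Ideal.span {(X : ℂ[X]) ^ d}) (d := d)
      (u := Ideal.Quotient.mk _ X) ?_ ▸ ?_⟩
    · rw [← map_pow]
      exact Ideal.Quotient.eq_zero_iff_mem.mpr (Ideal.mem_span_singleton_self _)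
    · congr 1
      rw [← Ideal.Quotient.mkₐ_eq_mk ℂ, aeval_algHom_apply, aeval_X_left_apply]
  have h2 := IsNilpotent.map_exp h1 f
  have h3 := congrArg f (exists_logTail d).choose_spec
  have h4 : ∀ p, f (Ideal.Quotient.mk _ p) = aeval u p := fun p => Ideal.Quotient.lift_mk _ _ _
  rw [h4] at h2
  rw [← h2, logPoly]
  refine h3.trans ?_
  rw [map_add, map_one, h4, aeval_X]

lemma exp_sub_one_pow {d : ℕ} {z : A} (h : z ^ d = 0) : (IsNilpotent.exp z - 1) ^ d = 0 := by
  obtain ⟨s, hs⟩ := exists_exp_eq (⟨d, h⟩ : IsNilpotent z)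
  have hc : Commute z (1 + z * aeval z s) := by
    have := commute_aeval_self z (1 + X * s)
    simpa using this
  have : IsNilpotent.exp z - 1 = z * (1 + z * aeval z s) := by rw [hs]; noncomm_ring
  rw [this, hc.mul_pow, h, zero_mul]

/-- Both sides have the same exponential and commute, the left one being a polynomial in `z`; so
their difference is a nilpotent element with exponential `1`. -/
lemma aeval_logPoly_exp {d : ℕ} {z : A} (h : z ^ d = 0) :
    aeval (IsNilpotent.exp z - 1) (logPoly d) = z := by
  have h0 := exp_sub_one_pow h
  have h1 := exp_aeval_logPoly h0
  have h2 : IsNilpotent (aeval (IsNilpotent.exp z - 1) (logPoly d)) := ⟨d, pow_aeval_logPoly h0⟩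
  have hz : IsNilpotent z := ⟨d, h⟩
  rw [add_sub_cancel] at h1
  have hc : Commute (aeval (IsNilpotent.exp z - 1) (logPoly d)) z := by
    have : aeval (IsNilpotent.exp z - 1) (logPoly d) =
        aeval z ((logPoly d).comp (expPoly d - 1)) := by
      rw [aeval_comp, map_sub, exp_eq_aeval h, map_one]
    rw [this]
    exact (commute_aeval_self z _).symm
  have h3 := IsNilpotent.exp_add_of_commute hc.neg_right h2 hz.neg
  rw [h1, IsNilpotent.exp_mul_exp_neg_self hz] at h3
  have h4 := exp_eq_one_imp (hc.neg_right.isNilpotent_add h2 hz.neg) h3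
  rwa [← sub_eq_add_neg, sub_eq_zero] at h4

lemma exp_injective_of_isNilpotent {a b : A} (ha : IsNilpotent a) (hb : IsNilpotent b)
    (h : IsNilpotent.exp a = IsNilpotent.exp b) : a = b := by
  obtain ⟨m, hm⟩ := ha
  obtain ⟨n, hn⟩ := hb
  rw [← aeval_logPoly_exp (pow_eq_zero_of_le (le_max_left m n) hm),
    ← aeval_logPoly_exp (pow_eq_zero_of_le (le_max_right m n) hn), h]

lemma exp_smul_add {a : A} (ha : IsNilpotent a) (s t : ℂ) :
    IsNilpotent.exp ((s + t) • a) = IsNilpotent.exp (s • a) * IsNilpotent.exp (t • a) := by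
  rw [add_smul]
  exact IsNilpotent.exp_add_of_commute
    (((Commute.refl a).smul_left s).smul_right t) (ha.smul s) (ha.smul t)

lemma exp_natCast_smul {a : A} (ha : IsNilpotent a) (m : ℕ) :
    IsNilpotent.exp ((m : ℂ) • a) = IsNilpotent.exp a ^ m := by
  induction m with
  | zero => simp
  | succ m ih => rw [Nat.cast_succ, exp_smul_add ha, ih, one_smul, pow_succ]

/-- Conjugation by `exp a` is `exp (ad a)`: left multiplication by `a` and right multiplication by
`-a` commute and add up to `commMap a`, whose power `2 * d` therefore vanishes. -/
lemma exp_mul_mul_exp_neg {a : A} {d : ℕ} (ha : a ^ d = 0) (b : A) :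
    IsNilpotent.exp a * b * IsNilpotent.exp (-a) =
      ∑ i ∈ Finset.range (2 * d), ((i.factorial : ℂ)⁻¹) • ((commMap a) ^ i) b := by
  have hL : (LinearMap.mulLeft ℂ a) ^ d = 0 := by
    rw [LinearMap.pow_mulLeft, ha, LinearMap.mulLeft_zero_eq_zero]
  have hR : (LinearMap.mulRight ℂ (-a)) ^ d = 0 := by
    rw [LinearMap.pow_mulRight, neg_pow, ha, mul_zero, LinearMap.mulRight_zero_eq_zero]
  have hc : Commute (LinearMap.mulLeft ℂ a) (LinearMap.mulRight ℂ (-a)) :=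
    LinearMap.commute_mulLeft_right a (-a)
  have had : commMap a = LinearMap.mulLeft ℂ a + LinearMap.mulRight ℂ (-a) := by
    ext x; simp [sub_eq_add_neg]
  have hE := IsNilpotent.exp_add_of_commute hc ⟨d, hL⟩ ⟨d, hR⟩
  have hd : (commMap a) ^ (2 * d) = 0 := by
    rw [had]
    exact hc.add_pow_eq_zero_of_add_le_succ_of_pow_eq_zero hL hR (by omega)
  have hna : (-a) ^ d = 0 := by rw [neg_pow, ha, mul_zero]
  rw [← had, IsNilpotent.exp_eq_sum hd, IsNilpotent.exp_eq_sum hL, IsNilpotent.exp_eq_sum hR] at hE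
  have h := LinearMap.congr_fun hE b
  rw [LinearMap.sum_apply, Module.End.mul_apply, LinearMap.sum_apply, LinearMap.sum_apply] at h
  rw [IsNilpotent.exp_eq_sum ha, IsNilpotent.exp_eq_sum hna, mul_assoc, Finset.sum_mul,
    Finset.mul_sum]
  refine Eq.trans ?_ (h.symm.trans ?_)
  · refine Finset.sum_congr rfl fun i _ => ?_
    simp [LinearMap.pow_mulLeft, LinearMap.pow_mulRight, smul_mul_assoc, mul_smul_comm,
      Finset.mul_sum]
    exact Finset.sum_congr rfl fun j _ => smul_comm _ _ _
  · refine Finset.sum_congr rfl fun i _ => ?_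
    rw [LinearMap.smul_apply, rat_inv_smul]

end NilpotentLog

end FormalLie
namespace FormalLie

open Polynomial

/-! ### The Baker-Campbell-Hausdorff theorem without the explicit series -/

section BakerCampbellHausdorff

variable {A : Type*} [Ring A] [Algebra ℂ A]

/-- The polynomials with coefficients in a subspace. -/
def coeffsIn (N : Submodule ℂ A) : Submodule ℂ A[X] where
  carrier := {f | ∀ i, f.coeff i ∈ N}
  add_mem' hf hg i := by rw [coeff_add]; exact N.add_mem (hf i) (hg i)
  zero_mem' i := by rw [coeff_zero]; exact N.zero_mem
  smul_mem' c f hf i := by rw [coeff_smul]; exact N.smul_mem c (hf i)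

lemma coeff_derivative_eq_smul (f : A[X]) (i : ℕ) :
    (derivative f).coeff i = ((i : ℂ) + 1) • f.coeff (i + 1) := by
  rw [coeff_derivative, Algebra.smul_def, Algebra.commutes]
  simp

lemma mul_mem_coeffsIn {M N : Submodule ℂ A} {f g : A[X]} (hf : f ∈ coeffsIn M)
    (hg : g ∈ coeffsIn N) : f * g ∈ coeffsIn (M * N) := by
  intro i
  rw [coeff_mul]
  exact Submodule.sum_mem _ fun p _ => Submodule.mul_mem_mul (hf _) (hg _)

lemma pow_mem_coeffsIn {N : Submodule ℂ A} {f : A[X]} (hf : f ∈ coeffsIn N) (m : ℕ) :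
    f ^ m ∈ coeffsIn (N ^ m) := by
  induction m with
  | zero =>
    intro i
    rw [pow_zero, pow_zero, coeff_one]
    split_ifs
    · exact Submodule.one_le.mp le_rfl
    · exact Submodule.zero_mem _
  | succ m ih => rw [pow_succ, pow_succ]; exact mul_mem_coeffsIn ih hf

lemma pow_eq_zero_of_mem_coeffsIn {N : Submodule ℂ A} {d : ℕ} (hN : N ^ d = ⊥) {f : A[X]}
    (hf : f ∈ coeffsIn N) : f ^ d = 0 := by
  have := pow_mem_coeffsIn hf d
  rw [hN] at this
  ext i
  simpa using this i

lemma commMap_mem_coeffsIn {g : Submodule ℂ A} (hg : ∀ a ∈ g, ∀ b ∈ g, a * b - b * a ∈ g)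
    {x : A} (hx : x ∈ g) {f : A[X]} (hf : f ∈ coeffsIn g) :
    commMap (monomial 1 x) f ∈ coeffsIn g := by
  intro i
  rw [commMap_apply, coeff_sub]
  rcases i with _ | i
  · simp [coeff_mul, coeff_monomial]
  · rw [← C_mul_X_eq_monomial, mul_assoc, X_mul, ← mul_assoc, coeff_mul_X, coeff_C_mul,
      ← mul_assoc, coeff_mul_X, coeff_mul_C]
    exact hg _ hx _ (hf i)

/-- As `z` has no constant term, coefficients of the bracket up to degree `m` involve `w` only in
degrees below `m`. This gain of one degree drives the induction in `exists_exp_eq_exp_mul_exp`. -/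
lemma coeff_commMap_mem {g : Submodule ℂ A} (hg : ∀ a ∈ g, ∀ b ∈ g, a * b - b * a ∈ g)
    {z w : A[X]} {m : ℕ} (hz0 : z.coeff 0 = 0) (hz : ∀ i ≤ m, z.coeff i ∈ g)
    (hw : ∀ i < m, w.coeff i ∈ g) : ∀ i ≤ m, (commMap z w).coeff i ∈ g := by
  intro i hi
  rw [commMap_apply, coeff_sub, coeff_mul, coeff_mul, ← Finset.Nat.sum_antidiagonal_swap (n := i)
    (f := fun p => w.coeff p.1 * z.coeff p.2), ← Finset.sum_sub_distrib]
  refine Submodule.sum_mem _ fun p hp => ?_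
  have hp := Finset.HasAntidiagonal.mem_antidiagonal.mp hp
  by_cases h : p.1 = 0
  · simp [h, hz0]
  · exact hg _ (hz _ (by omega)) _ (hw _ (by omega))

variable [Module ℚ A]

/-- Conjugate the differentiation operator `D` by the exponential of multiplication by `z`: since
`[z, D]` is multiplication by `-z'`, the iterated brackets are known. Applied to `1`, the conjugate
gives `exp z * (exp (-z))'`, which is minus the left-hand side. -/
lemma derivative_exp_mul_exp_neg {z : A[X]} {d : ℕ} (hz : z ^ d = 0) :
    derivative (IsNilpotent.exp z) * IsNilpotent.exp (-z) =
      ∑ i ∈ Finset.range (2 * d), (((i + 1).factorial : ℂ)⁻¹) •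
        ((commMap z) ^ i) (derivative z) := by
  have hn : IsNilpotent z := ⟨d, hz⟩
  let D : Module.End ℂ A[X] := (derivative : A[X] →ₗ[A] A[X]).restrictScalars ℂ
  have hD : ∀ f, D f = derivative f := fun _ => rfl
  let l : A[X] →ₐ[ℂ] Module.End ℂ A[X] := Algebra.lmul ℂ A[X]
  have hl : ∀ f h, l f h = f * h := fun _ _ => rfl
  have hlz : (l z) ^ (d + 1) = 0 := by rw [← map_pow, pow_succ, hz, zero_mul, map_zero]
  have h1 := exp_mul_mul_exp_neg hlz D
  have h2 : ∀ i, ((commMap (l z)) ^ (i + 1)) D = - l (((commMap z) ^ i) (derivative z)) := by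
    intro i
    induction i with
    | zero =>
      refine LinearMap.ext fun f => ?_
      simp only [zero_add, pow_one, pow_zero, commMap_apply, LinearMap.sub_apply,
        Module.End.mul_apply, hl, hD, derivative_mul, LinearMap.neg_apply, Module.End.one_apply]
      abel
    | succ i ih =>
      rw [pow_succ', Module.End.mul_apply, ih, pow_succ', Module.End.mul_apply, commMap_apply,
        commMap_apply, map_sub, map_mul, map_mul]
      refine LinearMap.ext fun f => ?_
      simp only [LinearMap.sub_apply, Module.End.mul_apply, LinearMap.neg_apply, hl]
      noncomm_ring
  have h3 := LinearMap.congr_fun h1 1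
  rw [← map_neg, ← IsNilpotent.map_exp hn l, ← IsNilpotent.map_exp hn.neg l] at h3
  simp only [Module.End.mul_apply, hl, hD, mul_one] at h3
  -- The first term is split off because `D 1 = 0`, the last because it contains `ad z` to the power
  -- `2 * d`.
  rw [show 2 * (d + 1) = 2 * d + 1 + 1 by ring, Finset.sum_range_succ', Finset.sum_range_succ] at h3
  have h4 : ((commMap z) ^ (2 * d)) (derivative z) = 0 := by
    have hc : Commute (LinearMap.mulLeft ℂ z) (LinearMap.mulRight ℂ z) :=
      LinearMap.commute_mulLeft_right z z
    have : (commMap z) ^ (2 * d) = 0 := by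
      rw [commMap, sub_eq_add_neg]
      refine hc.neg_right.add_pow_eq_zero_of_add_le_succ_of_pow_eq_zero (m := d) (n := d) ?_ ?_
        (by omega)
      · rw [LinearMap.pow_mulLeft, hz, LinearMap.mulLeft_zero_eq_zero]
      · rw [neg_pow, LinearMap.pow_mulRight, hz, LinearMap.mulRight_zero_eq_zero, mul_zero]
    rw [this, LinearMap.zero_apply]
  have h5 := congrArg derivative (IsNilpotent.exp_mul_exp_neg_self hn)
  rw [derivative_mul, derivative_one] at h5
  rw [eq_neg_of_add_eq_zero_left h5, h3]
  simp [h2, h4, hD, hl, Finset.sum_neg_distrib]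

lemma exp_monomial_sub_one_mem {N : Submodule ℂ A} (hN : N * N ≤ N) {x : A} (hx : x ∈ N)
    (hn : IsNilpotent x) : IsNilpotent.exp (monomial 1 x) - 1 ∈ coeffsIn N := by
  have hp : ∀ i, x ^ (i + 1) ∈ N := by
    intro i
    induction i with
    | zero => simpa using hx
    | succ i ih => rw [pow_succ]; exact hN (Submodule.mul_mem_mul ih hx)
  obtain ⟨d, hd⟩ := hn
  have h : (monomial 1 x : A[X]) ^ (d + 1) = 0 := by
    rw [monomial_pow, pow_succ, hd, zero_mul, monomial_zero_right]
  rw [IsNilpotent.exp_eq_sum h, Finset.sum_range_succ']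
  simp only [Nat.factorial_zero, pow_zero, Nat.cast_one, inv_one, one_smul, add_sub_cancel_right]
  refine Submodule.sum_mem _ fun i _ => ?_
  rw [rat_inv_smul]
  refine Submodule.smul_mem _ _ fun j => ?_
  rw [monomial_pow, coeff_monomial]
  split_ifs
  · exact hp i
  · exact N.zero_mem

/-- Only the term `i = 0` survives, as `x` commutes with its multiples. -/
lemma derivative_exp_monomial_mul {x : A} (hn : IsNilpotent x) :
    derivative (IsNilpotent.exp (monomial 1 x)) * IsNilpotent.exp (-monomial 1 x) = C x := by
  obtain ⟨d, hd⟩ := hn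
  have h : (monomial 1 x : A[X]) ^ (d + 1) = 0 := by
    rw [monomial_pow, pow_succ, hd, zero_mul, monomial_zero_right]
  have h1 : derivative (monomial 1 x) = C x := by rw [derivative_monomial]; simp
  have h2 : commMap (monomial 1 x) (C x) = 0 := by
    rw [commMap_apply, ← monomial_zero_left, monomial_mul_monomial, monomial_mul_monomial]
    simp
  rw [derivative_exp_mul_exp_neg h, h1, show 2 * (d + 1) = 2 * d + 1 + 1 by ring,
    Finset.sum_range_succ', Finset.sum_eq_zero]
  · simp
  · intro i _
    rw [pow_succ, Module.End.mul_apply, h2, map_zero, smul_zero]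

/-- A Lie algebra contained in a nilpotent associative algebra is closed under the
Baker-Campbell-Hausdorff multiplication. -/
theorem exists_exp_eq_exp_mul_exp {g N : Submodule ℂ A} {d : ℕ}
    (hg : ∀ a ∈ g, ∀ b ∈ g, a * b - b * a ∈ g) (hgN : g ≤ N) (hN : N * N ≤ N) (hNd : N ^ d = ⊥)
    {x y : A} (hx : x ∈ g) (hy : y ∈ g) :
    ∃ z ∈ g, z ^ d = 0 ∧ IsNilpotent.exp z = IsNilpotent.exp x * IsNilpotent.exp y := by
  have hnil : ∀ a ∈ g, a ^ d = 0 := by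
    intro a ha
    have := Submodule.pow_mem_pow N (hgN ha) d
    rwa [hNd, Submodule.mem_bot] at this
  have hm : ∀ a ∈ g, (monomial 1 a : A[X]) ^ d = 0 := by
    intro a ha
    rw [monomial_pow, hnil a ha, monomial_zero_right]
  have hmn : ∀ a ∈ g, IsNilpotent (monomial 1 a : A[X]) := fun a ha => ⟨d, hm a ha⟩
  set ex : A[X] := IsNilpotent.exp (monomial 1 x) with hex
  set ey : A[X] := IsNilpotent.exp (monomial 1 y) with hey
  have hu : (ex * ey - 1) ^ d = 0 := by
    refine pow_eq_zero_of_mem_coeffsIn hNd ?_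
    have h1 := exp_monomial_sub_one_mem hN (hgN hx) ⟨d, hnil x hx⟩
    have h2 := exp_monomial_sub_one_mem hN (hgN hy) ⟨d, hnil y hy⟩
    rw [← hex] at h1
    rw [← hey] at h2
    rw [show ex * ey - 1 = (ex - 1) * (ey - 1) + ((ex - 1) + (ey - 1)) by noncomm_ring]
    have h3 : (ex - 1) * (ey - 1) ∈ coeffsIn N := fun i => hN (mul_mem_coeffsIn h1 h2 i)
    exact Submodule.add_mem _ h3 (Submodule.add_mem _ h1 h2)
  -- The curve `z(t) = log (exp (t x) exp (t y))`, a polynomial in `t`; the required element is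
  -- `z(1)`. It remains to see that all its coefficients lie in `g`.
  set z : A[X] := aeval (ex * ey - 1) (logPoly d) with hz
  have hzd : z ^ d = 0 := pow_aeval_logPoly hu
  have hzn : IsNilpotent z := ⟨d, hzd⟩
  have hez : IsNilpotent.exp z = ex * ey := by
    have := exp_aeval_logPoly hu
    rwa [add_sub_cancel, ← hz] at this
  have hinv : IsNilpotent.exp (-z) =
      IsNilpotent.exp (-monomial 1 y) * IsNilpotent.exp (-monomial 1 x) := by
    refine left_inv_eq_right_inv (a := ex * ey) ?_ ?_
    · rw [← hez]; exact IsNilpotent.exp_neg_mul_exp_self hzn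
    · rw [mul_assoc, ← mul_assoc ey, IsNilpotent.exp_mul_exp_neg_self (hmn y hy), one_mul,
        IsNilpotent.exp_mul_exp_neg_self (hmn x hx)]
  -- The logarithmic derivative of `exp (t x) exp (t y)` is `x + exp (t x) y exp (-t x)`, which
  -- expands into iterated brackets with `x`.
  have hB : derivative (IsNilpotent.exp z) * IsNilpotent.exp (-z) ∈ coeffsIn g := by
    have h1 := derivative_exp_monomial_mul ⟨d, hnil x hx⟩
    have h2 := derivative_exp_monomial_mul ⟨d, hnil y hy⟩
    have h3 : derivative (IsNilpotent.exp z) * IsNilpotent.exp (-z) =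
        C x + ex * C y * IsNilpotent.exp (-monomial 1 x) := by
      have h4 := IsNilpotent.exp_mul_exp_neg_self (hmn y hy)
      rw [← hex] at h1
      rw [← hey] at h2 h4
      rw [hinv, hez, derivative_mul]
      calc _ = derivative ex * (ey * IsNilpotent.exp (-monomial 1 y)) *
            IsNilpotent.exp (-monomial 1 x) + ex * (derivative ey *
            IsNilpotent.exp (-monomial 1 y)) * IsNilpotent.exp (-monomial 1 x) := by noncomm_ring
        _ = _ := by rw [h2, h4, mul_one, h1]
    have hC : ∀ a ∈ g, (C a : A[X]) ∈ coeffsIn g := by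
      intro a ha i
      rw [coeff_C]
      split_ifs
      exacts [ha, g.zero_mem]
    rw [h3, hex, exp_mul_mul_exp_neg (hm x hx)]
    refine Submodule.add_mem _ (hC x hx) (Submodule.sum_mem _ fun i hi => Submodule.smul_mem _ _ ?_)
    clear hi
    induction i with
    | zero => exact hC y hy
    | succ i ih =>
      rw [pow_succ', Module.End.mul_apply]
      exact commMap_mem_coeffsIn hg hx ih
  -- Coefficients do not commute, so evaluation is a ring homomorphism only at central points such
  -- as `0` and `1`.
  let ev0 : A[X] →+* A := eval₂RingHom' (RingHom.id A) 0 fun a => Commute.zero_right _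
  let ev1 : A[X] →+* A := eval₂RingHom' (RingHom.id A) 1 fun a => Commute.one_right _
  have hz0 : z.coeff 0 = 0 := by
    have h1 : ev0 z = z.coeff 0 := by
      change eval₂ _ _ _ = _
      rw [eval₂_at_zero]; rfl
    have h2 : ∀ a ∈ g, ev0 (IsNilpotent.exp (monomial 1 a)) = 1 := by
      intro a ha
      rw [IsNilpotent.map_exp (hmn a ha)]
      have : ev0 (monomial 1 a) = 0 := by
        change eval₂ _ _ _ = _
        rw [eval₂_monomial]; simp
      rw [this, IsNilpotent.exp_zero]
    rw [← h1]
    refine exp_eq_one_imp (hzn.map ev0) ?_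
    rw [← IsNilpotent.map_exp hzn, hez, map_mul, h2 x hx, h2 y hy, mul_one]
  -- Compare coefficients of `t ^ m` in `∑ (ad z) ^ i (z') / (i + 1)!`: the term `i = 0` gives `(m +
  -- 1)` times the coefficient of `z` in degree `m + 1`, and the other terms involve only lower
  -- coefficients of `z`.
  have hzg : ∀ m, ∀ i ≤ m, z.coeff i ∈ g := by
    intro m
    induction m with
    | zero =>
      intro i hi
      rw [Nat.le_zero.mp hi, hz0]
      exact g.zero_mem
    | succ m ih =>
      intro i hi
      rcases Nat.lt_or_ge i (m + 1) with h | h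
      · exact ih i (by omega)
      obtain rfl : i = m + 1 := by omega
      have hD : ∀ i < m, (derivative z).coeff i ∈ g := by
        intro i hi
        rw [coeff_derivative_eq_smul]
        exact g.smul_mem _ (ih _ hi)
      have hpow : ∀ n, ∀ i ≤ m, (((commMap z) ^ (n + 1)) (derivative z)).coeff i ∈ g := by
        intro n
        induction n with
        | zero =>
          rw [zero_add, pow_one]
          exact coeff_commMap_mem hg hz0 ih hD
        | succ n ihn =>
          rw [pow_succ', Module.End.mul_apply]
          exact coeff_commMap_mem hg hz0 ih fun i hi => ihn i hi.le
      have h1 := hB m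
      rw [derivative_exp_mul_exp_neg (d := d + 1) (by rw [pow_succ, hzd, zero_mul]),
        show 2 * (d + 1) = 2 * d + 1 + 1 by ring, Finset.sum_range_succ', coeff_add,
        finsetSum_coeff] at h1
      have h2 := (Submodule.add_mem_iff_right g (Submodule.sum_mem g fun i _ => by
        rw [coeff_smul]
        exact g.smul_mem _ (hpow i m le_rfl))).mp h1
      rw [coeff_smul, pow_zero, Module.End.one_apply, coeff_derivative_eq_smul, smul_smul] at h2
      refine (g.smul_mem_iff ?_).mp h2
      simp only [zero_add, Nat.factorial_one, Nat.cast_one, inv_one, one_mul]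
      exact Nat.cast_add_one_ne_zero m
  refine ⟨ev1 z, ?_, by rw [← map_pow, hzd, map_zero], ?_⟩
  · change eval₂ _ _ _ ∈ g
    rw [eval₂_eq_sum_range]
    refine Submodule.sum_mem _ fun i _ => ?_
    rw [one_pow, mul_one]
    exact hzg i i le_rfl
  · have h2 : ∀ a ∈ g, ev1 (IsNilpotent.exp (monomial 1 a)) = IsNilpotent.exp a := by
      intro a ha
      rw [IsNilpotent.map_exp (hmn a ha)]
      congr 1
      change eval₂ _ _ _ = _
      rw [eval₂_monomial]; simp
    rw [← IsNilpotent.map_exp hzn, hez, map_mul, h2 x hx, h2 y hy]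

end BakerCampbellHausdorff

/-! ### Engel's theorem -/

section Engel

variable {V : Type*} [AddCommGroup V] [Module ℂ V] [FiniteDimensional ℂ V]

attribute [local instance] LieRing.ofAssociativeRing

/-- Engel's theorem: a Lie algebra of nilpotent endomorphisms is contained in a nilpotent
associative algebra. -/
lemma exists_nilpotent_algebra {g : Submodule ℂ (Module.End ℂ V)}
    (hg : ∀ a ∈ g, ∀ b ∈ g, a * b - b * a ∈ g) (hn : ∀ a ∈ g, IsNilpotent a) :
    ∃ (N : Submodule ℂ (Module.End ℂ V)) (d : ℕ), g ≤ N ∧ N * N ≤ N ∧ N ^ d = ⊥ := by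
  let L : LieSubalgebra ℂ (Module.End ℂ V) := { g with lie_mem' := fun {a b} ha hb => hg a ha b hb }
  have hL : LieModule.IsNilpotent L V := by
    rw [LieModule.isNilpotent_iff_forall (R := ℂ)]
    intro x
    exact hn x.1 x.2
  obtain ⟨d, hd⟩ := (LieModule.isNilpotent_iff ℂ L V).mp hL
  let F : ℕ → LieSubmodule ℂ L V := LieModule.lowerCentralSeries ℂ L V
  have hF : ∀ i, ∀ v ∈ F (i + 1), v ∈ F i := fun i v hv =>
    LieModule.antitone_lowerCentralSeries ℂ L V (Nat.le_succ i) hv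
  -- The operators that move each step of the lower central series of `V` into the next one form an
  -- associative algebra; a product of `d` of them maps `V` into the step `d`, which is zero.
  let N : Submodule ℂ (Module.End ℂ V) :=
    { carrier := {a | ∀ i, ∀ v ∈ F i, a v ∈ F (i + 1)}
      add_mem' := fun ha hb i v hv => add_mem (ha i v hv) (hb i v hv)
      zero_mem' := fun i v _ => zero_mem _
      smul_mem' := fun c a ha i v hv => (F (i + 1)).smul_mem c (ha i v hv) }
  refine ⟨N, d, ?_, ?_, ?_⟩
  · intro a ha i v hv
    change a v ∈ LieModule.lowerCentralSeries ℂ L V (i + 1)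
    rw [LieModule.lowerCentralSeries_succ]
    exact LieSubmodule.lie_mem_lie (x := (⟨a, ha⟩ : L)) (LieSubmodule.mem_top _) hv
  · rw [Submodule.mul_le]
    intro a ha b hb i v hv
    exact hF _ _ (ha _ _ (hb i v hv))
  · have key : ∀ m, ∀ a ∈ N ^ m, ∀ i, ∀ v ∈ F i, a v ∈ F (i + m) := by
      intro m
      induction m with
      | zero =>
        intro a ha i v hv
        rw [Submodule.pow_zero, Submodule.mem_one] at ha
        obtain ⟨c, rfl⟩ := ha
        exact (F i).smul_mem c hv
      | succ m ih =>
        intro a ha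
        rw [Submodule.pow_succ] at ha
        refine Submodule.mul_induction_on ha ?_ ?_
        · intro a ha b hb i v hv
          rw [show i + (m + 1) = i + 1 + m by omega]
          exact ih a ha (i + 1) (b v) (hb i v hv)
        · intro a b ha hb i v hv
          exact add_mem (ha i v hv) (hb i v hv)
    rw [eq_bot_iff]
    intro a ha
    rw [Submodule.mem_bot]
    refine LinearMap.ext fun v => ?_
    have := key d a ha 0 v (LieSubmodule.mem_top v)
    rw [zero_add] at this
    change a v ∈ LieModule.lowerCentralSeries ℂ L V d at this
    rw [hd] at this
    simpa using this

end Engel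

end FormalLie
namespace FormalLie

open Polynomial

/-! ### Regular maps into an algebra, relative to any algebra of scalar functions -/

section RegularMaps

variable {P A : Type*} [Ring A] [Algebra ℂ A]

/-- A map into a finite-dimensional algebra is regular with respect to an algebra `R` of functions
if its composition with every linear form belongs to `R`. -/
def IsRegular (R : Subalgebra ℂ (P → ℂ)) (c : P → A) : Prop :=
  ∀ l : Module.Dual ℂ A, (fun p => l (c p)) ∈ R

variable {R : Subalgebra ℂ (P → ℂ)} {c c' : P → A}

lemma isRegular_const (a : A) : IsRegular R fun _ => a := fun l => R.algebraMap_mem (l a)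

lemma IsRegular.add (h : IsRegular R c) (h' : IsRegular R c') :
    IsRegular R fun p => c p + c' p := fun l => by
  simp only [map_add]
  exact R.add_mem (h l) (h' l)

lemma IsRegular.sub (h : IsRegular R c) (h' : IsRegular R c') :
    IsRegular R fun p => c p - c' p := fun l => by
  simp only [map_sub]
  exact R.sub_mem (h l) (h' l)

lemma IsRegular.sum {ι : Type*} {s : Finset ι} {c : ι → P → A} (h : ∀ i ∈ s, IsRegular R (c i)) :
    IsRegular R fun p => ∑ i ∈ s, c i p := fun l => by
  have := R.sum_mem fun i hi => h i hi l
  convert this using 1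
  ext p
  simp

lemma IsRegular.smul {f : P → ℂ} (hf : f ∈ R) (h : IsRegular R c) :
    IsRegular R fun p => f p • c p := fun l => by
  simp only [map_smul]
  exact R.mul_mem hf (h l)

/-- Expanding the left factor in a basis makes the value a finite sum of products of regular
functions. -/
lemma IsRegular.mul [FiniteDimensional ℂ A] (h : IsRegular R c) (h' : IsRegular R c') :
    IsRegular R fun p => c p * c' p := fun l => by
  let b := Module.finBasis ℂ A
  have : (fun p => l (c p * c' p)) = ∑ i, (fun p => b.coord i (c p)) *
      (fun p => (l ∘ₗ LinearMap.mulLeft ℂ (b i)) (c' p)) := by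
    ext p
    conv_lhs => rw [← b.sum_repr (c p), Finset.sum_mul, map_sum]
    simp
  rw [this]
  exact R.sum_mem fun i _ => R.mul_mem (h _) (h' _)

lemma IsRegular.pow [FiniteDimensional ℂ A] (h : IsRegular R c) (m : ℕ) :
    IsRegular R fun p => c p ^ m := by
  induction m with
  | zero => simpa using isRegular_const (R := R) (1 : A)
  | succ m ih => simpa only [pow_succ] using ih.mul h

lemma IsRegular.aeval [FiniteDimensional ℂ A] (h : IsRegular R c) (q : ℂ[X]) :
    IsRegular R fun p => Polynomial.aeval (c p) q := by
  simp only [Polynomial.aeval_eq_sum_range]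
  exact IsRegular.sum fun i _ => IsRegular.smul (R.algebraMap_mem (q.coeff i)) (h.pow i)

lemma IsRegular.list_prod [FiniteDimensional ℂ A] {ι : Type*} (l : List ι) {c : ι → P → A}
    (h : ∀ i ∈ l, IsRegular R (c i)) : IsRegular R fun p => (l.map fun i => c i p).prod := by
  induction l with
  | nil => simpa using isRegular_const (R := R) (1 : A)
  | cons i l ih =>
    simp only [List.map_cons, List.prod_cons]
    exact (h i (by simp)).mul (ih fun j hj => h j (by simp [hj]))

end RegularMaps

/-! ### Polynomial functions, on `End V` and on the line, and smooth functions -/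

section PolynomialFunctions

variable {V P : Type*} [AddCommGroup V] [Module ℂ V]

lemma isRegular_id : IsRegular (polyFun V) (fun a : Module.End ℂ V => a) :=
  fun l => Algebra.subset_adjoin ⟨l, rfl⟩

lemma IsRegular.comp_polyFun {R : Subalgebra ℂ (P → ℂ)} {c : P → Module.End ℂ V}
    (h : IsRegular R c) {p : Module.End ℂ V → ℂ} (hp : p ∈ polyFun V) :
    (fun x => p (c x)) ∈ R := by
  refine Algebra.adjoin_induction (p := fun p _ => (fun x => p (c x)) ∈ R) ?_ ?_ ?_ ?_ hp
  · rintro _ ⟨l, rfl⟩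
    exact h l
  · exact fun r => R.algebraMap_mem r
  · exact fun _ _ _ _ h1 h2 => R.add_mem h1 h2
  · exact fun _ _ _ _ h1 h2 => R.mul_mem h1 h2

/-- Convergence in `End V` is tested on linear forms, which avoids choosing a topology there. -/
lemma tendsto_polyFun {F : Filter P} {c : P → Module.End ℂ V} {a : Module.End ℂ V}
    (h : ∀ l : Module.Dual ℂ (Module.End ℂ V), Filter.Tendsto (fun x => l (c x)) F (nhds (l a)))
    {p : Module.End ℂ V → ℂ} (hp : p ∈ polyFun V) :
    Filter.Tendsto (fun x => p (c x)) F (nhds (p a)) := by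
  refine Algebra.adjoin_induction
    (p := fun p _ => Filter.Tendsto (fun x => p (c x)) F (nhds (p a))) ?_ ?_ ?_ ?_ hp
  · rintro _ ⟨l, rfl⟩
    exact h l
  · exact fun r => tendsto_const_nhds
  · exact fun _ _ _ _ h1 h2 => h1.add h2
  · exact fun _ _ _ _ h1 h2 => h1.mul h2

/-- The algebra of polynomial functions of one variable. -/
noncomputable def polyFunLine : Subalgebra ℂ (ℂ → ℂ) :=
  (Polynomial.aeval (fun t : ℂ => t) : ℂ[X] →ₐ[ℂ] ℂ → ℂ).range

lemma id_mem_polyFunLine : (fun t : ℂ => t) ∈ polyFunLine := ⟨X, by simp⟩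

/-- A polynomial with infinitely many roots is zero. This carries polynomial equations from the
integer powers of an element to its whole one-parameter group. -/
lemma eq_zero_of_mem_polyFunLine {f : ℂ → ℂ} (hf : f ∈ polyFunLine) (h : ∀ m : ℕ, f m = 0)
    (t : ℂ) : f t = 0 := by
  obtain ⟨q, rfl⟩ := hf
  have hq : ∀ t, (Polynomial.aeval (fun t : ℂ => t) q) t = q.eval t := by
    intro t
    rw [Polynomial.aeval_eq_sum_range, Polynomial.eval_eq_sum_range]
    simp
  simp only [AlgHom.toRingHom_eq_coe, RingHom.coe_coe, hq] at h ⊢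
  have : q = 0 := by
    refine Polynomial.eq_zero_of_infinite_isRoot q (Set.Infinite.mono ?_
      (Set.infinite_range_of_injective (Nat.cast_injective (R := ℂ))))
    rintro _ ⟨m, rfl⟩
    exact h m
  rw [this, Polynomial.eval_zero]

/-- The algebra of continuously differentiable functions of several complex variables. -/
def smoothFun (ι : Type*) [Fintype ι] : Subalgebra ℂ ((ι → ℂ) → ℂ) where
  carrier := {f | ContDiff ℂ 1 f}
  mul_mem' {f g} hf hg := by
    rw [Set.mem_ofPred_eq] at hf hg ⊢
    exact ContDiff.mul hf hg
  add_mem' {f g} hf hg := by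
    rw [Set.mem_ofPred_eq] at hf hg ⊢
    exact ContDiff.add hf hg
  algebraMap_mem' c := by
    rw [Set.mem_ofPred_eq]
    exact contDiff_const (c := c)

lemma mem_smoothFun {ι : Type*} [Fintype ι] {f : (ι → ℂ) → ℂ} :
    f ∈ smoothFun ι ↔ ContDiff ℂ 1 f := Iff.rfl

end PolynomialFunctions

/-! ### Ordered products of exponentials -/

section ProdExp

variable {V : Type*} [AddCommGroup V] [Module ℂ V]

lemma prod_map_eq_single {M ι : Type*} [Monoid M] {f : ι → M} {i : ι} {l : List ι}
    (hl : l.Nodup) (hi : i ∈ l) (h : ∀ j, j ≠ i → f j = 1) : (l.map f).prod = f i := by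
  induction l with
  | nil => simp at hi
  | cons j l ih =>
    rw [List.map_cons, List.prod_cons]
    rw [List.nodup_cons] at hl
    by_cases hj : j = i
    · subst hj
      rw [List.prod_eq_one, mul_one]
      intro x hx
      obtain ⟨k, hk, rfl⟩ := List.mem_map.mp hx
      exact h k fun hkj => hl.1 (hkj ▸ hk)
    · rw [h j hj, one_mul]
      exact ih hl.2 ((List.mem_cons.mp hi).resolve_left fun h => hj h.symm)

variable [Module ℚ (Module.End ℂ V)]

/-- The ordered product of the elements `exp (t i • Y i)`. -/
noncomputable def prodExp {ι : Type*} [Fintype ι] (Y : ι → Module.End ℂ V) (t : ι → ℂ) :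
    Module.End ℂ V :=
  ((Finset.univ : Finset ι).toList.map fun i => IsNilpotent.exp (t i • Y i)).prod

lemma prodExp_single {ι : Type*} [Fintype ι] [DecidableEq ι] (Y : ι → Module.End ℂ V) (i : ι)
    (s : ℂ) : prodExp Y (Pi.single i s) = IsNilpotent.exp (s • Y i) := by
  rw [prodExp, prod_map_eq_single (Finset.nodup_toList _) (i := i) (by simp), Pi.single_eq_same]
  intro j hj
  rw [Pi.single_eq_of_ne hj, zero_smul, IsNilpotent.exp_zero]

end ProdExp

/-! ### Exponential and logarithm of endomorphisms -/

section UnipotentEnd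

variable {V : Type*} [AddCommGroup V] [Module ℂ V] [FiniteDimensional ℂ V]

/-- An exponent that does not depend on `a` makes nilpotency a polynomial condition and lets a
single polynomial compute all logarithms. -/
lemma pow_finrank_eq_zero {a : Module.End ℂ V} (h : IsNilpotent a) :
    a ^ Module.finrank ℂ V = 0 := by
  obtain ⟨m, hm⟩ := h
  have h1 := Module.End.ker_pow_le_ker_pow_finrank a m
  rw [hm, LinearMap.ker_zero, top_le_iff, LinearMap.ker_eq_top] at h1
  exact h1

/-- The logarithm of a unipotent endomorphism. -/
noncomputable def logEnd (a : Module.End ℂ V) : Module.End ℂ V :=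
  aeval (a - 1) (logPoly (Module.finrank ℂ V))

lemma isRegular_logEnd {P : Type*} {R : Subalgebra ℂ (P → ℂ)} {c : P → Module.End ℂ V}
    (h : IsRegular R c) : IsRegular R fun p => logEnd (c p) :=
  (h.sub (isRegular_const 1)).aeval _

lemma isNilpotent_logEnd {a : Module.End ℂ V} (h : IsNilpotent (a - 1)) :
    IsNilpotent (logEnd a) := ⟨_, pow_aeval_logPoly (pow_finrank_eq_zero h)⟩

variable [Module ℚ (Module.End ℂ V)]

lemma exp_logEnd {a : Module.End ℂ V} (h : IsNilpotent (a - 1)) :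
    IsNilpotent.exp (logEnd a) = a := by
  rw [logEnd, exp_aeval_logPoly (pow_finrank_eq_zero h), add_sub_cancel]

lemma logEnd_exp {a : Module.End ℂ V} (h : IsNilpotent a) :
    logEnd (IsNilpotent.exp a) = a :=
  aeval_logPoly_exp (pow_finrank_eq_zero h)

lemma isRegular_exp {P : Type*} {R : Subalgebra ℂ (P → ℂ)} {c : P → Module.End ℂ V}
    (h : IsRegular R c) (hn : ∀ p, IsNilpotent (c p)) :
    IsRegular R fun p => IsNilpotent.exp (c p) := by
  have : (fun p => IsNilpotent.exp (c p)) =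
      fun p => aeval (c p) (expPoly (Module.finrank ℂ V)) := by
    ext p : 1
    exact exp_eq_aeval (pow_finrank_eq_zero (hn p))
  rw [this]
  exact h.aeval _

/-- The function is continuously differentiable, being regular, so its partial derivatives determine
the differential; on the `i`-th axis it is `s ↦ s * l (Y i)`, because only one exponential factor is
left. -/
lemma hasStrictFDerivAt_logEnd_prodExp {ι : Type*} [Fintype ι] {Y : ι → Module.End ℂ V}
    (hY : ∀ i, IsNilpotent (Y i)) (l : Module.Dual ℂ (Module.End ℂ V)) :
    HasStrictFDerivAt (fun t : ι → ℂ => l (logEnd (prodExp Y t)))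
      (∑ i, l (Y i) • ContinuousLinearMap.proj (R := ℂ) (φ := fun _ : ι => ℂ) i) 0 := by
  classical
  have hreg : IsRegular (smoothFun ι) fun t => logEnd (prodExp Y t) := by
    refine isRegular_logEnd (IsRegular.list_prod _ fun i _ => isRegular_exp ?_ ?_)
    · have hi : (fun t : ι → ℂ => t i) ∈ smoothFun ι := mem_smoothFun.mpr (contDiff_apply ℂ ℂ i)
      exact IsRegular.smul hi (isRegular_const _)
    · exact fun t => (hY i).smul _
  have h1 : ContDiff ℂ 1 (fun t : ι → ℂ => l (logEnd (prodExp Y t))) := mem_smoothFun.mp (hreg l)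
  have h2 := (h1.contDiffAt (x := 0)).hasStrictFDerivAt one_ne_zero
  refine h2.congr_fderiv ?_
  refine ContinuousLinearMap.coe_injective (LinearMap.pi_ext' fun i => LinearMap.ext_ring ?_)
  · have h3 : HasDerivAt (fun s : ℂ => (Pi.single i s : ι → ℂ)) (Pi.single i 1) 0 := by
      rw [hasDerivAt_pi]
      intro j
      by_cases hj : j = i
      · subst hj; simpa using hasDerivAt_id' (0 : ℂ)
      · simpa [Pi.single_eq_of_ne hj] using hasDerivAt_const (0 : ℂ) (0 : ℂ)
    have h4 := h2.hasFDerivAt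
    rw [show (0 : ι → ℂ) = Pi.single i (0 : ℂ) by simp] at h4
    have h5 := h4.comp_hasDerivAt (0 : ℂ) h3
    have h6 : ((fun t : ι → ℂ => l (logEnd (prodExp Y t))) ∘ fun s : ℂ => Pi.single i s) =
        fun s => s * l (Y i) := by
      ext s
      simp only [Function.comp_apply]
      rw [prodExp_single, logEnd_exp ((hY i).smul s), map_smul, smul_eq_mul]
    rw [h6] at h5
    have h7 := h5.unique ((hasDerivAt_id (0 : ℂ)).mul_const (l (Y i)))
    rw [show Pi.single i (0 : ℂ) = (0 : ι → ℂ) by simp] at h7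
    simpa [Pi.single_apply] using h7

end UnipotentEnd

end FormalLie
namespace FormalLie

open Polynomial

/-! ### Zariski closure of a unipotent group -/

section ZariskiClosure

variable {V : Type*} [AddCommGroup V] [Module ℂ V]

/-- The Zariski closure of a set of endomorphisms. -/
def zariskiClosure (S : Set (Module.End ℂ V)) : Set (Module.End ℂ V) :=
  {a | ∀ p ∈ polyFun V, (∀ b ∈ S, p b = 0) → p a = 0}

lemma mapsTo_zariskiClosure {S T : Set (Module.End ℂ V)} {F : Module.End ℂ V → Module.End ℂ V}
    (hF : IsRegular (polyFun V) F) (h : ∀ a ∈ S, F a ∈ zariskiClosure T) {a : Module.End ℂ V}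
    (ha : a ∈ zariskiClosure S) : F a ∈ zariskiClosure T := fun p hp hpT =>
  ha _ (hF.comp_polyFun hp) fun b hb => h b hb p hp hpT

lemma subset_zariskiClosure (S : Set (Module.End ℂ V)) : S ⊆ zariskiClosure S :=
  fun a ha _ _ h => h a ha

lemma eq_of_mem_zariskiClosure {S : Set (Module.End ℂ V)} {W : Type*} [AddCommGroup W]
    [Module ℂ W] {F : Module.End ℂ V → W} (hF : ∀ l : Module.Dual ℂ W, (fun a => l (F a)) ∈ polyFun V)
    (h : ∀ a ∈ S, F a = 0) {a : Module.End ℂ V} (ha : a ∈ zariskiClosure S) : F a = 0 := by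
  rw [← Module.forall_dual_apply_eq_zero_iff ℂ]
  intro l
  exact ha _ (hF l) fun b hb => by rw [h b hb, map_zero]

/-- The set of endomorphisms underlying a subgroup of `GL V`. -/
def endSet (G : Subgroup (LinearMap.GeneralLinearGroup ℂ V)) : Set (Module.End ℂ V) :=
  {a | ∃ A ∈ G, (A : Module.End ℂ V) = a}

lemma coe_mem_endSet {G : Subgroup (LinearMap.GeneralLinearGroup ℂ V)}
    {A : LinearMap.GeneralLinearGroup ℂ V} : (A : Module.End ℂ V) ∈ endSet G ↔ A ∈ G :=
  ⟨fun ⟨_, hB, h⟩ => Units.ext h ▸ hB, fun h => ⟨A, h, rfl⟩⟩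

lemma mul_mem_endSet {G : Subgroup (LinearMap.GeneralLinearGroup ℂ V)} {a b : Module.End ℂ V}
    (ha : a ∈ endSet G) (hb : b ∈ endSet G) : a * b ∈ endSet G := by
  obtain ⟨A, hA, rfl⟩ := ha
  obtain ⟨B, hB, rfl⟩ := hb
  exact ⟨A * B, G.mul_mem hA hB, rfl⟩

lemma one_mem_endSet {G : Subgroup (LinearMap.GeneralLinearGroup ℂ V)} : 1 ∈ endSet G :=
  ⟨1, G.one_mem, rfl⟩

lemma pow_mem_endSet {G : Subgroup (LinearMap.GeneralLinearGroup ℂ V)} {a : Module.End ℂ V}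
    (ha : a ∈ endSet G) (m : ℕ) : a ^ m ∈ endSet G := by
  obtain ⟨A, hA, rfl⟩ := ha
  exact ⟨A ^ m, G.pow_mem hA m, rfl⟩

variable [FiniteDimensional ℂ V]

lemma pow_eq_zero_of_mem_zariskiClosure {G : Subgroup (LinearMap.GeneralLinearGroup ℂ V)}
    (hG : ∀ A ∈ G, IsNilpotent ((A : Module.End ℂ V) - 1)) {a : Module.End ℂ V}
    (ha : a ∈ zariskiClosure (endSet G)) : (a - 1) ^ Module.finrank ℂ V = 0 := by
  refine eq_of_mem_zariskiClosure (F := fun a : Module.End ℂ V => (a - 1) ^ Module.finrank ℂ V)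
    ((isRegular_id.sub (isRegular_const 1)).pow _) ?_ ha
  rintro _ ⟨A, hA, rfl⟩
  exact pow_finrank_eq_zero (hG A hA)

omit [FiniteDimensional ℂ V] in
-- The geometric series makes inversion a polynomial map on unipotent operators.
lemma coe_inv_eq_of_isNilpotent {A : LinearMap.GeneralLinearGroup ℂ V}
    (hA : ((A : Module.End ℂ V) - 1) ^ Module.finrank ℂ V = 0) :
    ((A⁻¹ : LinearMap.GeneralLinearGroup ℂ V) : Module.End ℂ V) =
      ∑ i ∈ Finset.range (Module.finrank ℂ V), (1 - (A : Module.End ℂ V)) ^ i := by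
  refine Units.inv_eq_of_mul_eq_one_right ?_
  have h := mul_neg_geom_sum (1 - (A : Module.End ℂ V)) (Module.finrank ℂ V)
  have h1 : (1 - (A : Module.End ℂ V)) ^ Module.finrank ℂ V = 0 := by
    rw [← neg_sub, neg_pow, hA, mul_zero]
  rwa [sub_sub_cancel, h1, sub_zero] at h

/-- The Zariski closure of a group of unipotent automorphisms. -/
def unipotentClosure (G : Subgroup (LinearMap.GeneralLinearGroup ℂ V))
    (hG : ∀ A ∈ G, IsNilpotent ((A : Module.End ℂ V) - 1)) :
    Subgroup (LinearMap.GeneralLinearGroup ℂ V) where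
  carrier := {A | (A : Module.End ℂ V) ∈ zariskiClosure (endSet G)}
  one_mem' := subset_zariskiClosure _ ⟨1, G.one_mem, rfl⟩
  mul_mem' {A B} hA hB := by
    -- The usual two stages: first the left factor is reduced to an element of `G` with `B` fixed in
    -- the closure, then `B` is.
    refine mapsTo_zariskiClosure (F := fun a => a * (B : Module.End ℂ V))
      (isRegular_id.mul (isRegular_const _)) ?_ hA
    rintro _ ⟨C, hC, rfl⟩
    refine mapsTo_zariskiClosure (F := fun a => (C : Module.End ℂ V) * a)
      ((isRegular_const _).mul isRegular_id) ?_ hB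
    rintro _ ⟨D, hD, rfl⟩
    exact subset_zariskiClosure _ ⟨C * D, G.mul_mem hC hD, rfl⟩
  inv_mem' {A} hA := by
    rw [Set.mem_ofPred_eq] at hA ⊢
    rw [coe_inv_eq_of_isNilpotent (pow_eq_zero_of_mem_zariskiClosure hG hA)]
    refine mapsTo_zariskiClosure
      (F := fun a => ∑ i ∈ Finset.range (Module.finrank ℂ V), (1 - a) ^ i)
      (IsRegular.sum fun i _ => ((isRegular_const 1).sub isRegular_id).pow i) ?_ hA
    rintro _ ⟨B, hB, rfl⟩
    rw [← coe_inv_eq_of_isNilpotent (pow_finrank_eq_zero (hG B hB))]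
    exact subset_zariskiClosure _ ⟨B⁻¹, G.inv_mem hB, rfl⟩

variable {G : Subgroup (LinearMap.GeneralLinearGroup ℂ V)}
  (hG : ∀ A ∈ G, IsNilpotent ((A : Module.End ℂ V) - 1))

lemma le_unipotentClosure : G ≤ unipotentClosure G hG := fun A hA =>
  subset_zariskiClosure _ ⟨A, hA, rfl⟩

lemma isAlgebraicGroup_unipotentClosure : IsAlgebraicGroup (unipotentClosure G hG) := by
  refine ⟨{p | p ∈ polyFun V ∧ ∀ b ∈ endSet G, p b = 0}, fun p hp => hp.1, fun A => ?_⟩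
  exact ⟨fun h p hp => h p hp.1 hp.2, fun h p hp hp' => h p ⟨hp, hp'⟩⟩

omit [FiniteDimensional ℂ V] in
lemma coe_mem_of_mem_zariskiClosure {H : Subgroup (LinearMap.GeneralLinearGroup ℂ V)}
    (hH : IsAlgebraicGroup H) (h : G ≤ H) {A : LinearMap.GeneralLinearGroup ℂ V}
    (hA : (A : Module.End ℂ V) ∈ zariskiClosure (endSet G)) : A ∈ H := by
  obtain ⟨S, hS, hSH⟩ := hH
  rw [hSH]
  intro p hp
  refine hA p (hS hp) ?_
  rintro _ ⟨B, hB, rfl⟩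
  exact (hSH B).mp (h hB) p hp

lemma isNilpotent_of_mem_unipotentClosure {A : LinearMap.GeneralLinearGroup ℂ V}
    (hA : A ∈ unipotentClosure G hG) : IsNilpotent ((A : Module.End ℂ V) - 1) :=
  ⟨_, pow_eq_zero_of_mem_zariskiClosure hG hA⟩

end ZariskiClosure

/-! ### The Lie algebra of logarithms of a unipotent algebraic group -/

section UnipotentGroups

variable {V : Type*} [AddCommGroup V] [Module ℂ V] [Module ℚ (Module.End ℂ V)]

/-- The exponential of a nilpotent endomorphism as an element of `GL V`. -/
noncomputable def expGL (a : Module.End ℂ V) (ha : IsNilpotent a) :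
    LinearMap.GeneralLinearGroup ℂ V where
  val := IsNilpotent.exp a
  inv := IsNilpotent.exp (-a)
  val_inv := IsNilpotent.exp_mul_exp_neg_self ha
  inv_val := IsNilpotent.exp_neg_mul_exp_self ha

lemma exp_mem_endSet {G : Subgroup (LinearMap.GeneralLinearGroup ℂ V)} {a : Module.End ℂ V}
    (ha : IsNilpotent a) : IsNilpotent.exp a ∈ endSet G ↔ expGL a ha ∈ G :=
  coe_mem_endSet (A := expGL a ha)

lemma prodExp_mem_endSet {G : Subgroup (LinearMap.GeneralLinearGroup ℂ V)} {ι : Type*} [Fintype ι]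
    {Y : ι → Module.End ℂ V} {t : ι → ℂ} (h : ∀ i, IsNilpotent.exp (t i • Y i) ∈ endSet G) :
    prodExp Y t ∈ endSet G := by
  rw [prodExp]
  induction (Finset.univ : Finset ι).toList with
  | nil => exact one_mem_endSet
  | cons i l ih =>
    rw [List.map_cons, List.prod_cons]
    exact mul_mem_endSet (h i) ih

/-- Conjugation by `exp a` is a ring automorphism, hence commutes with the exponential. -/
lemma isNilpotent_conj {a b : Module.End ℂ V} (ha : IsNilpotent a) (hb : IsNilpotent b) :
    IsNilpotent (IsNilpotent.exp a * b * IsNilpotent.exp (-a)) ∧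
    IsNilpotent.exp (IsNilpotent.exp a * b * IsNilpotent.exp (-a)) =
      IsNilpotent.exp a * IsNilpotent.exp b * IsNilpotent.exp (-a) := by
  let f : Module.End ℂ V →+* Module.End ℂ V := MulSemiringAction.toRingHom
    (ConjAct (LinearMap.GeneralLinearGroup ℂ V)) _ (ConjAct.toConjAct (expGL a ha))
  have hf : ∀ c, f c = IsNilpotent.exp a * c * IsNilpotent.exp (-a) := fun c => rfl
  have h := IsNilpotent.map_exp hb f
  rw [hf, hf] at h
  exact ⟨hf b ▸ hb.map f, h.symm⟩

/-- The bracket is the coefficient of `s` in a polynomial curve that stays in `W`; a linear form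
vanishing on `W` kills every coefficient of the curve. -/
lemma lie_mem_of_conj_mem {W : Submodule ℂ (Module.End ℂ V)} {a b : Module.End ℂ V}
    (ha : IsNilpotent a)
    (h : ∀ s : ℂ, IsNilpotent.exp (s • a) * b * IsNilpotent.exp (-(s • a)) ∈ W) :
    a * b - b * a ∈ W := by
  obtain ⟨d, hd⟩ := ha
  by_contra hW
  obtain ⟨l, hl, hlW⟩ := Submodule.exists_dual_map_eq_bot_of_notMem hW inferInstance
  refine hl ?_
  -- Using `d + 1` instead of `d` keeps the index `1` in the range even when `d = 0`.
  let q : ℂ[X] := ∑ i ∈ Finset.range (2 * (d + 1)),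
    C (((i.factorial : ℂ)⁻¹) * l ((commMap a ^ i) b)) * X ^ i
  have hq : q = 0 := by
    refine Polynomial.funext fun s => ?_
    have h1 : (s • a) ^ (d + 1) = 0 := by rw [_root_.smul_pow, pow_succ a, hd, zero_mul, smul_zero]
    have h2 := h s
    rw [exp_mul_mul_exp_neg h1] at h2
    have h3 := Submodule.mem_map_of_mem (f := l) h2
    rw [hlW, Submodule.mem_bot, map_sum] at h3
    rw [Polynomial.eval_zero, ← h3, Polynomial.eval_finsetSum]
    refine Finset.sum_congr rfl fun i _ => ?_
    have h4 : commMap (s • a) = s • commMap a := by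
      refine LinearMap.ext fun c => ?_
      simp [smul_sub]
    rw [h4, _root_.smul_pow, LinearMap.smul_apply, map_smul, map_smul]
    simp only [eval_mul, eval_C, eval_pow, eval_X, smul_eq_mul]
    ring
  have := congrArg (fun p => Polynomial.coeff p 1) hq
  simp only [q, Polynomial.finsetSum_coeff, coeff_C_mul_X_pow, coeff_zero] at this
  rw [Finset.sum_ite_eq, if_pos (Finset.mem_range.mpr (by omega))] at this
  simpa using this

variable [FiniteDimensional ℂ V]

/-- The set of logarithms of the elements of a unipotent group. -/
def logSet (C : Subgroup (LinearMap.GeneralLinearGroup ℂ V)) : Set (Module.End ℂ V) :=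
  {a | IsNilpotent a ∧ IsNilpotent.exp a ∈ endSet C}

variable {C : Subgroup (LinearMap.GeneralLinearGroup ℂ V)}

/-- Along `t ↦ exp (t a)` an equation of `C` is a polynomial in `t`; it vanishes on `ℕ` since `exp
(m a)` is a power of `exp a`. -/
lemma smul_mem_logSet (hC : IsAlgebraicGroup C) {a : Module.End ℂ V} (ha : a ∈ logSet C) (t : ℂ) :
    t • a ∈ logSet C := by
  obtain ⟨hn, he⟩ := ha
  refine ⟨hn.smul t, ?_⟩
  rw [exp_mem_endSet (hn.smul t)]
  obtain ⟨S, hS, hSC⟩ := hC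
  rw [hSC]
  intro p hp
  have hr : IsRegular polyFunLine fun t : ℂ => IsNilpotent.exp (t • a) :=
    isRegular_exp (IsRegular.smul id_mem_polyFunLine (isRegular_const a)) fun t => hn.smul t
  refine eq_zero_of_mem_polyFunLine (hr.comp_polyFun (hS hp)) (fun m => ?_) t
  obtain ⟨A, hA, hAe⟩ := pow_mem_endSet he m
  rw [exp_natCast_smul hn, ← hAe]
  exact (hSC A).mp hA p hp

/-- With the exponent `finrank`, both nilpotency of `a` and `exp a ∈ C` are polynomial equations in
`a`, so they pass to the limit. -/
lemma mem_logSet_of_tendsto (hC : IsAlgebraicGroup C) {w : ℂ → Module.End ℂ V}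
    {a : Module.End ℂ V} (hw : ∀ s, s ≠ 0 → w s ∈ logSet C)
    (h : ∀ l : Module.Dual ℂ (Module.End ℂ V),
      Filter.Tendsto (fun s => l (w s)) (nhdsWithin 0 {0}ᶜ) (nhds (l a))) : a ∈ logSet C := by
  have key : ∀ p ∈ polyFun V, (∀ s, s ≠ 0 → p (w s) = 0) → p a = 0 := by
    intro p hp hpw
    refine tendsto_nhds_unique (tendsto_polyFun h hp) ?_
    refine tendsto_const_nhds.congr' ?_
    filter_upwards [self_mem_nhdsWithin] with s hs
    exact (hpw s hs).symm
  have hn : a ^ Module.finrank ℂ V = 0 := by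
    rw [← Module.forall_dual_apply_eq_zero_iff ℂ]
    intro l
    refine key (fun a => l (a ^ Module.finrank ℂ V)) (isRegular_id.pow _ l) fun s hs => ?_
    rw [pow_finrank_eq_zero (hw s hs).1, map_zero]
  have hn' : IsNilpotent a := ⟨_, hn⟩
  refine ⟨hn', ?_⟩
  rw [exp_mem_endSet hn']
  obtain ⟨S, hS, hSC⟩ := hC
  rw [hSC]
  intro p hp
  change p (IsNilpotent.exp a) = 0
  rw [exp_eq_aeval hn]
  refine key (fun a => p (aeval a (expPoly (Module.finrank ℂ V))))
    ((isRegular_id.aeval _).comp_polyFun (hS hp)) fun s hs => ?_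
  rw [← exp_eq_aeval (pow_finrank_eq_zero (hw s hs).1)]
  obtain ⟨A, hA, hAe⟩ := (hw s hs).2
  rw [← hAe]
  exact (hSC A).mp hA p hp

lemma logEnd_mem_logSet (hCu : ∀ A ∈ C, IsNilpotent ((A : Module.End ℂ V) - 1))
    {a : Module.End ℂ V} (ha : a ∈ endSet C) : logEnd a ∈ logSet C := by
  obtain ⟨A, hA, rfl⟩ := ha
  refine ⟨isNilpotent_logEnd (hCu A hA), ?_⟩
  rw [exp_logEnd (hCu A hA)]
  exact ⟨A, hA, rfl⟩

/-- The sum is the derivative at `s = 0` of `log (∏ exp (s Y_i))`, hence a limit of multiples of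
logarithms of elements of `C`. -/
lemma sum_mem_logSet (hC : IsAlgebraicGroup C)
    (hCu : ∀ A ∈ C, IsNilpotent ((A : Module.End ℂ V) - 1)) {ι : Type*} [Fintype ι]
    {Y : ι → Module.End ℂ V} (hY : ∀ i, Y i ∈ logSet C) : ∑ i, Y i ∈ logSet C := by
  refine mem_logSet_of_tendsto hC (w := fun s => s⁻¹ • logEnd (prodExp Y fun _ => s)) ?_ ?_
  · intro s hs
    refine smul_mem_logSet hC (logEnd_mem_logSet hCu (prodExp_mem_endSet fun i => ?_)) _
    exact (smul_mem_logSet hC (hY i) s).2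
  · intro l
    have h1 := (hasStrictFDerivAt_logEnd_prodExp (fun i => (hY i).1) l).hasFDerivAt
    have h2 : HasDerivAt (fun s : ℂ => (fun _ => s : ι → ℂ)) (fun _ => 1) 0 :=
      hasDerivAt_pi.mpr fun _ => hasDerivAt_id' 0
    have h3 := h1.comp_hasDerivAt (0 : ℂ) h2
    rw [hasDerivAt_iff_tendsto_slope] at h3
    have h0 : logEnd (prodExp Y fun _ => 0) = 0 := by
      have : prodExp Y (fun _ => 0) = IsNilpotent.exp (0 : Module.End ℂ V) := by
        rw [prodExp, List.prod_eq_one]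
        · simp
        · intro x hx
          obtain ⟨i, _, rfl⟩ := List.mem_map.mp hx
          simp
      rw [this, logEnd_exp IsNilpotent.zero]
    convert h3 using 1
    · ext s
      simp [slope, h0]
    · simp [map_sum]

/-- The Lie algebra of a unipotent algebraic group, as the set of logarithms of its elements. -/
def logSubmodule (hC : IsAlgebraicGroup C)
    (hCu : ∀ A ∈ C, IsNilpotent ((A : Module.End ℂ V) - 1)) : Submodule ℂ (Module.End ℂ V) where
  carrier := logSet C
  add_mem' {a b} ha hb := by
    have := sum_mem_logSet hC hCu (Y := fun i : Bool => cond i a b) fun i => by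
      cases i <;> assumption
    simpa using this
  zero_mem' := ⟨IsNilpotent.zero, by rw [IsNilpotent.exp_zero]; exact one_mem_endSet⟩
  smul_mem' t a ha := smul_mem_logSet hC ha t

/-- The set of logarithms is stable under conjugation by `exp (s a)`, and the bracket is the linear
term in `s`. -/
lemma lie_mem_logSet (hC : IsAlgebraicGroup C)
    (hCu : ∀ A ∈ C, IsNilpotent ((A : Module.End ℂ V) - 1)) {a b : Module.End ℂ V}
    (ha : a ∈ logSet C) (hb : b ∈ logSet C) : a * b - b * a ∈ logSet C := by
  refine lie_mem_of_conj_mem (W := logSubmodule hC hCu) ha.1 fun s => ?_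
  have hsa := smul_mem_logSet hC ha s
  have hsa' := smul_mem_logSet hC ha (-s)
  rw [neg_smul] at hsa'
  obtain ⟨h1, h2⟩ := isNilpotent_conj hsa.1 hb.1
  refine ⟨h1, ?_⟩
  rw [h2]
  exact mul_mem_endSet (mul_mem_endSet hsa.2 hb.2) hsa'.2

end UnipotentGroups

end FormalLie
namespace FormalLie

open Polynomial

/-! ### The algebraic group of a Lie algebra of nilpotent endomorphisms -/

section ExpGroup

variable {V : Type*} [AddCommGroup V] [Module ℂ V] [Module ℚ (Module.End ℂ V)]

/-- A Lie algebra of nilpotent endomorphisms. -/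
structure IsNilpotentLie (g : Submodule ℂ (Module.End ℂ V)) : Prop where
  lie_mem : ∀ a ∈ g, ∀ b ∈ g, a * b - b * a ∈ g
  isNilpotent : ∀ a ∈ g, IsNilpotent a

variable [FiniteDimensional ℂ V] {g : Submodule ℂ (Module.End ℂ V)}

/-- The exponential of a Lie algebra of nilpotent endomorphisms is a group. -/
def expGroup (hg : IsNilpotentLie g) : Subgroup (LinearMap.GeneralLinearGroup ℂ V) where
  carrier := {A | ∃ z ∈ g, IsNilpotent.exp z = (A : Module.End ℂ V)}
  one_mem' := ⟨0, g.zero_mem, IsNilpotent.exp_zero⟩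
  mul_mem' := by
    rintro A B ⟨x, hx, hxA⟩ ⟨y, hy, hyB⟩
    obtain ⟨N, d, hgN, hN, hNd⟩ := exists_nilpotent_algebra hg.lie_mem hg.isNilpotent
    obtain ⟨z, hz, -, h⟩ := exists_exp_eq_exp_mul_exp hg.lie_mem hgN hN hNd hx hy
    exact ⟨z, hz, by rw [h, hxA, hyB]; rfl⟩
  inv_mem' := by
    rintro A ⟨x, hx, hxA⟩
    refine ⟨-x, g.neg_mem hx, ?_⟩
    rw [eq_comm]
    refine Units.inv_eq_of_mul_eq_one_right ?_
    rw [← hxA]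
    exact IsNilpotent.exp_mul_exp_neg_self (hg.isNilpotent x hx)

lemma mem_endSet_expGroup (hg : IsNilpotentLie g) {a : Module.End ℂ V} :
    a ∈ endSet (expGroup hg) ↔ ∃ z ∈ g, IsNilpotent.exp z = a := by
  constructor
  · rintro ⟨A, hA, rfl⟩
    exact hA
  · rintro ⟨z, hz, rfl⟩
    exact ⟨expGL z (hg.isNilpotent z hz), ⟨z, hz, rfl⟩, rfl⟩

lemma exp_mem_endSet_expGroup (hg : IsNilpotentLie g) {a : Module.End ℂ V} (ha : IsNilpotent a) :
    IsNilpotent.exp a ∈ endSet (expGroup hg) ↔ a ∈ g := by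
  rw [mem_endSet_expGroup]
  constructor
  · rintro ⟨z, hz, h⟩
    exact exp_injective_of_isNilpotent (hg.isNilpotent z hz) ha h ▸ hz
  · exact fun h => ⟨a, h, rfl⟩

lemma isNilpotent_sub_one_of_mem_expGroup (hg : IsNilpotentLie g)
    {A : LinearMap.GeneralLinearGroup ℂ V} (hA : A ∈ expGroup hg) :
    IsNilpotent ((A : Module.End ℂ V) - 1) := by
  obtain ⟨z, hz, h⟩ := hA
  rw [← h]
  exact IsNilpotent.isNilpotent_exp_sub_one (hg.isNilpotent z hz)

lemma mem_expGroup_iff_logEnd (hg : IsNilpotentLie g) {A : LinearMap.GeneralLinearGroup ℂ V} :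
    A ∈ expGroup hg ↔ IsNilpotent ((A : Module.End ℂ V) - 1) ∧ logEnd (A : Module.End ℂ V) ∈ g := by
  constructor
  · intro hA
    refine ⟨isNilpotent_sub_one_of_mem_expGroup hg hA, ?_⟩
    obtain ⟨z, hz, h⟩ := hA
    rwa [← h, logEnd_exp (hg.isNilpotent z hz)]
  · rintro ⟨h1, h2⟩
    exact ⟨_, h2, exp_logEnd h1⟩

lemma logEnd_mem_of_mem_endSet_expGroup (hg : IsNilpotentLie g) {a : Module.End ℂ V}
    (ha : a ∈ endSet (expGroup hg)) : logEnd a ∈ g := by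
  obtain ⟨A, hA, rfl⟩ := ha
  exact ((mem_expGroup_iff_logEnd hg).mp hA).2

omit [Module ℚ (Module.End ℂ V)] [FiniteDimensional ℂ V] in
lemma mem_iff_forall_dual {W : Type*} [AddCommGroup W] [Module ℂ W] {g : Submodule ℂ W} {a : W} :
    a ∈ g ↔ ∀ l : Module.Dual ℂ W, (∀ b ∈ g, l b = 0) → l a = 0 := by
  refine ⟨fun ha l hl => hl a ha, fun h => ?_⟩
  by_contra ha
  obtain ⟨l, hl, hlg⟩ := Submodule.exists_dual_map_eq_bot_of_notMem ha inferInstance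
  refine hl (h l fun b hb => ?_)
  have := Submodule.mem_map_of_mem (f := l) hb
  rwa [hlg, Submodule.mem_bot] at this

/-- Membership means unipotence together with `l (log a) = 0` for the forms `l` vanishing on `g`; as
the logarithm is polynomial, both conditions persist on the Zariski closure. -/
lemma isAlgebraicGroup_expGroup (hg : IsNilpotentLie g) : IsAlgebraicGroup (expGroup hg) := by
  refine ⟨{p | p ∈ polyFun V ∧ ∀ b ∈ endSet (expGroup hg), p b = 0}, fun p hp => hp.1, fun A => ?_⟩
  refine ⟨fun h p hp => hp.2 _ ⟨A, h, rfl⟩, fun h => ?_⟩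
  have hA : (A : Module.End ℂ V) ∈ zariskiClosure (endSet (expGroup hg)) :=
    fun p hp hp' => h p ⟨hp, hp'⟩
  rw [mem_expGroup_iff_logEnd hg]
  refine ⟨⟨_, pow_eq_zero_of_mem_zariskiClosure
    (fun B hB => isNilpotent_sub_one_of_mem_expGroup hg hB) hA⟩, ?_⟩
  rw [mem_iff_forall_dual]
  intro l hl
  exact hA (fun a => l (logEnd a)) (isRegular_logEnd isRegular_id l)
    fun b hb => hl _ (logEnd_mem_of_mem_endSet_expGroup hg hb)

omit [Module ℚ (Module.End ℂ V)] [FiniteDimensional ℂ V] in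
-- Two curves with the same value and velocity remain tangent under polynomial functions; this is
-- used to exchange `1 + t a` and `exp (t a)`.
lemma exists_hasDerivAt_polyFun {c c' : ℂ → Module.End ℂ V} {s : ℂ} (h0 : c s = c' s)
    (h : ∀ l : Module.Dual ℂ (Module.End ℂ V), ∃ D, HasDerivAt (fun t => l (c t)) D s ∧
      HasDerivAt (fun t => l (c' t)) D s) {p : Module.End ℂ V → ℂ} (hp : p ∈ polyFun V) :
    ∃ D, HasDerivAt (fun t => p (c t)) D s ∧ HasDerivAt (fun t => p (c' t)) D s := by
  refine Algebra.adjoin_induction (p := fun p _ => ∃ D, HasDerivAt (fun t => p (c t)) D s ∧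
    HasDerivAt (fun t => p (c' t)) D s) ?_ ?_ ?_ ?_ hp
  · rintro _ ⟨l, rfl⟩
    exact h l
  · exact fun r => ⟨0, hasDerivAt_const _ _, hasDerivAt_const _ _⟩
  · rintro p q - - ⟨D, h1, h2⟩ ⟨D', h1', h2'⟩
    exact ⟨D + D', h1.add h1', h2.add h2'⟩
  · rintro p q - - ⟨D, h1, h2⟩ ⟨D', h1', h2'⟩
    refine ⟨D * q (c s) + p (c s) * D', h1.mul h1', ?_⟩
    rw [h0]
    exact h2.mul h2'

omit [Module ℚ (Module.End ℂ V)] [FiniteDimensional ℂ V] in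
lemma hasDerivAt_aeval_smul (a : Module.End ℂ V) (r : ℂ[X])
    (l : Module.Dual ℂ (Module.End ℂ V)) :
    HasDerivAt (fun t : ℂ => l (aeval (t • a) r)) (r.coeff 1 * l a) 0 := by
  induction r using Polynomial.induction_on' with
  | add p q hp hq =>
    simp only [map_add, coeff_add, add_mul]
    exact hp.add hq
  | monomial m c =>
    simp only [aeval_monomial, _root_.smul_pow, mul_smul_comm, map_smul, smul_eq_mul]
    rcases m with _ | _ | m
    · simpa [coeff_monomial] using hasDerivAt_const (0 : ℂ) (l (algebraMap ℂ _ c))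
    · have := (hasDerivAt_id' (0 : ℂ)).mul_const (l (algebraMap ℂ _ c * a))
      simpa [← Algebra.smul_def] using this
    · have := (hasDerivAt_pow (m + 2) (0 : ℂ)).mul_const (l (algebraMap ℂ _ c * a ^ (m + 2)))
      simpa [coeff_monomial] using this

/-- If `l` vanishes on `g`, then `l ∘ log` vanishes on the group, and its derivative at `1` along
`a` is `l a`; so a tangent vector lies in `g`. Conversely, for `a ∈ g` the curve `exp (t a)` stays
in the group and is tangent to `1 + t a`. -/
lemma lieAlgebraOf_expGroup (hg : IsNilpotentLie g) :
    lieAlgebraOf (expGroup hg) = (g : Set (Module.End ℂ V)) := by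
  have hcoeff : ∀ d, (logPoly d).coeff 1 = 1 := by
    intro d
    rw [logPoly, coeff_add, coeff_X_one, coeff_X_pow_mul']
    simp
  ext a
  constructor
  · intro h
    rw [SetLike.mem_coe, mem_iff_forall_dual]
    intro l hl
    have h1 := h (fun b => l (logEnd b)) (isRegular_logEnd isRegular_id l)
      fun B hB => hl _ ((mem_expGroup_iff_logEnd hg).mp hB).2
    have h2 := hasDerivAt_aeval_smul a (logPoly (Module.finrank ℂ V)) l
    rw [hcoeff, one_mul] at h2
    simp only [logEnd, add_sub_cancel_left] at h1
    exact h2.unique h1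
  · intro ha p hp hpg
    have hn := hg.isNilpotent a ha
    have hd := pow_finrank_eq_zero hn
    obtain ⟨D, h1, h2⟩ := exists_hasDerivAt_polyFun (c := fun t : ℂ => 1 + t • a)
      (c' := fun t => IsNilpotent.exp (t • a)) (s := 0) (by simp) (by
        intro l
        refine ⟨l a, ?_, ?_⟩
        · have := ((hasDerivAt_id' (0 : ℂ)).mul_const (l a)).const_add (l 1)
          simpa using this
        · have h3 : ∀ t : ℂ, IsNilpotent.exp (t • a) =
              -- The shift by `2` guarantees a linear term in the truncated series, whatever the
              -- dimension of `V`.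
              aeval (t • a) (expPoly (Module.finrank ℂ V + 2)) := fun t =>
            exp_eq_aeval (pow_eq_zero_of_le (Nat.le_add_right _ 2)
              (pow_finrank_eq_zero (hn.smul t)))
          have h4 := hasDerivAt_aeval_smul a (expPoly (Module.finrank ℂ V + 2)) l
          have h5 : (expPoly (Module.finrank ℂ V + 2)).coeff 1 = 1 := by
            rw [expPoly, Polynomial.finsetSum_coeff]
            simp only [coeff_C_mul_X_pow]
            rw [Finset.sum_ite_eq, if_pos (Finset.mem_range.mpr (by omega))]
            simp
          rw [h5, one_mul] at h4
          simpa only [h3] using h4) hp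
    have h3 : ∀ t : ℂ, p (IsNilpotent.exp (t • a)) = 0 := by
      intro t
      obtain ⟨A, hA, hAe⟩ := (mem_endSet_expGroup hg).mpr ⟨t • a, g.smul_mem t ha, rfl⟩
      rw [← hAe]
      exact hpg A hA
    simp only [h3] at h2
    rwa [h2.unique (hasDerivAt_const _ _)] at h1

end ExpGroup

/-! ### Generation by one-parameter groups -/

section Generation

variable {V : Type*} [AddCommGroup V] [Module ℂ V] [Module ℚ (Module.End ℂ V)]
  [FiniteDimensional ℂ V] {g : Submodule ℂ (Module.End ℂ V)}

/-- A group of exponentials that contains the exponentials of the multiples of the elements of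
a spanning set of the Lie algebra is the full group of exponentials. -/
lemma expGroup_le_of_le_span (hg : IsNilpotentLie g)
    {C : Subgroup (LinearMap.GeneralLinearGroup ℂ V)} (hC : C ≤ expGroup hg)
    {T : Set (Module.End ℂ V)} (hT : g ≤ Submodule.span ℂ T) (hTg : T ⊆ g)
    (h : ∀ b ∈ T, ∀ t : ℂ, IsNilpotent.exp (t • b) ∈ endSet C) : expGroup hg ≤ C := by
  obtain ⟨b, hbT, hbs, hbi⟩ := exists_linearIndependent ℂ T
  have hbfin : b.Finite := hbi.setFinite
  have : Fintype b := hbfin.fintype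
  let B := Module.Basis.span hbi
  have hspan : Submodule.span ℂ (Set.range ((↑) : b → Module.End ℂ V)) = Submodule.span ℂ T := by
    rw [Subtype.range_coe, hbs]
  -- The coordinates on the span, extended to linear forms on the whole of `End V`.
  choose l hl using fun i => LinearMap.exists_extend (B.coord i)
  have hlB : ∀ i (w : Submodule.span ℂ (Set.range ((↑) : b → Module.End ℂ V))),
      l i w = B.repr w i := fun i w => LinearMap.congr_fun (hl i) w
  have hnil : ∀ i : b, IsNilpotent (i : Module.End ℂ V) :=
    fun i => hg.isNilpotent _ (hTg (hbT i.2))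
  -- The coordinates of `log (∏ exp (t_i b_i))`. The differential at `0` is the identity, so by the
  -- inverse function theorem the image is a neighbourhood of `0`.
  let F : (b → ℂ) → (b → ℂ) := fun t i => l i (logEnd (prodExp ((↑) : b → Module.End ℂ V) t))
  have hF : HasStrictFDerivAt F
      ((ContinuousLinearEquiv.refl ℂ (b → ℂ) : (b → ℂ) ≃L[ℂ] (b → ℂ)) : (b → ℂ) →L[ℂ] (b → ℂ)) 0 := by
    rw [hasStrictFDerivAt_pi']
    intro i
    refine (hasStrictFDerivAt_logEnd_prodExp hnil (l i)).congr_fderiv ?_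
    classical
    ext t
    have : ∀ j : b, l i j = if j = i then 1 else 0 := by
      intro j
      have h1 := hlB i (B j)
      rw [Module.Basis.repr_self, Finsupp.single_apply] at h1
      rw [← h1]
      congr 1
      exact (congrArg Subtype.val (Module.Basis.span_apply hbi j)).symm
    simp only [sum_apply, smul_apply, this]
    simp
  have hF0 : F 0 = 0 := by
    have : prodExp ((↑) : b → Module.End ℂ V) 0 = IsNilpotent.exp (0 : Module.End ℂ V) := by
      rw [prodExp, List.prod_eq_one]
      · simp
      · intro x hx
        obtain ⟨i, _, rfl⟩ := List.mem_map.mp hx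
        simp
    ext i
    change l i (logEnd (prodExp _ 0)) = 0
    rw [this, logEnd_exp IsNilpotent.zero, map_zero]
  have hnhds : Set.range F ∈ nhds (0 : b → ℂ) := by
    have h1 := hF.map_nhds_eq_of_equiv
    rw [hF0] at h1
    rw [← h1, Filter.mem_map]
    exact Filter.mem_of_superset Filter.univ_mem fun t _ => ⟨t, rfl⟩
  rintro A ⟨x, hx, hxA⟩
  -- For large `m` the coordinates of `x / (m + 1)` lie in that neighbourhood, so `exp (x / (m +
  -- 1))` belongs to `C`; its power `m + 1` is `exp x`.
  have hlim : Filter.Tendsto (fun m : ℕ => ((m : ℂ) + 1)⁻¹ • fun i : b => l i x) Filter.atTop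
      (nhds 0) := by
    have h1 : Filter.Tendsto (fun m : ℕ => ((m : ℂ) + 1)⁻¹) Filter.atTop (nhds 0) := by
      simpa using tendsto_one_div_add_atTop_nhds_zero_nat (𝕜 := ℂ)
    simpa using h1.smul_const (fun i : b => l i x)
  obtain ⟨m, t, ht⟩ := (hlim.eventually hnhds).exists
  have hP : prodExp ((↑) : b → Module.End ℂ V) t ∈ endSet C :=
    prodExp_mem_endSet fun i => h i (hbT i.2) (t i)
  have hPg : prodExp ((↑) : b → Module.End ℂ V) t ∈ endSet (expGroup hg) := by
    obtain ⟨Q, hQ, hQe⟩ := hP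
    exact ⟨Q, hC hQ, hQe⟩
  have hlog := logEnd_mem_of_mem_endSet_expGroup hg hPg
  have heq : logEnd (prodExp ((↑) : b → Module.End ℂ V) t) = ((m : ℂ) + 1)⁻¹ • x := by
    have h1 := hspan ▸ hT hlog
    have h2 := hspan ▸ hT (g.smul_mem ((m : ℂ) + 1)⁻¹ hx)
    refine congrArg Subtype.val (B.ext_elem (x := ⟨_, h1⟩) (y := ⟨_, h2⟩) fun i => ?_)
    rw [← hlB, ← hlB]
    have := congrFun ht i
    simp only [Pi.smul_apply] at this
    rw [map_smul]
    exact this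
  have h3 : IsNilpotent.exp (((m : ℂ) + 1)⁻¹ • x) ∈ endSet C := by
    rw [← heq, exp_logEnd]
    · exact hP
    · obtain ⟨Q, hQ, hQe⟩ := hPg
      rw [← hQe]
      exact isNilpotent_sub_one_of_mem_expGroup hg hQ
  have h4 := pow_mem_endSet h3 (m + 1)
  rw [← exp_natCast_smul ((hg.isNilpotent x hx).smul _), smul_smul, Nat.cast_succ,
    mul_inv_cancel₀ (Nat.cast_add_one_ne_zero m), one_smul, hxA] at h4
  exact coe_mem_endSet.mp h4

/-- If `g` is generated by `S` as a Lie algebra, then the group `exp g` is generated by the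
one-parameter groups of the elements of `S`. -/
lemma expGroup_le_of_generates (hg : IsNilpotentLie g)
    {C : Subgroup (LinearMap.GeneralLinearGroup ℂ V)} (hC : C ≤ expGroup hg)
    {S : Set (Module.End ℂ V)} (hSg : S ⊆ g)
    (hS : ∀ W : Submodule ℂ (Module.End ℂ V), S ⊆ W → (∀ a ∈ W, ∀ b ∈ W, a * b - b * a ∈ W) →
      g ≤ W)
    (h : ∀ b ∈ S, ∀ t : ℂ, IsNilpotent.exp (t • b) ∈ endSet C) : expGroup hg ≤ C := by
  let T : Set (Module.End ℂ V) := {b | IsNilpotent b ∧ ∀ t : ℂ, IsNilpotent.exp (t • b) ∈ endSet C}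
  have hST : S ⊆ T := fun b hb => ⟨hg.isNilpotent b (hSg hb), h b hb⟩
  have hTg : T ⊆ g := by
    intro b hb
    have h1 := hb.2 1
    rw [one_smul] at h1
    obtain ⟨Q, hQ, hQe⟩ := h1
    exact (exp_mem_endSet_expGroup hg hb.1).mp ⟨Q, hC hQ, hQe⟩
  have hTW : Submodule.span ℂ T ≤ g := Submodule.span_le.mpr hTg
  -- Conjugation by `exp (s a)`, `a ∈ S`, stays inside `C`, hence preserves `T` and its span; the
  -- bracket is the linear term in `s`.
  have hconj : ∀ a ∈ S, ∀ b ∈ Submodule.span ℂ T, a * b - b * a ∈ Submodule.span ℂ T := by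
    intro a ha b hb
    have han := hg.isNilpotent a (hSg ha)
    refine lie_mem_of_conj_mem han fun s => ?_
    induction hb using Submodule.span_induction with
    | mem b hb =>
      refine Submodule.subset_span ⟨(isNilpotent_conj (han.smul s) hb.1).1, fun t => ?_⟩
      have h1 := (isNilpotent_conj (han.smul s) (hb.1.smul t)).2
      rw [mul_smul_comm, smul_mul_assoc] at h1
      rw [h1]
      refine mul_mem_endSet (mul_mem_endSet (h a ha s) (hb.2 t)) ?_
      rw [← neg_smul]
      exact h a ha (-s)
    | zero => simp
    | add x y _ _ hx hy => rw [mul_add, add_mul]; exact Submodule.add_mem _ hx hy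
    | smul c x _ hx => rw [mul_smul_comm, smul_mul_assoc]; exact Submodule.smul_mem _ c hx
  -- The operators whose bracket preserves the span of `T`. By the Jacobi identity they form a Lie
  -- algebra; it contains `S`, hence `g`. Thus the span of `T` is itself a Lie algebra containing
  -- `S`, and so contains `g`.
  let K : Submodule ℂ (Module.End ℂ V) :=
    { carrier := {a | ∀ b ∈ Submodule.span ℂ T, a * b - b * a ∈ Submodule.span ℂ T}
      add_mem' := fun {x y} hx hy b hb => by
        have := Submodule.add_mem _ (hx b hb) (hy b hb)
        convert this using 1
        noncomm_ring
      zero_mem' := fun b _ => by simp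
      smul_mem' := fun c x hx b hb => by
        have := Submodule.smul_mem _ c (hx b hb)
        convert this using 1
        rw [smul_sub, smul_mul_assoc, mul_smul_comm] }
  have hgK : g ≤ K := by
    refine hS K hconj fun a ha b hb w hw => ?_
    have h1 := ha _ (hb w hw)
    have h2 := hb _ (ha w hw)
    convert Submodule.sub_mem _ h1 h2 using 1
    noncomm_ring
  refine expGroup_le_of_le_span hg hC ?_ hTg fun b hb => hb.2
  exact hS _ (hST.trans Submodule.subset_span) fun a ha b hb => hgK (hTW ha) b hb

end Generation

end FormalLie
noncomputable section

namespace FormalLie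

open Polynomial

/-! ### Logarithms of algebra endomorphisms -/

section Intertwining

variable {M N : Type*} [AddCommGroup M] [Module ℂ M] [AddCommGroup N] [Module ℂ N]

lemma aeval_comp_of_comp_eq {fM : Module.End ℂ M} {fN : Module.End ℂ N} {u : M →ₗ[ℂ] N}
    (h : fN ∘ₗ u = u ∘ₗ fM) (p : ℂ[X]) : (aeval fN p) ∘ₗ u = u ∘ₗ (aeval fM p) := by
  have hpow : ∀ i, (fN ^ i) ∘ₗ u = u ∘ₗ (fM ^ i) :=
    fun i => Module.End.commute_pow_left_of_commute h i
  ext v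
  rw [aeval_eq_sum_range, aeval_eq_sum_range]
  simp only [LinearMap.comp_apply, LinearMap.sum_apply, LinearMap.smul_apply, map_sum, map_smul]
  exact Finset.sum_congr rfl fun i _ => congrArg _ (LinearMap.congr_fun (hpow i) v)

open TensorProduct in
/-- The logarithm of a unipotent endomorphism of an algebra is a derivation. -/
lemma log_mul {B : Type*} [CommRing B] [Algebra ℂ B] [Module ℚ B] {F : Module.End ℂ B}
    (hF : ∀ x y, F (x * y) = F x * F y) {d : ℕ} (hd : (F - 1) ^ d = 0) (x y : B) :
    aeval (F - 1) (logPoly d) (x * y) =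
      x * aeval (F - 1) (logPoly d) y + aeval (F - 1) (logPoly d) x * y := by
  set Z : Module.End ℂ B := aeval (F - 1) (logPoly d) with hZ
  have hZd : Z ^ d = 0 := pow_aeval_logPoly hd
  have hZn : IsNilpotent Z := ⟨d, hZd⟩
  have hexp : IsNilpotent.exp Z = F := by rw [hZ, exp_aeval_logPoly hd, add_sub_cancel]
  -- Multiplicativity of `F` says that the product map `B ⊗ B → B` intertwines `F ⊗ F` with `F`. It
  -- then intertwines their logarithms `1 ⊗ Z + Z ⊗ 1` and `Z`, which is the Leibniz rule.
  let DL : Module.End ℂ (B ⊗[ℂ] B) := Z.lTensor B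
  let DR : Module.End ℂ (B ⊗[ℂ] B) := Z.rTensor B
  have hL : IsNilpotent DL := hZn.map <| Module.End.lTensorAlgHom ℂ B B
  have hR : IsNilpotent DR := hZn.map <| Module.End.rTensorAlgHom ℂ B B
  have hc : Commute DL DR := by ext; simp [DL, DR]
  have h2 : IsNilpotent.exp DL = F.lTensor B :=
    (hZn.map_exp (Module.End.lTensorAlgHom ℂ B B)).symm.trans (by rw [hexp]; rfl)
  have h3 : IsNilpotent.exp DR = F.rTensor B :=
    (hZn.map_exp (Module.End.rTensorAlgHom ℂ B B)).symm.trans (by rw [hexp]; rfl)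
  obtain ⟨e, he⟩ := hc.isNilpotent_add hL hR
  -- A common exponent, so that the same logarithm polynomial serves on both sides.
  have he' := pow_eq_zero_of_le (le_max_right d e) he
  have hZe := pow_eq_zero_of_le (le_max_left d e) hZd
  have hint : (IsNilpotent.exp Z - 1) ∘ₗ LinearMap.mul' ℂ B =
      LinearMap.mul' ℂ B ∘ₗ (IsNilpotent.exp (DL + DR) - 1) := by
    rw [IsNilpotent.exp_add_of_commute hc hL hR, h2, h3, hexp]
    ext a b
    simp [hF]
  have h4 := aeval_comp_of_comp_eq hint (logPoly (max d e))
  rw [aeval_logPoly_exp he', aeval_logPoly_exp hZe] at h4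
  have h5 := LinearMap.congr_fun h4 (x ⊗ₜ[ℂ] y)
  simpa [DL, DR] using h5

end Intertwining

/-! ### Closure in the Krull topology -/

section Krull

/-- In the topology generated by the classes of a decreasing sequence of equivalence relations, a
point is in the closure of a set if and only if each of its classes meets the set. -/
lemma mem_closure_generateFrom_iff {Z : Type*} (E : ℕ → Z → Z → Prop)
    (hE : ∀ k, Equivalence (E k)) (hmono : ∀ k l, k ≤ l → ∀ a b, E l a b → E k a b) (S : Set Z)
    (a : Z) : a ∈ @closure Z (TopologicalSpace.generateFrom {U | ∃ k b, U = {c | E k c b}}) S ↔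
      ∀ k, ∃ b ∈ S, E k b a := by
  let _ := TopologicalSpace.generateFrom {U | ∃ k b, U = {c | E k c b}}
  have hB : TopologicalSpace.IsTopologicalBasis {U | ∃ k b, U = {c | E k c b}} := by
    refine ⟨?_, ?_, rfl⟩
    · rintro _ ⟨k, b, rfl⟩ _ ⟨l, c, rfl⟩ x ⟨hx, hx'⟩
      refine ⟨_, ⟨max k l, x, rfl⟩, (hE _).refl x, fun y hy => ⟨?_, ?_⟩⟩
      · exact (hE k).trans (hmono _ _ (le_max_left k l) _ _ hy) hx
      · exact (hE l).trans (hmono _ _ (le_max_right k l) _ _ hy) hx'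
    · rw [Set.eq_univ_iff_forall]
      exact fun x => ⟨_, ⟨0, x, rfl⟩, (hE 0).refl x⟩
  rw [hB.mem_closure_iff]
  constructor
  · intro h k
    obtain ⟨b, hb, hbS⟩ := h _ ⟨k, a, rfl⟩ ((hE k).refl a)
    exact ⟨b, hbS, hb⟩
  · rintro h _ ⟨k, b, rfl⟩ ha
    obtain ⟨c, hc, hca⟩ := h k
    exact ⟨c, (hE k).trans hca ha, hc⟩

end Krull

/-! ### Jet spaces, jets of vector fields and of diffeomorphisms -/

section Jets

variable {n : ℕ}

/-- Inductively, constants and the products of the previous space with the variables suffice. This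
gives finite dimensionality of the jet spaces and reduces statements modulo `𝔪 ^ k` to polynomials.
-/
lemma exists_fg_approx (n k : ℕ) : ∃ W : Submodule ℂ (Series n), W.FG ∧
    W ≤ Subalgebra.toSubmodule (Algebra.adjoin ℂ (Set.range (MvPowerSeries.X : Fin n → Series n))) ∧
    ∀ f, ∃ w ∈ W, f - w ∈ maxIdeal n ^ k := by
  induction k with
  | zero => exact ⟨⊥, Submodule.fg_bot, bot_le, fun f => ⟨0, Submodule.zero_mem _, by simp⟩⟩
  | succ k ih =>
    obtain ⟨W, hW, hWA, h⟩ := ih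
    refine ⟨Submodule.span ℂ {1} ⊔ ⨆ i : Fin n,
      W.map (LinearMap.mulRight ℂ (MvPowerSeries.X i : Series n)), ?_, ?_, ?_⟩
    · exact (Submodule.fg_span_singleton _).sup (Submodule.fg_iSup _ fun i => hW.map _)
    · refine sup_le ?_ (iSup_le fun i => ?_)
      · rw [Submodule.span_singleton_le_iff_mem]
        exact Subalgebra.one_mem _
      · rw [Submodule.map_le_iff_le_comap]
        intro w hw
        exact Subalgebra.mul_mem _ (hWA hw) (Algebra.subset_adjoin ⟨i, rfl⟩)
    · intro f
      have hf : f - algebraMap ℂ (Series n) (MvPowerSeries.constantCoeff f) ∈ maxIdeal n := by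
        rw [mem_maxIdeal_iff, map_sub, ← MvPowerSeries.c_eq_algebraMap,
          MvPowerSeries.constantCoeff_C, sub_self]
      rw [maxIdeal_eq_span, Ideal.mem_span_range_iff_exists_fun] at hf
      obtain ⟨c, hc⟩ := hf
      choose w hw hw' using fun i => h (c i)
      refine ⟨algebraMap ℂ (Series n) (MvPowerSeries.constantCoeff f) +
        ∑ i, w i * MvPowerSeries.X i, Submodule.add_mem_sup ?_ ?_, ?_⟩
      · rw [Submodule.mem_span_singleton]
        exact ⟨_, (Algebra.algebraMap_eq_smul_one _).symm⟩
      · exact Submodule.sum_mem _ fun i _ =>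
          Submodule.mem_iSup_of_mem i (Submodule.mem_map_of_mem (hw i))
      · rw [← sub_sub, ← hc, ← Finset.sum_sub_distrib]
        refine Ideal.sum_mem _ fun i _ => ?_
        rw [← sub_mul, pow_succ]
        refine Ideal.mul_mem_mul (hw' i) ?_
        rw [mem_maxIdeal_iff]
        simp

/-- The `k`-jet of a power series that vanishes at the origin. -/
def jetMk (k : ℕ) (f : Series n) (hf : f ∈ maxIdeal n) : JetSpace n k :=
  Submodule.Quotient.mk ⟨f, hf⟩

lemma jetMk_surjective (k : ℕ) (v : JetSpace n k) : ∃ f hf, jetMk k f hf = v := by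
  obtain ⟨⟨f, hf⟩, rfl⟩ := Submodule.Quotient.mk_surjective _ v
  exact ⟨f, hf, rfl⟩

lemma jetMk_eq_jetMk {k : ℕ} {f g : Series n} {hf : f ∈ maxIdeal n} {hg : g ∈ maxIdeal n} :
    jetMk k f hf = jetMk k g hg ↔ f - g ∈ maxIdeal n ^ (k + 1) := by
  rw [jetMk, jetMk, Submodule.Quotient.eq]
  rfl

lemma jetMk_eq_zero {k : ℕ} {f : Series n} {hf : f ∈ maxIdeal n} :
    jetMk k f hf = 0 ↔ f ∈ maxIdeal n ^ (k + 1) := by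
  rw [jetMk, Submodule.Quotient.mk_eq_zero]
  rfl

/-- The inclusion of `𝔪 / 𝔪 ^ (k + 1)` into `ℂ[[x₁, …, xₙ]] / 𝔪 ^ (k + 1)`. -/
def jetIncl (n k : ℕ) : JetSpace n k →ₗ[ℂ] Series n ⧸ maxIdeal n ^ (k + 1) :=
  Submodule.mapQ _ ((maxIdeal n ^ (k + 1)).restrictScalars ℂ)
    ((maxIdeal n).restrictScalars ℂ).subtype le_rfl

lemma jetIncl_jetMk {k : ℕ} {f : Series n} (hf : f ∈ maxIdeal n) :
    jetIncl n k (jetMk k f hf) = Ideal.Quotient.mk _ f := rfl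

lemma jetIncl_injective (n k : ℕ) : Function.Injective (jetIncl n k) := by
  rw [injective_iff_map_eq_zero]
  intro v hv
  obtain ⟨f, hf, rfl⟩ := jetMk_surjective k v
  rw [jetIncl_jetMk, Ideal.Quotient.eq_zero_iff_mem] at hv
  exact jetMk_eq_zero.mpr hv

instance (n k : ℕ) : FiniteDimensional ℂ (JetSpace n k) := by
  obtain ⟨W, hW, -, h⟩ := exists_fg_approx n (k + 1)
  have h1 : Module.Finite ℂ (Series n ⧸ maxIdeal n ^ (k + 1)) := by
    have h2 := hW.map (Ideal.Quotient.mkₐ ℂ (maxIdeal n ^ (k + 1))).toLinearMap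
    have h3 : W.map (Ideal.Quotient.mkₐ ℂ (maxIdeal n ^ (k + 1))).toLinearMap = ⊤ := by
      rw [eq_top_iff]
      rintro v -
      obtain ⟨f, rfl⟩ := Ideal.Quotient.mk_surjective v
      obtain ⟨w, hw, hfw⟩ := h f
      exact ⟨w, hw, (Ideal.Quotient.eq.mpr hfw).symm⟩
    exact Module.finite_def.mpr (h3 ▸ h2)
  exact Module.Finite.of_injective (jetIncl n k) (jetIncl_injective n k)

/-- The operators that preserve the powers of the maximal ideal. -/
def PreservesPowers (T : Module.End ℂ (Series n)) : Prop :=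
  ∀ j, ∀ f ∈ maxIdeal n ^ j, T f ∈ maxIdeal n ^ j

lemma PreservesPowers.pow {T : Module.End ℂ (Series n)} (hT : PreservesPowers T) (i : ℕ) :
    PreservesPowers (T ^ i) := by
  intro j f hf
  induction i with
  | zero => simpa using hf
  | succ i ih => rw [pow_succ', Module.End.mul_apply]; exact hT j _ ih

lemma jetMap_jetMk {k : ℕ} {T : Module.End ℂ (Series n)} (hT : PreservesPowers T) {f : Series n}
    (hf : f ∈ maxIdeal n) : jetMap k T hT (jetMk k f hf) = jetMk k (T f) (maps_maxIdeal hT hf) :=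
  rfl

lemma jetMap_eq_iff {k : ℕ} {T U : Module.End ℂ (Series n)} (hT : PreservesPowers T)
    (hU : PreservesPowers U) :
    jetMap k T hT = jetMap k U hU ↔ ∀ f ∈ maxIdeal n, T f - U f ∈ maxIdeal n ^ (k + 1) := by
  constructor
  · intro h f hf
    have := LinearMap.congr_fun h (jetMk k f hf)
    rwa [jetMap_jetMk, jetMap_jetMk, jetMk_eq_jetMk] at this
  · intro h
    refine LinearMap.ext fun v => ?_
    obtain ⟨f, hf, rfl⟩ := jetMk_surjective k v
    rw [jetMap_jetMk, jetMap_jetMk, jetMk_eq_jetMk]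
    exact h f hf

lemma jetMap_pow {k : ℕ} {T : Module.End ℂ (Series n)} (hT : PreservesPowers T) (i : ℕ) :
    jetMap k T hT ^ i = jetMap k (T ^ i) (hT.pow i) := by
  induction i with
  | zero =>
    refine LinearMap.ext fun v => ?_
    obtain ⟨f, hf, rfl⟩ := jetMk_surjective k v
    rfl
  | succ i ih =>
    rw [pow_succ (jetMap k T hT) i, ih]
    refine LinearMap.ext fun v => ?_
    obtain ⟨f, hf, rfl⟩ := jetMk_surjective k v
    simp only [pow_succ T i]
    rfl

lemma jetMap_pow_eq_zero_iff {k i : ℕ} {T : Module.End ℂ (Series n)} (hT : PreservesPowers T) :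
    jetMap k T hT ^ i = 0 ↔ ∀ f ∈ maxIdeal n, (T ^ i) f ∈ maxIdeal n ^ (k + 1) := by
  have h0 : PreservesPowers (0 : Module.End ℂ (Series n)) := fun j f _ => Ideal.zero_mem _
  have : (0 : Module.End ℂ (JetSpace n k)) = jetMap k 0 h0 := by
    refine LinearMap.ext fun v => ?_
    obtain ⟨f, hf, rfl⟩ := jetMk_surjective k v
    rfl
  rw [jetMap_pow, this, jetMap_eq_iff]
  simp

lemma isNilpotent_jetMap_of_le {k l : ℕ} (hkl : k ≤ l) {T : Module.End ℂ (Series n)}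
    (hT : PreservesPowers T) (h : IsNilpotent (jetMap l T hT)) : IsNilpotent (jetMap k T hT) := by
  obtain ⟨i, hi⟩ := h
  refine ⟨i, ?_⟩
  rw [jetMap_pow_eq_zero_iff] at hi ⊢
  exact fun f hf => Ideal.pow_le_pow_right (by omega) (hi f hf)

/-- An induction principle modulo `𝔪 ^ k`, used to see that a `k`-jet is determined by the images of
the variables. -/
lemma mem_of_mem_adjoin_approx {k : ℕ} {p : Series n → Prop}
    (hX : ∀ i, p (MvPowerSeries.X i)) (hC : ∀ c, p (algebraMap ℂ _ c))
    (hadd : ∀ f g, p f → p g → p (f + g)) (hmul : ∀ f g, p f → p g → p (f * g))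
    (hm : ∀ f ∈ maxIdeal n ^ k, p f) (f : Series n) : p f := by
  obtain ⟨W, -, hWA, h⟩ := exists_fg_approx n k
  obtain ⟨w, hw, hfw⟩ := h f
  rw [← sub_add_cancel f w]
  refine hadd _ _ (hm _ hfw) ?_
  refine Algebra.adjoin_induction (p := fun f _ => p f) ?_ hC (fun f g _ _ => hadd f g)
    (fun f g _ _ => hmul f g) (hWA hw)
  rintro _ ⟨i, rfl⟩
  exact hX i

/-! ### Jets of vector fields -/

lemma jetVF_eq_iff {k : ℕ} {X Y : FormalVF n} : jetVF k X = jetVF k Y ↔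
    ∀ f, op X f - op Y f ∈ maxIdeal n ^ (k + 1) := by
  rw [jetVF, jetVF, jetMap_eq_iff X.map_mem Y.map_mem]
  refine ⟨fun h f => ?_, fun h f _ => h f⟩
  have hf : f - algebraMap ℂ (Series n) (MvPowerSeries.constantCoeff f) ∈ maxIdeal n := by
    rw [mem_maxIdeal_iff, map_sub, ← MvPowerSeries.c_eq_algebraMap,
      MvPowerSeries.constantCoeff_C, sub_self]
  have hX : op X (algebraMap ℂ (Series n) (MvPowerSeries.constantCoeff f)) = 0 :=
    X.1.map_algebraMap _
  have hY : op Y (algebraMap ℂ (Series n) (MvPowerSeries.constantCoeff f)) = 0 :=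
    Y.1.map_algebraMap _
  have := h _ hf
  rwa [map_sub, map_sub, hX, hY, sub_zero, sub_zero] at this

lemma jetVF_eq_iff_X {k : ℕ} {X Y : FormalVF n} : jetVF k X = jetVF k Y ↔
    ∀ i, X.1 (MvPowerSeries.X i) - Y.1 (MvPowerSeries.X i) ∈ maxIdeal n ^ (k + 1) := by
  rw [jetVF_eq_iff]
  refine ⟨fun h i => h _, fun h => mem_of_mem_adjoin_approx (k := k + 1) h ?_ ?_ ?_ ?_⟩
  · intro c
    have hX : op X (algebraMap ℂ (Series n) c) = 0 := X.1.map_algebraMap _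
    have hY : op Y (algebraMap ℂ (Series n) c) = 0 := Y.1.map_algebraMap _
    rw [hX, hY, sub_zero]
    exact Ideal.zero_mem _
  · intro f g hf hg
    have := Ideal.add_mem _ hf hg
    rwa [sub_add_sub_comm, ← map_add, ← map_add] at this
  · intro f g hf hg
    rw [op_mul, op_mul]
    convert Ideal.add_mem _ (Ideal.mul_mem_left _ f hg) (Ideal.mul_mem_left _ g hf) using 1
    ring
  · intro f hf
    exact Ideal.sub_mem _ (X.map_mem _ f hf) (Y.map_mem _ f hf)

lemma mem_closure_VF_iff {S : Set (FormalVF n)} {X : FormalVF n} :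
    X ∈ closure S ↔ ∀ k, ∃ Y ∈ S, jetVF k Y = jetVF k X := by
  simp_rw [jetVF_eq_iff_X]
  refine mem_closure_generateFrom_iff (Z := FormalVF n) (fun k X Y => ∀ i,
    X.1 (MvPowerSeries.X i) - Y.1 (MvPowerSeries.X i) ∈ maxIdeal n ^ (k + 1)) ?_ ?_ S X
  · intro k
    simp_rw [← jetVF_eq_iff_X]
    exact ⟨fun _ => rfl, fun h => h.symm, fun h h' => h.trans h'⟩
  · exact fun k l hkl X Y h i => Ideal.pow_le_pow_right (by omega) (h i)

lemma eq_of_jetVF_eq {X Y : FormalVF n} (h : ∀ k, jetVF k X = jetVF k Y) : X = Y := by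
  refine Subtype.ext (Derivation.ext fun f => eq_of_forall_sub_mem fun k => ?_)
  exact Ideal.pow_le_pow_right (Nat.le_succ k) (jetVF_eq_iff.mp (h k) f)

/-- The map `X ↦ Xₖ` as a linear map. -/
def jetVFLin (n k : ℕ) : FormalVF n →ₗ[ℂ] Module.End ℂ (JetSpace n k) where
  toFun := jetVF k
  map_add' X Y := by
    refine LinearMap.ext fun v => ?_
    obtain ⟨f, hf, rfl⟩ := jetMk_surjective k v
    rfl
  map_smul' := jetVF_smul k

lemma jetVFLin_apply (k : ℕ) (X : FormalVF n) : jetVFLin n k X = jetVF k X := rfl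

lemma jetVF_lie (k : ℕ) (X Y : FormalVF n) :
    jetVF k ⁅X, Y⁆ = jetVF k X * jetVF k Y - jetVF k Y * jetVF k X := by
  refine LinearMap.ext fun v => ?_
  obtain ⟨f, hf, rfl⟩ := jetMk_surjective k v
  refine congrArg Submodule.Quotient.mk (Subtype.ext ?_)
  change (⁅X.1, Y.1⁆ : Derivation ℂ (Series n) (Series n)) f = X.1 (Y.1 f) - Y.1 (X.1 f)
  rw [Derivation.commutator_apply]

lemma isNilpotent_jetVF (k : ℕ) {X : FormalVF n} (hX : IsNilpotentVF X) :
    IsNilpotent (jetVF k X) := by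
  obtain ⟨N, hN⟩ := exists_op_pow_mem ⟨X, hX⟩ (k + 1)
  exact ⟨N, (jetMap_pow_eq_zero_iff X.map_mem).mpr fun f _ => hN N le_rfl f⟩

lemma isNilpotentVF_of_jetVF {k : ℕ} (hk : 1 ≤ k) {X : FormalVF n}
    (h : IsNilpotent (jetVF k X)) : IsNilpotentVF X :=
  isNilpotent_jetMap_of_le hk X.map_mem h

/-! ### Jets of diffeomorphisms -/

lemma coe_jetHom (k : ℕ) (φ : FormalDiff n) :
    (jetHom n k φ : Module.End ℂ (JetSpace n k)) = jetMap k φ.toLinearMap φ.map_mem := rfl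

lemma sub_one_preservesPowers (φ : FormalDiff n) :
    PreservesPowers ((φ.toLinearMap : Module.End ℂ (Series n)) - 1) :=
  fun j f hf => Ideal.sub_mem _ (φ.map_mem j f hf) hf

lemma coe_jetHom_sub_one (k : ℕ) (φ : FormalDiff n) :
    (jetHom n k φ : Module.End ℂ (JetSpace n k)) - 1 =
      jetMap k ((φ.toLinearMap : Module.End ℂ (Series n)) - 1) (sub_one_preservesPowers φ) := by
  refine LinearMap.ext fun v => ?_
  obtain ⟨f, hf, rfl⟩ := jetMk_surjective k v
  rfl

lemma jetHom_eq_iff {k : ℕ} {φ ψ : FormalDiff n} : jetHom n k φ = jetHom n k ψ ↔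
    ∀ f, φ f - ψ f ∈ maxIdeal n ^ (k + 1) := by
  rw [← Units.val_inj, coe_jetHom, coe_jetHom, jetMap_eq_iff φ.map_mem ψ.map_mem]
  refine ⟨fun h f => ?_, fun h f _ => h f⟩
  have hf : f - algebraMap ℂ (Series n) (MvPowerSeries.constantCoeff f) ∈ maxIdeal n := by
    rw [mem_maxIdeal_iff, map_sub, ← MvPowerSeries.c_eq_algebraMap,
      MvPowerSeries.constantCoeff_C, sub_self]
  have := h _ hf
  simp only [AlgEquiv.toLinearMap_apply, map_sub, AlgEquiv.commutes] at this
  rwa [sub_sub_sub_cancel_right] at this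

lemma jetHom_eq_iff_X {k : ℕ} {φ ψ : FormalDiff n} : jetHom n k φ = jetHom n k ψ ↔
    ∀ i, φ (MvPowerSeries.X i) - ψ (MvPowerSeries.X i) ∈ maxIdeal n ^ (k + 1) := by
  rw [jetHom_eq_iff]
  refine ⟨fun h i => h _, fun h => mem_of_mem_adjoin_approx (k := k + 1) h ?_ ?_ ?_ ?_⟩
  · intro c
    rw [AlgEquiv.commutes, AlgEquiv.commutes, sub_self]
    exact Ideal.zero_mem _
  · intro f g hf hg
    have := Ideal.add_mem _ hf hg
    rwa [sub_add_sub_comm, ← map_add, ← map_add] at this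
  · intro f g hf hg
    rw [map_mul, map_mul]
    convert Ideal.add_mem _ (Ideal.mul_mem_left _ (φ f) hg) (Ideal.mul_mem_left _ (ψ g) hf) using 1
    ring
  · intro f hf
    exact Ideal.sub_mem _ (φ.map_mem _ f hf) (ψ.map_mem _ f hf)

lemma mem_closure_diff_iff {S : Set (FormalDiff n)} {φ : FormalDiff n} :
    φ ∈ closure S ↔ ∀ k, ∃ ψ ∈ S, jetHom n k ψ = jetHom n k φ := by
  simp_rw [jetHom_eq_iff_X]
  refine mem_closure_generateFrom_iff (Z := FormalDiff n) (fun k φ ψ => ∀ i,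
    φ (MvPowerSeries.X i) - ψ (MvPowerSeries.X i) ∈ maxIdeal n ^ (k + 1)) ?_ ?_ S φ
  · intro k
    simp_rw [← jetHom_eq_iff_X]
    exact ⟨fun _ => rfl, fun h => h.symm, fun h h' => h.trans h'⟩
  · exact fun k l hkl X Y h i => Ideal.pow_le_pow_right (by omega) (h i)

/-- Verified after the injection into the quotient of the full ring by `𝔪 ^ (k + 1)`, which
intertwines the two induced operators and hence their exponentials. -/
lemma coe_jetHom_exp (k : ℕ) (X : NilVF n) :
    (jetHom n k (exp X) : Module.End ℂ (JetSpace n k)) = IsNilpotent.exp (jetVF k X.1) := by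
  refine LinearMap.ext fun v => jetIncl_injective n k ?_
  have h : quotOp (k + 1) X.1 ∘ₗ jetIncl n k = jetIncl n k ∘ₗ jetVF k X.1 := by
    refine LinearMap.ext fun v => ?_
    obtain ⟨f, hf, rfl⟩ := jetMk_surjective k v
    rfl
  have h1 := Module.End.commute_exp_left_of_commute (isNilpotent_jetVF k X.2)
    (quotOp_nilpotent (k + 1) X) h
  refine Eq.trans ?_ (LinearMap.congr_fun h1 v)
  obtain ⟨f, hf, rfl⟩ := jetMk_surjective k v
  rw [LinearMap.comp_apply, jetIncl_jetMk, ← mk_expFun]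
  rfl

end Jets

end FormalLie

end
noncomputable section

namespace FormalLie

open Polynomial

/-! ### Logarithms of unipotent formal diffeomorphisms -/

section Logarithm

variable {n : ℕ}

lemma exp_injective : Function.Injective (exp : NilVF n → FormalDiff n) := by
  intro X Y h
  refine Subtype.ext (eq_of_jetVF_eq fun k => ?_)
  refine exp_injective_of_isNilpotent (isNilpotent_jetVF k X.2) (isNilpotent_jetVF k Y.2) ?_
  rw [← coe_jetHom_exp, ← coe_jetHom_exp, h]

lemma isUnipotentDiff_exp (X : NilVF n) : IsUnipotentDiff (exp X) := by
  rw [IsUnipotentDiff, coe_jetHom_exp]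
  exact IsNilpotent.isNilpotent_exp_sub_one (isNilpotent_jetVF 1 X.2)

/-- The operator `φ - 1` on formal power series. -/
def subOne (φ : FormalDiff n) : Module.End ℂ (Series n) := φ.toLinearMap - 1

lemma subOne_apply (φ : FormalDiff n) (f : Series n) : subOne φ f = φ f - f := rfl

lemma subOne_mul (φ : FormalDiff n) (f g : Series n) :
    subOne φ (f * g) = subOne φ f * g + f * subOne φ g + subOne φ f * subOne φ g := by
  simp only [subOne_apply, map_mul]
  ring

lemma subOne_preservesPowers (φ : FormalDiff n) : PreservesPowers (subOne φ) :=
  sub_one_preservesPowers φ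

lemma subOne_pow_mem (φ : FormalDiff n) {i j k : ℕ} (hij : i ≤ j) {f : Series n}
    (hf : (subOne φ ^ i) f ∈ maxIdeal n ^ k) : (subOne φ ^ j) f ∈ maxIdeal n ^ k := by
  obtain ⟨l, rfl⟩ := Nat.exists_eq_add_of_le' hij
  rw [pow_add, Module.End.mul_apply]
  exact (subOne_preservesPowers φ).pow l k _ hf

/-- The twisted Leibniz rule `subOne_mul` lowers `a`, or `b`, or both at once; the last case is the
reason for the inequality `a + b ≤ c`. -/
lemma subOne_pow_mul_mem (φ : FormalDiff n) (k c a b : ℕ) (hab : a + b ≤ c) {f g : Series n}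
    (hf : f ∈ maxIdeal n) (hg : g ∈ maxIdeal n ^ k) (hfa : (subOne φ ^ a) f ∈ maxIdeal n ^ 2)
    (hgb : (subOne φ ^ b) g ∈ maxIdeal n ^ (k + 1)) :
    (subOne φ ^ c) (f * g) ∈ maxIdeal n ^ (k + 2) := by
  induction c generalizing a b f g with
  | zero =>
    obtain ⟨rfl, rfl⟩ : a = 0 ∧ b = 0 := by omega
    rw [show k + 2 = 2 + k by omega, pow_add]
    exact Ideal.mul_mem_mul hfa hg
  | succ c ih =>
    rcases a with _ | a
    · refine subOne_pow_mem φ (Nat.zero_le _) ?_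
      rw [show k + 2 = 2 + k by omega, pow_add]
      exact Ideal.mul_mem_mul hfa hg
    rcases b with _ | b
    · refine subOne_pow_mem φ (Nat.zero_le _) ?_
      rw [show k + 2 = 1 + (k + 1) by omega, pow_add, pow_one]
      exact Ideal.mul_mem_mul hf hgb
    have hT : subOne φ f ∈ maxIdeal n := maps_maxIdeal (subOne_preservesPowers φ) hf
    have hT' : subOne φ g ∈ maxIdeal n ^ k := subOne_preservesPowers φ k g hg
    have hfa' : (subOne φ ^ a) (subOne φ f) ∈ maxIdeal n ^ 2 := by
      rwa [← Module.End.mul_apply, ← pow_succ]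
    have hgb' : (subOne φ ^ b) (subOne φ g) ∈ maxIdeal n ^ (k + 1) := by
      rwa [← Module.End.mul_apply, ← pow_succ]
    rw [pow_succ (subOne φ), Module.End.mul_apply, subOne_mul, map_add, map_add]
    refine Ideal.add_mem _ (Ideal.add_mem _ ?_ ?_) ?_
    · exact ih a (b + 1) (by omega) hT hg hfa' hgb
    · exact ih (a + 1) b (by omega) hf hT' hfa hgb'
    · exact ih a b (by omega) hT hT' hfa' hgb'

/-- Unipotence of the linear part spreads to each `𝔪 ^ (k + 1) / 𝔪 ^ (k + 2)` through products;
constants are killed by a single application. -/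
lemma exists_subOne_pow_mem {φ : FormalDiff n} (hφ : IsUnipotentDiff φ) (k : ℕ) :
    ∃ N, ∀ f, (subOne φ ^ N) f ∈ maxIdeal n ^ k := by
  obtain ⟨N, hN⟩ := hφ
  rw [coe_jetHom_sub_one, jetMap_pow_eq_zero_iff] at hN
  have h2 : ∀ k, ∃ M, ∀ f ∈ maxIdeal n ^ (k + 1), (subOne φ ^ M) f ∈ maxIdeal n ^ (k + 2) := by
    intro k
    induction k with
    | zero => exact ⟨N, fun f hf => hN f (by simpa using hf)⟩
    | succ k ih =>
      obtain ⟨M, hM⟩ := ih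
      refine ⟨N + M, fun f hf => ?_⟩
      rw [pow_succ' _ (k + 1)] at hf
      refine Submodule.mul_induction_on hf ?_ ?_
      · intro a ha b hb
        exact subOne_pow_mul_mem φ (k + 1) _ N M le_rfl ha hb (hN a ha) (hM b hb)
      · intro a b ha hb
        rw [map_add]
        exact Ideal.add_mem _ ha hb
  induction k with
  | zero => exact ⟨0, fun f => by simp⟩
  | succ k ih =>
    obtain ⟨M, hM⟩ := ih
    rcases k with _ | k
    · refine ⟨1, fun f => ?_⟩
      have hf : f - algebraMap ℂ (Series n) (MvPowerSeries.constantCoeff f) ∈ maxIdeal n := by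
        rw [mem_maxIdeal_iff, map_sub, ← MvPowerSeries.c_eq_algebraMap,
          MvPowerSeries.constantCoeff_C, sub_self]
      have h := maps_maxIdeal (subOne_preservesPowers φ) hf
      rw [map_sub, subOne_apply φ (algebraMap _ _ _), AlgEquiv.commutes, sub_self, sub_zero] at h
      simpa using h
    · obtain ⟨M', hM'⟩ := h2 k
      refine ⟨M' + M, fun f => ?_⟩
      rw [pow_add (subOne φ), Module.End.mul_apply]
      exact hM' _ (hM f)

/-- The operator induced on `ℂ[[x₁, …, xₙ]] / 𝔪 ^ k`. -/
def quotMap (k : ℕ) (T : Module.End ℂ (Series n)) (hT : PreservesPowers T) :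
    Module.End ℂ (Series n ⧸ maxIdeal n ^ k) :=
  Submodule.mapQ ((maxIdeal n ^ k).restrictScalars ℂ) ((maxIdeal n ^ k).restrictScalars ℂ) T (hT k)

lemma quotMap_mk {k : ℕ} {T : Module.End ℂ (Series n)} (hT : PreservesPowers T) (f : Series n) :
    quotMap k T hT (Ideal.Quotient.mk _ f) = Ideal.Quotient.mk _ (T f) := rfl

lemma aeval_quotMap_mk {k : ℕ} {T : Module.End ℂ (Series n)} (hT : PreservesPowers T) (p : ℂ[X])
    (f : Series n) : aeval (quotMap k T hT) p (Ideal.Quotient.mk _ f) =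
      Ideal.Quotient.mk _ (aeval T p f) :=
  LinearMap.congr_fun (aeval_comp_of_comp_eq (fM := T) (fN := quotMap k T hT)
    (u := (Ideal.Quotient.mkₐ ℂ (maxIdeal n ^ k)).toLinearMap) rfl p) f

lemma quotMap_pow_eq_zero {k N : ℕ} {T : Module.End ℂ (Series n)} (hT : PreservesPowers T)
    (h : ∀ f, (T ^ N) f ∈ maxIdeal n ^ k) : quotMap k T hT ^ N = 0 := by
  refine LinearMap.ext fun v => ?_
  obtain ⟨f, rfl⟩ := Ideal.Quotient.mk_surjective v
  have := aeval_quotMap_mk (k := k) hT (X ^ N) f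
  rw [map_pow, map_pow, aeval_X, aeval_X] at this
  rw [this, LinearMap.zero_apply, Ideal.Quotient.eq_zero_iff_mem]
  exact h f

lemma PreservesPowers.aeval {T : Module.End ℂ (Series n)} (hT : PreservesPowers T) (p : ℂ[X]) :
    PreservesPowers (aeval T p) := by
  intro j f hf
  rw [aeval_eq_sum_range, LinearMap.sum_apply]
  refine Ideal.sum_mem _ fun i _ => ?_
  rw [LinearMap.smul_apply]
  exact Submodule.smul_of_tower_mem _ _ (hT.pow i j f hf)

/-- Every unipotent formal diffeomorphism is the exponential of a nilpotent formal vector field. -/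
theorem exists_exp_eq_of_isUnipotentDiff {φ : FormalDiff n} (hφ : IsUnipotentDiff φ) :
    ∃ X : NilVF n, exp X = φ := by
  have hcomp := complete n
  have hT := subOne_preservesPowers φ
  choose N hN using exists_subOne_pow_mem hφ
  have hQ : ∀ k, quotMap k (subOne φ) hT ^ N k = 0 := fun k => quotMap_pow_eq_zero hT (hN k)
  -- Truncated logarithms of `φ`. Their limit in the complete ring is the required derivation.
  let L : ℕ → Module.End ℂ (Series n) := fun k => aeval (subOne φ) (logPoly (N k))
  have hL : ∀ k, PreservesPowers (L k) := fun k => hT.aeval _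
  have hcompat : ∀ a b, a ≤ b → ∀ f, L a f - L b f ∈ maxIdeal n ^ a := by
    intro a b hab f
    have hb : quotMap a (subOne φ) hT ^ N b = 0 :=
      quotMap_pow_eq_zero hT fun f => Ideal.pow_le_pow_right hab (hN b f)
    -- The two polynomials may differ, but both compute the unique nilpotent logarithm of the same
    -- operator modulo `𝔪 ^ a`.
    have h1 : aeval (quotMap a (subOne φ) hT) (logPoly (N a)) =
        aeval (quotMap a (subOne φ) hT) (logPoly (N b)) := by
      refine exp_injective_of_isNilpotent ⟨_, pow_aeval_logPoly (hQ a)⟩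
        ⟨_, pow_aeval_logPoly hb⟩ ?_
      rw [exp_aeval_logPoly (hQ a), exp_aeval_logPoly hb]
    have h2 := LinearMap.congr_fun h1 (Ideal.Quotient.mk _ f)
    rwa [aeval_quotMap_mk, aeval_quotMap_mk, Ideal.Quotient.eq] at h2
  have hlim : ∀ f, ∃ g, ∀ k, L k f - g ∈ maxIdeal n ^ k := by
    intro f
    obtain ⟨g, hg⟩ := IsPrecomplete.prec' (I := maxIdeal n) (fun k => L k f) fun {a b} hab => by
      rw [SModEq.sub_mem]
      simpa using hcompat a b hab f
    refine ⟨g, fun k => ?_⟩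
    have := hg k
    rw [SModEq.sub_mem] at this
    simpa using this
  choose D hD using hlim
  have hLmul : ∀ k f g, L k (f * g) - (f * L k g + L k f * g) ∈ maxIdeal n ^ k := by
    intro k f g
    rw [← Ideal.Quotient.eq, map_add (Ideal.Quotient.mk _), map_mul (Ideal.Quotient.mk _),
      map_mul (Ideal.Quotient.mk _)]
    simp only [L]
    have h0 : quotMap k (subOne φ) hT =
        quotMap k φ.toLinearMap φ.map_mem - 1 := by
      refine LinearMap.ext fun v => ?_
      obtain ⟨f, rfl⟩ := Ideal.Quotient.mk_surjective v
      rfl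
    have h1 := hQ k
    rw [← aeval_quotMap_mk hT, ← aeval_quotMap_mk hT, ← aeval_quotMap_mk hT,
      map_mul (Ideal.Quotient.mk _)]
    rw [h0] at h1 ⊢
    refine log_mul ?_ h1 _ _
    intro x y
    obtain ⟨a, rfl⟩ := Ideal.Quotient.mk_surjective x
    obtain ⟨b, rfl⟩ := Ideal.Quotient.mk_surjective y
    exact congrArg (Ideal.Quotient.mk _) (map_mul φ a b)
  have key : ∀ {f g : Series n}, (∀ k, ∃ h, f - h ∈ maxIdeal n ^ k ∧ g - h ∈ maxIdeal n ^ k) →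
      f = g := by
    intro f g h
    refine eq_of_forall_sub_mem fun k => ?_
    obtain ⟨c, hf, hg⟩ := h k
    have := Ideal.sub_mem _ hf hg
    rwa [sub_sub_sub_cancel_right] at this
  have hD' : ∀ f k, D f - L k f ∈ maxIdeal n ^ k := by
    intro f k
    rw [← neg_sub]
    exact Ideal.neg_mem_iff _ |>.mpr (hD f k)
  let Dl : Series n →ₗ[ℂ] Series n :=
    { toFun := D
      map_add' := fun f g => key fun k => ⟨L k (f + g), hD' _ k, by
        have := Ideal.add_mem _ (hD' f k) (hD' g k)
        rwa [sub_add_sub_comm, ← map_add] at this⟩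
      map_smul' := fun c f => key fun k => ⟨L k (c • f), hD' _ k, by
        have := Submodule.smul_of_tower_mem (maxIdeal n ^ k) c (hD' f k)
        rwa [smul_sub, ← map_smul] at this⟩ }
  let Y : Derivation ℂ (Series n) (Series n) := Derivation.mk' Dl fun f g =>
    key fun k => ⟨L k (f * g), hD' _ k, by
      have h1 := Ideal.neg_mem_iff _ |>.mpr (hLmul k f g)
      have h2 := Ideal.mul_mem_left _ f (hD' g k)
      have h3 := Ideal.mul_mem_left _ g (hD' f k)
      convert Ideal.add_mem _ h1 (Ideal.add_mem _ h2 h3) using 1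
      change f * D g + g * D f - _ = _
      ring⟩
  have hY : ∀ f, Y f = D f := fun _ => rfl
  let X : FormalVF n := ⟨Y, fun f hf => by
    have h1 := hD' f 1
    rw [pow_one] at h1
    have h2 := Ideal.add_mem _ h1 (maps_maxIdeal (hL 1) hf)
    rwa [sub_add_cancel] at h2⟩
  have hXq : ∀ k, quotOp k X = aeval (quotMap k (subOne φ) hT) (logPoly (N k)) := by
    intro k
    refine LinearMap.ext fun v => ?_
    obtain ⟨f, rfl⟩ := Ideal.Quotient.mk_surjective v
    rw [aeval_quotMap_mk]
    exact Ideal.Quotient.eq.mpr (hD' f k)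
  have hXn : IsNilpotentVF X := by
    refine ⟨N 2, (jetMap_pow_eq_zero_iff X.map_mem).mpr fun f hf => ?_⟩
    rw [← Ideal.Quotient.eq_zero_iff_mem, ← quotOp_pow_mk, hXq, pow_aeval_logPoly (hQ 2),
      LinearMap.zero_apply]
  refine ⟨⟨X, hXn⟩, AlgEquiv.ext fun f => eq_of_mk_eq fun k => ?_⟩
  refine (mk_expFun k ⟨X, hXn⟩ f).trans ?_
  rw [hXq, exp_aeval_logPoly (hQ k), LinearMap.add_apply, Module.End.one_apply, quotMap_mk,
    ← map_add, subOne_apply, add_sub_cancel]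

lemma exp_log {φ : FormalDiff n} (hφ : IsUnipotentDiff φ) : exp (log φ) = φ := by
  have h := exists_exp_eq_of_isUnipotentDiff hφ
  rw [log, dif_pos h]
  exact h.choose_spec

lemma coe_jetHom_of_isUnipotentDiff (k : ℕ) {φ : FormalDiff n} (hφ : IsUnipotentDiff φ) :
    (jetHom n k φ : Module.End ℂ (JetSpace n k)) = IsNilpotent.exp (jetVF k (log φ).1) := by
  rw [← coe_jetHom_exp, exp_log hφ]

lemma isNilpotent_jetHom_sub_one (k : ℕ) {φ : FormalDiff n} (hφ : IsUnipotentDiff φ) :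
    IsNilpotent ((jetHom n k φ : Module.End ℂ (JetSpace n k)) - 1) := by
  rw [coe_jetHom_of_isUnipotentDiff k hφ]
  exact IsNilpotent.isNilpotent_exp_sub_one (isNilpotent_jetVF k (log φ).2)

lemma coe_jetHom_oneParam (k : ℕ) (φ : FormalDiff n) (t : ℂ) :
    (jetHom n k (oneParam φ t) : Module.End ℂ (JetSpace n k)) =
      IsNilpotent.exp (t • jetVF k (log φ).1) := by
  rw [oneParam, coe_jetHom_exp, ← jetVF_smul]
  rfl

end Logarithm

/-! ### The groups `G_k` and the pro-algebraic closure of a unipotent group -/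

section JetClosure

variable {n : ℕ} {G : Subgroup (FormalDiff n)}

lemma isNilpotent_sub_one_of_mem_map (hG : IsUnipotentGroup G) (k : ℕ) :
    ∀ A ∈ G.map (jetHom n k), IsNilpotent ((A : Module.End ℂ (JetSpace n k)) - 1) := by
  rintro _ ⟨φ, hφ, rfl⟩
  exact isNilpotent_jetHom_sub_one k (hG φ hφ)

/-- The logarithms of the jets of `G` lie in the linear space of jets of vector fields. Lying there
is a polynomial condition, so it passes to the Zariski closure, and exponentiating returns to jets
of diffeomorphisms. -/
lemma unipotentClosure_le_jetGroup (hG : IsUnipotentGroup G) (k : ℕ) :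
    unipotentClosure (G.map (jetHom n k)) (isNilpotent_sub_one_of_mem_map hG k) ≤
      jetGroup n k := by
  intro A hA
  have hAn := isNilpotent_of_mem_unipotentClosure (isNilpotent_sub_one_of_mem_map hG k) hA
  have hlog : logEnd (A : Module.End ℂ (JetSpace n k)) ∈ LinearMap.range (jetVFLin n k) := by
    rw [mem_iff_forall_dual]
    intro l hl
    refine hA (fun a => l (logEnd a)) (isRegular_logEnd isRegular_id l) ?_
    rintro _ ⟨_, ⟨φ, hφ, rfl⟩, rfl⟩
    rw [coe_jetHom_of_isUnipotentDiff k (hG φ hφ), logEnd_exp (isNilpotent_jetVF k (log φ).2)]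
    exact hl _ ⟨_, rfl⟩
  obtain ⟨X, hX⟩ := hlog
  rw [jetVFLin_apply] at hX
  -- For `k = 0` the jet space is zero and says nothing about the linear part of `X`.
  rcases Nat.eq_zero_or_pos k with rfl | hk
  · refine ⟨1, Units.ext (LinearMap.ext fun v => ?_)⟩
    have : ∀ v : JetSpace n 0, v = 0 := by
      intro v
      obtain ⟨f, hf, rfl⟩ := jetMk_surjective 0 v
      rw [jetMk_eq_zero]
      simpa using hf
    exact (this _).trans (this _).symm
  · have hXn : IsNilpotentVF X :=
      isNilpotentVF_of_jetVF hk (hX ▸ isNilpotent_logEnd hAn)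
    refine ⟨exp ⟨X, hXn⟩, Units.ext ?_⟩
    rw [coe_jetHom_exp, hX, exp_logEnd hAn]

lemma jetClosure_eq_unipotentClosure (hG : IsUnipotentGroup G) (k : ℕ) :
    jetClosure G k =
      unipotentClosure (G.map (jetHom n k)) (isNilpotent_sub_one_of_mem_map hG k) := by
  refine le_antisymm (sInf_le ⟨isAlgebraicGroup_unipotentClosure _,
    unipotentClosure_le_jetGroup hG k, le_unipotentClosure _⟩) (le_sInf ?_)
  rintro H ⟨hH, -, hGH⟩ A hA
  exact coe_mem_of_mem_zariskiClosure hH hGH hA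

lemma isAlgebraicGroup_jetClosure (hG : IsUnipotentGroup G) (k : ℕ) :
    IsAlgebraicGroup (jetClosure G k) := by
  rw [jetClosure_eq_unipotentClosure hG]
  exact isAlgebraicGroup_unipotentClosure _

lemma isNilpotent_of_mem_jetClosure (hG : IsUnipotentGroup G) (k : ℕ) :
    ∀ A ∈ jetClosure G k, IsNilpotent ((A : Module.End ℂ (JetSpace n k)) - 1) := by
  intro A hA
  rw [jetClosure_eq_unipotentClosure hG] at hA
  exact isNilpotent_of_mem_unipotentClosure _ hA

lemma map_le_jetClosure (G : Subgroup (FormalDiff n)) (k : ℕ) :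
    G.map (jetHom n k) ≤ jetClosure G k := le_sInf fun _ hH => hH.2.2

lemma jetClosure_eq_map (k : ℕ) (h : IsAlgebraicGroup (G.map (jetHom n k))) :
    jetClosure G k = G.map (jetHom n k) :=
  le_antisymm (sInf_le ⟨h, Subgroup.map_le_range _ _, le_rfl⟩) (map_le_jetClosure G k)

lemma mem_proClosure {φ : FormalDiff n} :
    φ ∈ proClosure G ↔ ∀ k, jetHom n k φ ∈ jetClosure G k := by
  simp [proClosure, Subgroup.mem_iInf]

lemma le_proClosure (G : Subgroup (FormalDiff n)) : G ≤ proClosure G := fun φ hφ =>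
  mem_proClosure.mpr fun k => map_le_jetClosure G k ⟨φ, hφ, rfl⟩

lemma isUnipotentGroup_proClosure (hG : IsUnipotentGroup G) : IsUnipotentGroup (proClosure G) :=
  fun _ hφ => isNilpotent_of_mem_jetClosure hG 1 _ (mem_proClosure.mp hφ 1)

lemma isClosed_proClosure (G : Subgroup (FormalDiff n)) :
    IsClosed (proClosure G : Set (FormalDiff n)) := by
  refine isClosed_of_closure_subset fun φ hφ => mem_proClosure.mpr fun k => ?_
  obtain ⟨ψ, hψ, h⟩ := mem_closure_diff_iff.mp hφ k
  exact h ▸ mem_proClosure.mp hψ k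

/-- The Lie algebra of the algebraic group `Gₖ`. -/
def jetLogSubmodule (hG : IsUnipotentGroup G) (k : ℕ) : Submodule ℂ (Module.End ℂ (JetSpace n k)) :=
  logSubmodule (isAlgebraicGroup_jetClosure hG k) (isNilpotent_of_mem_jetClosure hG k)

lemma jetVF_mem_jetLogSubmodule (hG : IsUnipotentGroup G) {k : ℕ} (X : NilVF n) :
    jetVF k X.1 ∈ jetLogSubmodule hG k ↔ jetHom n k (exp X) ∈ jetClosure G k := by
  have h := isNilpotent_jetVF k X.2
  rw [← coe_mem_endSet, coe_jetHom_exp]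
  exact ⟨fun h => h.2, fun h' => ⟨h, h'⟩⟩

lemma isNilpotentLie_jetLogSubmodule (hG : IsUnipotentGroup G) (k : ℕ) :
    IsNilpotentLie (jetLogSubmodule hG k) where
  lie_mem _ ha _ hb := lie_mem_logSet (isAlgebraicGroup_jetClosure hG k)
    (isNilpotent_of_mem_jetClosure hG k) ha hb
  isNilpotent _ ha := ha.1

lemma oneParam_mem_proClosure (hG : IsUnipotentGroup G) {φ : FormalDiff n}
    (hφ : φ ∈ proClosure G) (t : ℂ) : oneParam φ t ∈ proClosure G := by
  rw [mem_proClosure]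
  intro k
  refine (jetVF_mem_jetLogSubmodule hG _).mp ?_
  change jetVF k (t • (log φ).1) ∈ _
  rw [jetVF_smul]
  refine Submodule.smul_mem _ t ((jetVF_mem_jetLogSubmodule hG _).mpr ?_)
  rw [exp_log (isUnipotentGroup_proClosure hG φ hφ)]
  exact mem_proClosure.mp hφ k

end JetClosure

end FormalLie

end
noncomputable section

namespace FormalLie

/-! ### The correspondence between Lie algebras and pro-algebraic groups -/

section Correspondence

variable {n : ℕ}

/-- The Lie algebra of `k`-jets of a Lie algebra of formal vector fields. -/
def jetLie (g : LieSubalgebra ℂ (FormalVF n)) (k : ℕ) :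
    Submodule ℂ (Module.End ℂ (JetSpace n k)) :=
  g.toSubmodule.map (jetVFLin n k)

lemma isNilpotentLie_jetLie {g : LieSubalgebra ℂ (FormalVF n)} (hg : ∀ X ∈ g, IsNilpotentVF X)
    (k : ℕ) : IsNilpotentLie (jetLie g k) where
  lie_mem := by
    rintro _ ⟨X, hX, rfl⟩ _ ⟨Y, hY, rfl⟩
    exact ⟨⁅X, Y⁆, g.lie_mem hX hY, jetVF_lie k X Y⟩
  isNilpotent := by
    rintro _ ⟨X, hX, rfl⟩
    exact isNilpotent_jetVF k (hg X hX)

/-- This is where Krull closedness of `g` enters: a closed set is recovered from its jets. -/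
lemma mem_of_forall_jetVF_mem_jetLie {g : LieSubalgebra ℂ (FormalVF n)}
    (hc : IsClosed (g : Set (FormalVF n))) {X : FormalVF n} (h : ∀ k, jetVF k X ∈ jetLie g k) :
    X ∈ g := by
  rw [← SetLike.mem_coe, ← hc.closure_eq, mem_closure_VF_iff]
  exact h

/-- The group of formal diffeomorphisms whose jets are exponentials of the jets of elements
of `g`. -/
def expSubgroup (g : LieSubalgebra ℂ (FormalVF n)) (hg : ∀ X ∈ g, IsNilpotentVF X) :
    Subgroup (FormalDiff n) :=
  ⨅ k, (expGroup (isNilpotentLie_jetLie hg k)).comap (jetHom n k)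

variable {g : LieSubalgebra ℂ (FormalVF n)} (hg : ∀ X ∈ g, IsNilpotentVF X)

lemma mem_expSubgroup {φ : FormalDiff n} : φ ∈ expSubgroup g hg ↔
    ∀ k, jetHom n k φ ∈ expGroup (isNilpotentLie_jetLie hg k) := by
  simp [expSubgroup, Subgroup.mem_iInf]

lemma isUnipotentGroup_expSubgroup : IsUnipotentGroup (expSubgroup g hg) := fun _ hφ =>
  isNilpotent_sub_one_of_mem_expGroup _ ((mem_expSubgroup hg).mp hφ 1)

lemma exp_mem_expSubgroup {X : NilVF n} (hX : X.1 ∈ g) : exp X ∈ expSubgroup g hg :=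
  (mem_expSubgroup hg).mpr fun k => ⟨jetVF k X.1, ⟨X.1, hX, rfl⟩, (coe_jetHom_exp k X).symm⟩

lemma coe_expSubgroup (hc : IsClosed (g : Set (FormalVF n))) :
    (expSubgroup g hg : Set (FormalDiff n)) = expSet g := by
  ext φ
  constructor
  · intro hφ
    obtain ⟨X, rfl⟩ := exists_exp_eq_of_isUnipotentDiff (isUnipotentGroup_expSubgroup hg φ hφ)
    refine ⟨X, mem_of_forall_jetVF_mem_jetLie hc fun k => ?_, rfl⟩
    have h := (mem_expSubgroup hg).mp hφ k
    rwa [← coe_mem_endSet, coe_jetHom_exp, exp_mem_endSet_expGroup _ (isNilpotent_jetVF k X.2)] at h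
  · rintro ⟨X, hX, rfl⟩
    exact exp_mem_expSubgroup hg hX

/-- An element of `exp g_k` is the exponential of a jet that lifts to some `X ∈ g`, and `exp X` has
the right jets at every level. -/
lemma map_expSubgroup (k : ℕ) :
    (expSubgroup g hg).map (jetHom n k) = expGroup (isNilpotentLie_jetLie hg k) := by
  refine le_antisymm ?_ ?_
  · rintro _ ⟨φ, hφ, rfl⟩
    exact (mem_expSubgroup hg).mp hφ k
  · rintro A ⟨_, ⟨X, hX, rfl⟩, hA⟩
    exact ⟨exp ⟨X, hg X hX⟩, exp_mem_expSubgroup hg hX, Units.ext ((coe_jetHom_exp k _).trans hA)⟩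

lemma jetClosure_expSubgroup (k : ℕ) :
    jetClosure (expSubgroup g hg) k = expGroup (isNilpotentLie_jetLie hg k) := by
  rw [jetClosure_eq_map, map_expSubgroup]
  rw [map_expSubgroup]
  exact isAlgebraicGroup_expGroup _

lemma isProAlgebraic_expSubgroup : IsProAlgebraic (expSubgroup g hg) := by
  simp only [IsProAlgebraic, proClosure, jetClosure_expSubgroup]
  rfl

lemma proLie_expSubgroup (hc : IsClosed (g : Set (FormalVF n))) :
    proLie (expSubgroup g hg) = (g : Set (FormalVF n)) := by
  ext X
  simp only [proLie, jetClosure_expSubgroup, lieAlgebraOf_expGroup]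
  exact ⟨fun h => mem_of_forall_jetVF_mem_jetLie hc h, fun h k => ⟨X, h, rfl⟩⟩

/-- The Lie algebra of the pro-algebraic closure of a unipotent group. -/
def logLie {G : Subgroup (FormalDiff n)} (hG : IsUnipotentGroup G) :
    LieSubalgebra ℂ (FormalVF n) where
  carrier := {X | ∀ k, jetVF k X ∈ jetLogSubmodule hG k}
  add_mem' {X Y} hX hY k := by
    rw [← jetVFLin_apply, map_add]
    exact add_mem (hX k) (hY k)
  zero_mem' k := by
    rw [← jetVFLin_apply, map_zero]
    exact zero_mem _
  smul_mem' c X hX k := by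
    rw [jetVF_smul]
    exact Submodule.smul_mem _ c (hX k)
  lie_mem' {X Y} hX hY k := by
    rw [jetVF_lie]
    exact (isNilpotentLie_jetLogSubmodule hG k).lie_mem _ (hX k) _ (hY k)

variable {G : Subgroup (FormalDiff n)} (hG : IsUnipotentGroup G)

lemma isNilpotentVF_of_mem_logLie {X : FormalVF n} (hX : X ∈ logLie hG) : IsNilpotentVF X :=
  (isNilpotentLie_jetLogSubmodule hG 1).isNilpotent _ (hX 1)

lemma isClosed_logLie : IsClosed (logLie hG : Set (FormalVF n)) := by
  refine isClosed_of_closure_subset fun X hX k => ?_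
  obtain ⟨Y, hY, h⟩ := mem_closure_VF_iff.mp hX k
  exact h ▸ hY k

lemma expSet_logLie : expSet (logLie hG) = (proClosure G : Set (FormalDiff n)) := by
  ext φ
  constructor
  · rintro ⟨X, hX, rfl⟩
    exact mem_proClosure.mpr fun k => (jetVF_mem_jetLogSubmodule hG X).mp (hX k)
  · intro hφ
    obtain ⟨X, rfl⟩ := exists_exp_eq_of_isUnipotentDiff (isUnipotentGroup_proClosure hG φ hφ)
    exact ⟨X, fun k => (jetVF_mem_jetLogSubmodule hG X).mpr (mem_proClosure.mp hφ k), rfl⟩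

lemma le_of_expSet_subset {g g' : LieSubalgebra ℂ (FormalVF n)} (hg : ∀ X ∈ g, IsNilpotentVF X)
    (h : expSet g ⊆ expSet g') : g ≤ g' := by
  intro X hX
  obtain ⟨Y, hY, hYX⟩ := h ⟨⟨X, hg X hX⟩, hX, rfl⟩
  have := exp_injective hYX
  subst this
  exact hY

/-! ### One-parameter groups -/

/-- The group generated by the one-parameter groups of the elements of `G`. -/
def oneParamClosure (G : Subgroup (FormalDiff n)) : Subgroup (FormalDiff n) :=
  Subgroup.closure (⋃ φ ∈ G, Set.range fun t : ℂ => oneParam φ t)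

lemma oneParam_mem_oneParamClosure {φ : FormalDiff n} (hφ : φ ∈ G) (t : ℂ) :
    oneParam φ t ∈ oneParamClosure G :=
  Subgroup.subset_closure (Set.mem_biUnion hφ ⟨t, rfl⟩)

lemma oneParamClosure_le {H : Subgroup (FormalDiff n)} (h : ∀ φ ∈ G, ∀ t, oneParam φ t ∈ H) :
    oneParamClosure G ≤ H := by
  rw [oneParamClosure, Subgroup.closure_le]
  refine Set.iUnion₂_subset ?_
  rintro φ hφ _ ⟨t, rfl⟩
  exact h φ hφ t

include hG in
-- The Lie algebra generated by the logarithms of the jets of `G` has an algebraic exponential group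
-- containing these jets, hence containing `G_k`; and that group is generated by the one-parameter
-- groups.
lemma jetClosure_le_map_oneParamClosure (k : ℕ) :
    jetClosure G k ≤ (oneParamClosure G).map (jetHom n k) := by
  let S : Set (Module.End ℂ (JetSpace n k)) := {a | ∃ φ ∈ G, jetVF k (log φ).1 = a}
  let 𝒲 : Set (Submodule ℂ (Module.End ℂ (JetSpace n k))) :=
    {W | S ⊆ W ∧ ∀ a ∈ W, ∀ b ∈ W, a * b - b * a ∈ W}
  let g : Submodule ℂ (Module.End ℂ (JetSpace n k)) := sInf 𝒲
  have hSC : S ⊆ jetLogSubmodule hG k := by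
    rintro _ ⟨φ, hφ, rfl⟩
    refine (jetVF_mem_jetLogSubmodule hG _).mpr ?_
    rw [exp_log (hG φ hφ)]
    exact map_le_jetClosure G k ⟨φ, hφ, rfl⟩
  have hgC : g ≤ jetLogSubmodule hG k :=
    sInf_le ⟨hSC, (isNilpotentLie_jetLogSubmodule hG k).lie_mem⟩
  have hSg : S ⊆ g := fun a ha => Submodule.mem_sInf.mpr fun W hW => hW.1 ha
  have hg : IsNilpotentLie g :=
    { lie_mem := fun a ha b hb => Submodule.mem_sInf.mpr fun W hW =>
        hW.2 a (Submodule.mem_sInf.mp ha W hW) b (Submodule.mem_sInf.mp hb W hW)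
      isNilpotent := fun a ha => (isNilpotentLie_jetLogSubmodule hG k).isNilpotent a (hgC ha) }
  have hle : (oneParamClosure G).map (jetHom n k) ≤ expGroup hg := by
    rw [Subgroup.map_le_iff_le_comap]
    refine oneParamClosure_le fun φ hφ t => ?_
    exact ⟨_, g.smul_mem t (hSg ⟨φ, hφ, rfl⟩), (coe_jetHom_oneParam k φ t).symm⟩
  have hge : expGroup hg ≤ (oneParamClosure G).map (jetHom n k) := by
    refine expGroup_le_of_generates hg hle hSg (fun W h1 h2 => sInf_le ⟨h1, h2⟩) ?_
    rintro _ ⟨φ, hφ, rfl⟩ t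
    rw [← coe_jetHom_oneParam, coe_mem_endSet]
    exact ⟨_, oneParam_mem_oneParamClosure hφ t, rfl⟩
  refine le_trans (sInf_le ⟨isAlgebraicGroup_expGroup hg, hge.trans (Subgroup.map_le_range _ _),
    ?_⟩) hge
  rintro _ ⟨φ, hφ, rfl⟩
  exact ⟨_, hSg ⟨φ, hφ, rfl⟩, (coe_jetHom_of_isUnipotentDiff k (hG φ hφ)).symm⟩

include hG in
-- Agreement of jets at every level is exactly adherence in the Krull topology.
lemma proClosure_eq_closure_oneParamClosure :
    (proClosure G : Set (FormalDiff n)) = closure (oneParamClosure G : Set (FormalDiff n)) := by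
  refine Set.Subset.antisymm ?_ ?_
  · intro φ hφ
    rw [mem_closure_diff_iff]
    exact fun k => jetClosure_le_map_oneParamClosure hG k (mem_proClosure.mp hφ k)
  · refine closure_minimal ?_ (isClosed_proClosure G)
    exact oneParamClosure_le fun φ hφ t => oneParam_mem_proClosure hG (le_proClosure G hφ) t

end Correspondence

end FormalLie

end

theorem mainTheorem7 (n : ℕ) :
    -- the exponential is a bijection from nilpotent vector fields to unipotent diffeomorphisms,
    -- so that `log` and the one-parameter groups are well defined
    Set.BijOn (exp : NilVF n → FormalDiff n) Set.univ {φ | IsUnipotentDiff φ} ∧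
    -- the exponential of a Krull-closed Lie algebra of nilpotent vector fields is a unipotent
    -- pro-algebraic group with that Lie algebra
    (∀ g : LieSubalgebra ℂ (FormalVF n), (∀ X ∈ g, IsNilpotentVF X) →
      IsClosed (g : Set (FormalVF n)) →
      ∃ H : Subgroup (FormalDiff n), (H : Set (FormalDiff n)) = expSet g ∧
        IsProAlgebraic H ∧ IsUnipotentGroup H ∧ proLie H = (g : Set (FormalVF n))) ∧
    -- the correspondence is bijective
    Set.BijOn (fun g : LieSubalgebra ℂ (FormalVF n) => expSet g)
      {g | (∀ X ∈ g, IsNilpotentVF X) ∧ IsClosed (g : Set (FormalVF n))}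
      {S | ∃ H : Subgroup (FormalDiff n), (H : Set (FormalDiff n)) = S ∧
        IsProAlgebraic H ∧ IsUnipotentGroup H} ∧
    -- the pro-algebraic closure of a unipotent group
    (∀ G : Subgroup (FormalDiff n), IsUnipotentGroup G →
      (proClosure G : Set (FormalDiff n)) =
        closure (Subgroup.closure (⋃ φ ∈ G, Set.range fun t : ℂ => oneParam φ t) :
          Set (FormalDiff n))) ∧
    -- the characterization of unipotent pro-algebraic groups
    (∀ G : Subgroup (FormalDiff n), IsUnipotentGroup G →
      (IsProAlgebraic G ↔ IsClosed (G : Set (FormalDiff n)) ∧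
        ∀ φ ∈ G, ∀ t : ℂ, oneParam φ t ∈ G)) := by
  refine ⟨⟨fun X _ => isUnipotentDiff_exp X, exp_injective.injOn, fun φ hφ => ?_⟩,
    fun g hg hc => ⟨expSubgroup g hg, coe_expSubgroup hg hc, isProAlgebraic_expSubgroup hg,
      isUnipotentGroup_expSubgroup hg, proLie_expSubgroup hg hc⟩,
    ⟨fun g hg => ⟨expSubgroup g hg.1, coe_expSubgroup hg.1 hg.2, isProAlgebraic_expSubgroup hg.1,
      isUnipotentGroup_expSubgroup hg.1⟩, fun g hg g' hg' h => ?_, ?_⟩,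
    fun G hG => proClosure_eq_closure_oneParamClosure hG, fun G hG => ⟨fun h => ?_, fun h => ?_⟩⟩
  · obtain ⟨X, hX⟩ := exists_exp_eq_of_isUnipotentDiff hφ
    exact ⟨X, Set.mem_univ X, hX⟩
  · exact le_antisymm (le_of_expSet_subset hg.1 h.subset) (le_of_expSet_subset hg'.1 h.superset)
  · rintro _ ⟨H, rfl, hH, hHu⟩
    -- Surjectivity: the preimage of `H` consists of the fields whose jets are logarithms of
    -- elements of the groups `H_k`.
    refine ⟨logLie hHu, ⟨fun X hX => isNilpotentVF_of_mem_logLie hHu hX, isClosed_logLie hHu⟩, ?_⟩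
    refine (expSet_logLie hHu).trans ?_
    rw [← show H = proClosure H from hH]
  · rw [show G = proClosure G from h]
    exact ⟨isClosed_proClosure G,
      fun φ hφ t => oneParam_mem_proClosure hG hφ t⟩
  · refine le_antisymm (le_proClosure G) fun φ hφ => ?_
    have h1 : φ ∈ closure (oneParamClosure G : Set (FormalDiff n)) :=
      proClosure_eq_closure_oneParamClosure hG ▸ hφ
    exact closure_minimal (oneParamClosure_le h.2) h.1 h1
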